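/- Let $\alpha>0$, $h\in\mathbb R$ and let $\hat e_3=(0,0,1)$. Let $j\in L^\infty((0,\infty);L^{6/5}(\mathbb R^3;\mathbb R^3))$ be a fixed current density, and let $m_0\in H^2(\mathbb R^3;\mathbb S^2):=\{m:\mathbb R^3\to\mathbb S^2:\ m-\hat e_3\in H^2(\mathbb R^3;\mathbb R^3)\}$. Consider the Landau–Lifshitz–Gilbert equation $$\partial_t m = m\times\big(\alpha\,\partial_t m+\Delta m+\Delta^2 m-h\,\hat e_3\big)-(j\cdot\nabla)m\qquad\text{in }(0,\infty)\times\mathbb R^3,$$ understood in the sense of distributions, where for $m$ as below $m\times\Delta^2 m$ denotes the distribution $\Delta(m\times\Delta m)-2\sum_{k=1}^3\partial_k(\partial_k m\times\Delta m)$. Then there is at most one solution $$m\in L^\infty\big((0,\infty);H^2(\mathbb R^3;\mathbb S^2)\big)\cap\dot H^1\big((0,\infty);L^2(\mathbb R^3;\mathbb R^3)\big)$$ with initial value $m|_{t=0}=m_0$: if $m_1$ and $m_2$ are two such solutions (for the same $j$ and $m_0$), then $m_1(t)=m_2(t)$ almost everywhere in $\mathbb R^3$ for almost every $t>0$. Here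 $\partial_t m\in L^2((0,\infty)\times\mathbb R^3)$, so that $m-\hat e_3$ has a representative that is continuous on $[0,\infty)$ with values in $L^2$, and the initial value is the value of that representative at $t=0$. -/

import Mathlib

open MeasureTheory Filter Topology Set
open scoped ENNReal NNReal ContDiff Distributions InnerProductSpace

noncomputable section

namespace LLG

/-- Euclidean three-space. It is both the spatial domain and the target of the vector fields. -/
abbrev E3 : Type := EuclideanSpace ℝ (Fin 3)

/-- The `k`-th standard basis vector. -/
def e (k : Fin 3) : E3 := EuclideanSpace.single k (1 : ℝ)

/-- The third standard basis vector, the direction of the Zeeman field and the value of the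
magnetization at infinity. -/
def e₃ : E3 := e 2

/-- The cross product on Euclidean three-space. -/
def cross (a b : E3) : E3 := WithLp.toLp 2 (crossProduct a.ofLp b.ofLp)

/-- Lebesgue measure on `(0,∞)`. -/
def timeMeasure : Measure ℝ := volume.restrict (Ioi 0)

/-- Lebesgue measure on the space-time domain `(0,∞) × ℝ³`. -/
def spaceTimeMeasure : Measure (ℝ × E3) := timeMeasure.prod volume

/-- The space-time domain `(0,∞) × ℝ³` as an open subset of `ℝ × ℝ³`. -/
def spaceTime : TopologicalSpace.Opens (ℝ × E3) :=
  ⟨Ioi 0 ×ˢ univ, isOpen_Ioi.prod isOpen_univ⟩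

/-- `u ∈ L^∞((0,∞); L^p(ℝ³;ℝ³))`, for a time-dependent vector field `u t x`. -/
def MemLinfLp (p : ℝ≥0∞) (u : ℝ → E3 → E3) : Prop :=
  AEStronglyMeasurable (fun z : ℝ × E3 => u z.1 z.2) spaceTimeMeasure ∧
    ∃ C : ℝ≥0, ∀ᵐ t ∂timeMeasure, eLpNorm (u t) p volume ≤ C

/-- The vector field `g` on `ℝ³` is the weak partial derivative `∂_k u`. -/
def IsWeakPartial (k : Fin 3) (u g : E3 → E3) : Prop :=
  LocallyIntegrable u volume ∧ LocallyIntegrable g volume ∧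
    ∀ φ : 𝓓((⊤ : TopologicalSpace.Opens E3), ℝ),
      ∫ x, (fderiv ℝ φ x (e k)) • u x = -∫ x, φ x • g x

/-- `m₀ ∈ H²(ℝ³;𝕊²)`: the field has values in the unit sphere, and `m₀ - e₃` is in
`H²(ℝ³;ℝ³)`, i.e. it is square integrable with its weak derivatives of order one and two. -/
def MemH2Sphere (m₀ : E3 → E3) : Prop :=
  (∀ᵐ x, ‖m₀ x‖ = 1) ∧
  MemLp (fun x => m₀ x - e₃) 2 volume ∧
  ∃ (D : Fin 3 → E3 → E3) (D2 : Fin 3 → Fin 3 → E3 → E3),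
    (∀ k, MemLp (D k) 2 volume ∧ IsWeakPartial k (fun x => m₀ x - e₃) (D k)) ∧
    (∀ i k, MemLp (D2 i k) 2 volume ∧ IsWeakPartial i (D k) (D2 i k))

/-- `m` belongs to `L^∞((0,∞); H²(ℝ³;𝕊²)) ∩ Ḣ¹((0,∞); L²(ℝ³;ℝ³))`, and `mt`, `D k`, `D2 i k`
are (representatives of) its weak derivatives `∂ₜm`, `∂_k m`, `∂_i∂_k m`. -/
structure IsRegular (m mt : ℝ → E3 → E3) (D : Fin 3 → ℝ → E3 → E3)
    (D2 : Fin 3 → Fin 3 → ℝ → E3 → E3) : Prop where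
  /-- `m` takes values in the unit sphere. -/
  sphere : ∀ᵐ t ∂timeMeasure, ∀ᵐ x, ‖m t x‖ = 1
  /-- `m - e₃ ∈ L^∞((0,∞); L²)`. -/
  memL2 : MemLinfLp 2 (fun t x => m t x - e₃)
  /-- `∂_k m ∈ L^∞((0,∞); L²)`. -/
  memL2_D : ∀ k, MemLinfLp 2 (D k)
  /-- `∂_i∂_k m ∈ L^∞((0,∞); L²)`. -/
  memL2_D2 : ∀ i k, MemLinfLp 2 (D2 i k)
  /-- At almost every time `D k` is the weak partial derivative `∂_k` of `m - e₃`. -/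
  weak_D : ∀ᵐ t ∂timeMeasure, ∀ k, IsWeakPartial k (fun x => m t x - e₃) (D k t)
  /-- At almost every time `D2 i k` is the weak partial derivative `∂_i` of `D k`. -/
  weak_D2 : ∀ᵐ t ∂timeMeasure, ∀ i k, IsWeakPartial i (D k t) (D2 i k t)
  /-- `∂ₜm ∈ L²((0,∞); L²) = L²((0,∞) × ℝ³)`. -/
  memL2_mt : MemLp (fun z : ℝ × E3 => mt z.1 z.2) 2 spaceTimeMeasure
  /-- `mt` is the weak time derivative of `m` in `(0,∞) × ℝ³`. -/
  weak_mt : ∀ φ : 𝓓(spaceTime, ℝ),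
    ∫ z, (fderiv ℝ φ z ((1 : ℝ), (0 : E3))) • m z.1 z.2 ∂spaceTimeMeasure =
      -∫ z, φ z • mt z.1 z.2 ∂spaceTimeMeasure

/-- `m`, of class `L^∞((0,∞); H²(ℝ³;𝕊²)) ∩ Ḣ¹((0,∞); L²(ℝ³;ℝ³))`, solves
`∂ₜm = m × (α ∂ₜm + Δm + Δ²m - h e₃) - (j·∇)m` in the sense of distributions on `(0,∞) × ℝ³`.
For a field `m` of this regularity the fourth order term is the distribution
`m × Δ²m = Δ(m × Δm) - 2 ∑ₖ ∂ₖ(∂ₖm × Δm)`, and all other terms are locally integrable. -/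
def IsSolution (α h : ℝ) (j m : ℝ → E3 → E3) : Prop :=
  ∃ (mt : ℝ → E3 → E3) (D : Fin 3 → ℝ → E3 → E3) (D2 : Fin 3 → Fin 3 → ℝ → E3 → E3),
    IsRegular m mt D D2 ∧
    ∀ φ : 𝓓(spaceTime, E3),
      ∫ z, ⟪mt z.1 z.2, φ z⟫_ℝ ∂spaceTimeMeasure =
        ∫ z,
          (⟪cross (m z.1 z.2) (α • mt z.1 z.2 + ∑ k, D2 k k z.1 z.2 - h • e₃), φ z⟫_ℝ
          + ⟪cross (m z.1 z.2) (∑ k, D2 k k z.1 z.2),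
              Laplacian.laplacian (fun y : E3 => φ (z.1, y)) z.2⟫_ℝ
          + 2 * ∑ k, ⟪cross (D k z.1 z.2) (∑ l, D2 l l z.1 z.2),
              fderiv ℝ (fun y : E3 => φ (z.1, y)) z.2 (e k)⟫_ℝ
          - ⟪∑ k, (j z.1 z.2 k) • D k z.1 z.2, φ z⟫_ℝ) ∂spaceTimeMeasure

/-- `m|_{t=0} = m₀`, as the `L²`-trace at time zero: the essential limit of `‖m(t) - m₀‖_{L²}`
as `t → 0+` is zero. Fields with `∂ₜm ∈ L²((0,∞) × ℝ³)` agree, after modification on a null set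
of times, with a map that is continuous on `[0,∞)` in `L²`; this is its value at zero. -/
def HasInitialValue (m : ℝ → E3 → E3) (m₀ : E3 → E3) : Prop :=
  Tendsto (fun t => eLpNorm (fun x => m t x - m₀ x) 2 volume) (𝓝[>] (0 : ℝ) ⊓ ae volume) (𝓝 0)

end LLG

end

noncomputable section

namespace LLG

/-! ### The cross product on Euclidean three-space -/

/-! Let w = m - m' be the difference of two solutions, a and a' their time derivatives, c = (j·∇)m
and c' = (j·∇)m'. Only two spatial derivatives exist, so both equations are tested with fields of
class H². By the triple product rule, the equation for m tested with ψ says that ⟨a + c, ψ⟩ - ⟨αa +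
Δm - h e₃, ψ × m⟩ - ⟨Δm, Δ(ψ × m)⟩ has integral zero (`weakForm_eq`).

The choice ψ = w + α m × m' works because, with q = |w|²/2, the sphere constraint gives ψ × m = m ×
m' - α w + α q m and ψ × m' = m × m' - α w - α q m'. In the difference of the equations the terms
α⟨a - a', m × m'⟩ cancel, while -α w yields α²⟨a - a', w⟩ and the coercive term α|Δw|². The leftover
multiples of ⟨a, m⟩ and ⟨a', m'⟩ disappear when the first equation is tested in addition with α² q m
and the second with -α² q m': fields parallel to the magnetization do not see the torque. The term
⟨Δw, Δ(m × m')⟩ is harmless since m × m' = w × m' and Δw × m' is orthogonal to Δw. The result is the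
pointwise identity `weakForm_difference`, whose error terms are all at least quadratic in w and its
derivatives.

The errors are controlled by Hölder's inequality, the uniform bounds on Δm in L² and on ∇m in L⁴,
and the inequalities ‖w‖_∞ + ‖∇w‖₄ ≤ δ‖Δw‖₂ + C‖w‖₂ with δ arbitrarily small and ‖∇w‖₆ ≤ C‖Δw‖₂. The
current contributes ‖j‖_{6/5}‖∇w‖₆‖w‖_∞, which also carries a small factor. Absorbing ‖Δw‖₂² leaves
∫⟨a - a', w⟩ ≤ K‖w‖₂² (`exists_energy_le`). The identity ‖w(t)‖₂² = 2∫₀ᵗ∫⟨a - a', w⟩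
(`energy_identity_diff`) and Gronwall's inequality (`ae_eq_zero_of_le_integral`) then give w = 0.

Two devices make this rigorous. `H2` is the closure of the second order jets of test functions; by
`H2.of_weak` it contains the fields with square integrable weak derivatives, and by `H2.bilin` it is
stable under products, so the test fields above are admissible. And since ψ depends on the solutions
at the given time, the equation must hold at almost every time for all H² test fields at once;
`IsSolution.exists_slice` obtains this from a countable dense family of test functions. -/

@[simp] theorem cross_zero_apply (a b : E3) : cross a b 0 = a 1 * b 2 - a 2 * b 1 := by
  simp [cross, crossProduct]

@[simp] theorem cross_one_apply (a b : E3) : cross a b 1 = a 2 * b 0 - a 0 * b 2 := by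
  simp [cross, crossProduct]

@[simp] theorem cross_two_apply (a b : E3) : cross a b 2 = a 0 * b 1 - a 1 * b 0 := by
  simp [cross, crossProduct]

theorem E3.ext_three {a b : E3} (h0 : a 0 = b 0) (h1 : a 1 = b 1) (h2 : a 2 = b 2) : a = b := by
  ext i; fin_cases i <;> assumption

theorem inner_E3 (a b : E3) : ⟪a, b⟫_ℝ = a 0 * b 0 + a 1 * b 1 + a 2 * b 2 := by
  simp [PiLp.inner_apply, Fin.sum_univ_three, mul_comm]

theorem inner_cross_left (a b c : E3) : ⟪cross a b, c⟫_ℝ = ⟪b, cross c a⟫_ℝ := by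
  simp only [inner_E3, cross_zero_apply, cross_one_apply, cross_two_apply]; ring

theorem inner_cross_self_right (a b : E3) : ⟪b, cross a b⟫_ℝ = 0 := by
  simp only [inner_E3, cross_zero_apply, cross_one_apply, cross_two_apply]; ring

theorem cross_add_left (a b c : E3) : cross (a + b) c = cross a c + cross b c := by
  apply E3.ext_three <;> simp <;> ring

theorem cross_add_right (a b c : E3) : cross a (b + c) = cross a b + cross a c := by
  apply E3.ext_three <;> simp <;> ring

theorem cross_smul_left (r : ℝ) (a b : E3) : cross (r • a) b = r • cross a b := by
  apply E3.ext_three <;> simp <;> ring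

theorem cross_smul_right (r : ℝ) (a b : E3) : cross a (r • b) = r • cross a b := by
  apply E3.ext_three <;> simp <;> ring

theorem norm_cross_le (a b : E3) : ‖cross a b‖ ≤ ‖a‖ * ‖b‖ := by
  refine abs_le_of_sq_le_sq' ?_ (by positivity) |>.2
  have : ∀ v : E3, ‖v‖ ^ 2 = v 0 * v 0 + v 1 * v 1 + v 2 * v 2 := fun v => by
    rw [← real_inner_self_eq_norm_sq, inner_E3]
  rw [mul_pow, this, this, this]
  simp only [cross_zero_apply, cross_one_apply, cross_two_apply]
  nlinarith [sq_nonneg (a 0 * b 0 + a 1 * b 1 + a 2 * b 2)]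

/-- The cross product as a continuous bilinear map. -/
def crossL : E3 →L[ℝ] E3 →L[ℝ] E3 :=
  LinearMap.mkContinuous₂
    (LinearMap.mk₂ ℝ cross cross_add_left cross_smul_left cross_add_right cross_smul_right) 1
    (fun a b => by simpa using norm_cross_le a b)

@[simp] theorem crossL_apply (a b : E3) : crossL a b = cross a b := rfl

/-- The bilinear map `(a, b) ↦ ⟪a, b⟫ e₃`. -/
def dotL : E3 →L[ℝ] E3 →L[ℝ] E3 :=
  (ContinuousLinearMap.compL ℝ E3 ℝ E3 (ContinuousLinearMap.toSpanSingleton ℝ e₃)).comp (innerSL ℝ)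

@[simp] theorem dotL_apply (a b : E3) : dotL a b = ⟪a, b⟫_ℝ • e₃ := by
  simp [dotL]

/-- The bilinear map `(a, b) ↦ ⟪e₃, a⟫ b`. -/
def scalL : E3 →L[ℝ] E3 →L[ℝ] E3 :=
  (ContinuousLinearMap.lsmul ℝ ℝ).comp (innerSL ℝ e₃)

@[simp] theorem scalL_apply (a b : E3) : scalL a b = ⟪e₃, a⟫_ℝ • b := by
  simp [scalL]

theorem inner_e₃_self : ⟪e₃, e₃⟫_ℝ = 1 := by
  simp [e₃, e]

theorem norm_e₃ : ‖e₃‖ = 1 := by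
  simp [e₃, e]

/-! ### The Leibniz rule for second order jets -/

/-- The Laplacian of `B(u,v)` in terms of the values, first derivatives and Laplacians of
`u` and `v`. -/
def leib (B : E3 →L[ℝ] E3 →L[ℝ] E3) (u : E3) (d : Fin 3 → E3) (l : E3)
    (v : E3) (d' : Fin 3 → E3) (l' : E3) : E3 :=
  B l v + (2 : ℝ) • ∑ k, B (d k) (d' k) + B u l'

/-- The Laplacian of the product of a scalar jet `(q, qd, ql)` and a vector jet. -/
def sleib (q : ℝ) (qd : Fin 3 → ℝ) (ql : ℝ) (v : E3) (d : Fin 3 → E3) (l : E3) : E3 :=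
  ql • v + (2 : ℝ) • ∑ k, qd k • d k + q • l

/-- The pointwise conditions on the second order jet of a field with values in the sphere. -/
structure SphereJet (m : E3) (d : Fin 3 → E3) (l : E3) : Prop where
  unit : ⟪m, m⟫_ℝ = 1
  tangent : ∀ k, ⟪m, d k⟫_ℝ = 0
  lap : ⟪m, l⟫_ℝ + ∑ k, ⟪d k, d k⟫_ℝ = 0

/-- Half of the squared distance of two vectors. -/
def hq (m m' : E3) : ℝ := ⟪m - m', m - m'⟫_ℝ / 2

/-- The derivatives of half of the squared distance. -/
def hqd (m : E3) (d : Fin 3 → E3) (m' : E3) (d' : Fin 3 → E3) (k : Fin 3) : ℝ :=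
  ⟪m - m', d k - d' k⟫_ℝ

/-- The Laplacian of half of the squared distance. -/
def hql (m : E3) (d : Fin 3 → E3) (l : E3) (m' : E3) (d' : Fin 3 → E3) (l' : E3) : ℝ :=
  ⟪m - m', l - l'⟫_ℝ + ∑ k, ⟪d k - d' k, d k - d' k⟫_ℝ

/-- Expand (m × m') × m = m' - ⟨m, m'⟩ m and use ⟨m, m'⟩ = 1 - |m - m'|²/2 on the sphere. -/
theorem cross_test_left {m m' : E3} (α : ℝ) (hm : ⟪m, m⟫_ℝ = 1) (hm' : ⟪m', m'⟫_ℝ = 1) :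
    cross (m - m' + α • cross m m') m = cross m m' + α • (-(m - m') + hq m m' • m) := by
  simp only [hq, inner_E3, PiLp.sub_apply] at *
  apply E3.ext_three <;> simp
  · linear_combination α * (m' 0 * hm - m 0 * (hm + hm') / 2)
  · linear_combination α * (m' 1 * hm - m 1 * (hm + hm') / 2)
  · linear_combination α * (m' 2 * hm - m 2 * (hm + hm') / 2)

/-- Here (m × m') × m' = ⟨m, m'⟩ m' - m: the linear part is the same as for m, and only the
quadratic correction changes sign. -/
theorem cross_test_right {m m' : E3} (α : ℝ) (hm : ⟪m, m⟫_ℝ = 1) (hm' : ⟪m', m'⟫_ℝ = 1) :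
    cross (m - m' + α • cross m m') m' = cross m m' + α • (-(m - m') - hq m m' • m') := by
  simp only [hq, inner_E3, PiLp.sub_apply] at *
  apply E3.ext_three <;> simp
  · linear_combination α * (-m 0 * hm' + m' 0 * (hm + hm') / 2)
  · linear_combination α * (-m 1 * hm' + m' 1 * (hm + hm') / 2)
  · linear_combination α * (-m 2 * hm' + m' 2 * (hm + hm') / 2)

/-- This is the Laplacian of the identity in `cross_test_left`, carried out as algebra of jets. -/
theorem leib_test_left {m m' : E3} {d d' : Fin 3 → E3} {l l' : E3} (α : ℝ)
    (hm : SphereJet m d l) (hm' : SphereJet m' d' l') :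
    leib crossL (m - m' + α • cross m m')
      (fun k => d k - d' k + α • (cross (d k) m' + cross m (d' k)))
      (l - l' + α • leib crossL m d l m' d' l') m d l =
    leib crossL m d l m' d' l' +
      α • (-(l - l') + sleib (hq m m') (hqd m d m' d') (hql m d l m' d' l') m d l) := by
  obtain ⟨h0, hk, hl⟩ := hm
  obtain ⟨h0', hk', hl'⟩ := hm'
  have k0 := hk 0; have k1 := hk 1; have k2 := hk 2
  have k0' := hk' 0; have k1' := hk' 1; have k2' := hk' 2
  clear hk hk'
  simp only [Fin.sum_univ_three, hq, hqd, hql, leib, sleib, crossL_apply, inner_E3,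
    PiLp.sub_apply] at *
  apply E3.ext_three <;> simp
  -- The multipliers are those of `cross_test_left` after the Leibniz rule: with |m|² - 1 = 0
  -- differentiated, Δ|m|² brings the factor 2 and the mixed terms the factor 4.
  · linear_combination α * (2 * m' 0 * hl + 4 * (k0 * d' 0 0 + k1 * d' 1 0 + k2 * d' 2 0)
      + l' 0 * h0 - ((hl + hl') * m 0 + 2 * ((k0 + k0') * d 0 0 + (k1 + k1') * d 1 0
      + (k2 + k2') * d 2 0) + (h0 + h0') / 2 * l 0))
  · linear_combination α * (2 * m' 1 * hl + 4 * (k0 * d' 0 1 + k1 * d' 1 1 + k2 * d' 2 1)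
      + l' 1 * h0 - ((hl + hl') * m 1 + 2 * ((k0 + k0') * d 0 1 + (k1 + k1') * d 1 1
      + (k2 + k2') * d 2 1) + (h0 + h0') / 2 * l 1))
  · linear_combination α * (2 * m' 2 * hl + 4 * (k0 * d' 0 2 + k1 * d' 1 2 + k2 * d' 2 2)
      + l' 2 * h0 - ((hl + hl') * m 2 + 2 * ((k0 + k0') * d 0 2 + (k1 + k1') * d 1 2
      + (k2 + k2') * d 2 2) + (h0 + h0') / 2 * l 2))

theorem leib_test_right {m m' : E3} {d d' : Fin 3 → E3} {l l' : E3} (α : ℝ)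
    (hm : SphereJet m d l) (hm' : SphereJet m' d' l') :
    leib crossL (m - m' + α • cross m m')
      (fun k => d k - d' k + α • (cross (d k) m' + cross m (d' k)))
      (l - l' + α • leib crossL m d l m' d' l') m' d' l' =
    leib crossL m d l m' d' l' +
      α • (-(l - l') - sleib (hq m m') (hqd m d m' d') (hql m d l m' d' l') m' d' l') := by
  obtain ⟨h0, hk, hl⟩ := hm
  obtain ⟨h0', hk', hl'⟩ := hm'
  have k0 := hk 0; have k1 := hk 1; have k2 := hk 2
  have k0' := hk' 0; have k1' := hk' 1; have k2' := hk' 2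
  clear hk hk'
  simp only [Fin.sum_univ_three, hq, hqd, hql, leib, sleib, crossL_apply, inner_E3,
    PiLp.sub_apply] at *
  apply E3.ext_three <;> simp
  · linear_combination -α * (2 * m 0 * hl' + 4 * (k0' * d 0 0 + k1' * d 1 0 + k2' * d 2 0)
      + l 0 * h0' - ((hl + hl') * m' 0 + 2 * ((k0 + k0') * d' 0 0 + (k1 + k1') * d' 1 0
      + (k2 + k2') * d' 2 0) + (h0 + h0') / 2 * l' 0))
  · linear_combination -α * (2 * m 1 * hl' + 4 * (k0' * d 0 1 + k1' * d 1 1 + k2' * d 2 1)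
      + l 1 * h0' - ((hl + hl') * m' 1 + 2 * ((k0 + k0') * d' 0 1 + (k1 + k1') * d' 1 1
      + (k2 + k2') * d' 2 1) + (h0 + h0') / 2 * l' 1))
  · linear_combination -α * (2 * m 2 * hl' + 4 * (k0' * d 0 2 + k1' * d 1 2 + k2' * d 2 2)
      + l 2 * h0' - ((hl + hl') * m' 2 + 2 * ((k0 + k0') * d' 0 2 + (k1 + k1') * d' 1 2
      + (k2 + k2') * d' 2 2) + (h0 + h0') / 2 * l' 2))

theorem leib_cross_self (m : E3) (d : Fin 3 → E3) (l : E3) : leib crossL m d l m d l = 0 := by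
  simp only [leib, Fin.sum_univ_three, crossL_apply]
  apply E3.ext_three <;> simp <;> ring

/-- The jet is that of (q m) × m = 0; the terms cancel by antisymmetry, without any constraint on m.
-/
theorem leib_sleib_self (q : ℝ) (qd : Fin 3 → ℝ) (ql : ℝ) (m : E3) (d : Fin 3 → E3) (l : E3) :
    leib crossL (q • m) (fun k => qd k • m + q • d k) (sleib q qd ql m d l) m d l = 0 := by
  simp only [leib, sleib, Fin.sum_univ_three, crossL_apply]
  apply E3.ext_three <;> simp <;> ring

theorem leib_sub_left (B : E3 →L[ℝ] E3 →L[ℝ] E3) (u u' : E3) (d d' : Fin 3 → E3) (l l' : E3)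
    (v : E3) (f : Fin 3 → E3) (n : E3) :
    leib B (u - u') (fun k => d k - d' k) (l - l') v f n =
      leib B u d l v f n - leib B u' d' l' v f n := by
  simp only [leib, map_sub, _root_.sub_apply, Finset.sum_sub_distrib, smul_sub]
  abel

/-- The integrand of the spatial weak formulation of the equation, tested with a second order
jet `(ψ, ψd, ψl)`; the vector `c` stands for the convection term. -/
def weakForm (α h : ℝ) (m a : E3) (d : Fin 3 → E3) (l c ψ : E3) (ψd : Fin 3 → E3) (ψl : E3) : ℝ :=
  ⟪a - cross m (α • a + l - h • e₃) + c, ψ⟫_ℝ - ⟪cross m l, ψl⟫_ℝ -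
    2 * ∑ k, ⟪cross (d k) l, ψd k⟫_ℝ

/-- The triple product moves m and its derivatives onto the test jet, producing Δψ × m + 2 ∑ ∂ₖψ ×
∂ₖm. The term ψ × Δm that completes Δ(ψ × m) is free, being orthogonal to Δm. -/
theorem weakForm_eq (α h : ℝ) (m a : E3) (d : Fin 3 → E3) (l c ψ : E3) (ψd : Fin 3 → E3)
    (ψl : E3) :
    weakForm α h m a d l c ψ ψd ψl = ⟪a + c, ψ⟫_ℝ - ⟪α • a + l - h • e₃, cross ψ m⟫_ℝ -
      ⟪l, leib crossL ψ ψd ψl m d l⟫_ℝ := by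
  simp only [weakForm, leib, crossL_apply, inner_add_right, inner_cross_self_right, add_zero,
    inner_smul_right, inner_sum]
  rw [inner_cross_left m l ψl]
  simp only [inner_cross_left (d _) l]
  rw [show a - cross m (α • a + l - h • e₃) + c = a + c - cross m (α • a + l - h • e₃) by abel,
    inner_sub_left, inner_cross_left]
  ring

theorem cross_self' (m : E3) : cross m m = 0 := by
  apply E3.ext_three <;> simp <;> ring

/-- For ψ parallel to m both ψ × m and its Laplacian vanish. This supplies the ⟨a, m⟩ terms needed
for the cancellation without a separate proof that the velocity is tangent to the sphere. -/
theorem weakForm_parallel (α h : ℝ) (m a : E3) (d : Fin 3 → E3) (l c : E3)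
    (q : ℝ) (qd : Fin 3 → ℝ) (ql : ℝ) :
    weakForm α h m a d l c (q • m) (fun k => qd k • m + q • d k) (sleib q qd ql m d l) =
      q * ⟪a + c, m⟫_ℝ := by
  rw [weakForm_eq, leib_sleib_self, cross_smul_left, cross_self', inner_smul_right]
  simp

/-- The difference of the weak formulations for two sphere valued jets, tested with
`m - m' + α m × m'` up to corrections parallel to `m` and to `m'`. -/
theorem weakForm_difference (α h : ℝ) {m m' a a' : E3} {d d' : Fin 3 → E3} {l l' c c' : E3}
    (hm : SphereJet m d l) (hm' : SphereJet m' d' l')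
    (hc : ⟪c, m⟫_ℝ = 0) (hc' : ⟪c', m'⟫_ℝ = 0) :
    weakForm α h m a d l c (m - m' + α • cross m m')
        (fun k => d k - d' k + α • (cross (d k) m' + cross m (d' k)))
        (l - l' + α • leib crossL m d l m' d' l') +
      α ^ 2 * weakForm α h m a d l c (hq m m' • m)
        (fun k => hqd m d m' d' k • m + hq m m' • d k)
        (sleib (hq m m') (hqd m d m' d') (hql m d l m' d' l') m d l) -
      (weakForm α h m' a' d' l' c' (m - m' + α • cross m m')
        (fun k => d k - d' k + α • (cross (d k) m' + cross m (d' k)))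
        (l - l' + α • leib crossL m d l m' d' l') -
      α ^ 2 * weakForm α h m' a' d' l' c' (hq m m' • m')
        (fun k => hqd m d m' d' k • m' + hq m m' • d' k)
        (sleib (hq m m') (hqd m d m' d') (hql m d l m' d' l') m' d' l')) =
    (1 + α ^ 2) * ⟪a - a', m - m'⟫_ℝ + α * ⟪l - l', l - l'⟫_ℝ +
    (⟪c - c', m - m' + α • cross m m'⟫_ℝ - ⟪l - l', cross m m'⟫_ℝ
      + α * ⟪l - l', m - m'⟫_ℝ - α * hq m m' * (⟪l, m⟫_ℝ + ⟪l', m'⟫_ℝ)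
      + h * α * hq m m' * ⟪e₃, m + m'⟫_ℝ
      - ⟪l - l', leib crossL (m - m') (fun k => d k - d' k) (l - l') m' d' l'⟫_ℝ
      - α * (⟪l, sleib (hq m m') (hqd m d m' d') (hql m d l m' d' l') m d l⟫_ℝ
        + ⟪l', sleib (hq m m') (hqd m d m' d') (hql m d l m' d' l') m' d' l'⟫_ℝ)) := by
  -- The rewrites with `leib_sub_left` and `leib_cross_self` express (m - m') × m' = m × m' at the
  -- level of jets.
  rw [weakForm_parallel, weakForm_parallel, weakForm_eq, weakForm_eq, leib_test_left α hm hm',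
    leib_test_right α hm hm', cross_test_left α hm.unit hm'.unit,
    cross_test_right α hm.unit hm'.unit, leib_sub_left, leib_cross_self, sub_zero]
  set C := cross m m'
  set S := leib crossL m d l m' d' l'
  set S₁ := sleib (hq m m') (hqd m d m' d') (hql m d l m' d' l') m d l
  set S₂ := sleib (hq m m') (hqd m d m' d') (hql m d l m' d' l') m' d' l'
  generalize hq m m' = q
  simp only [inner_add_left, inner_add_right, inner_sub_left, inner_sub_right, inner_smul_left,
    inner_smul_right, inner_neg_right, hc, hc', RCLike.conj_to_real]
  ring

/-! ### Pointwise bounds for the error terms -/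

theorem norm_sleib_le (q : ℝ) (qd : Fin 3 → ℝ) (ql : ℝ) (v : E3) (d : Fin 3 → E3) (l : E3) :
    ‖sleib q qd ql v d l‖ ≤ |ql| * ‖v‖ + 2 * ∑ k, |qd k| * ‖d k‖ + |q| * ‖l‖ := by
  refine (norm_add_le _ _).trans (add_le_add ((norm_add_le _ _).trans (add_le_add ?_ ?_)) ?_)
  · rw [norm_smul, Real.norm_eq_abs]
  · rw [norm_smul, Real.norm_eq_abs, abs_two]
    gcongr
    exact (norm_sum_le _ _).trans (Finset.sum_le_sum fun k _ => by rw [norm_smul, Real.norm_eq_abs])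
  · rw [norm_smul, Real.norm_eq_abs]

theorem sum_mul_le_sum_mul_sum {f g : Fin 3 → ℝ} (hf : ∀ k, 0 ≤ f k) (hg : ∀ k, 0 ≤ g k) :
    ∑ k, f k * g k ≤ (∑ k, f k) * ∑ k, g k := by
  rw [Finset.mul_sum]
  exact Finset.sum_le_sum fun k _ => by
    gcongr
    · exact hg k
    · exact Finset.single_le_sum (fun i _ => hf i) (Finset.mem_univ k)

/-- With w = m - m', every derivative of q = |w|²/2 keeps two factors from w: |∂ₖq| ≤ |w||∂ₖw| and
|Δq| ≤ |w||Δw| + |∇w|². -/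
theorem abs_inner_sleib_le {m m' : E3} {d d' : Fin 3 → E3} {l l' : E3} (n : E3) (f : Fin 3 → E3)
    (L v : E3) (hn : ‖n‖ = 1) :
    |⟪v, sleib (hq m m') (hqd m d m' d') (hql m d l m' d' l') n f L⟫_ℝ| ≤
      ‖v‖ * (‖m - m'‖ * ‖l - l'‖ + (∑ k, ‖d k - d' k‖) ^ 2 +
        2 * ‖m - m'‖ * (∑ k, ‖d k - d' k‖) * (∑ k, ‖f k‖) + ‖m - m'‖ ^ 2 / 2 * ‖L‖) := by
  refine (abs_real_inner_le_norm _ _).trans ?_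
  gcongr
  refine (norm_sleib_le _ _ _ _ _ _).trans ?_
  rw [hn, mul_one]
  have hq_eq : |hq m m'| = ‖m - m'‖ ^ 2 / 2 := by
    rw [hq, real_inner_self_eq_norm_sq, abs_of_nonneg (by positivity)]
  have hql_le : |hql m d l m' d' l'| ≤ ‖m - m'‖ * ‖l - l'‖ + (∑ k, ‖d k - d' k‖) ^ 2 := by
    refine (abs_add_le _ _).trans (add_le_add (abs_real_inner_le_norm _ _) ?_)
    simp only [real_inner_self_eq_norm_mul_norm]
    rw [abs_of_nonneg (Finset.sum_nonneg fun _ _ => mul_nonneg (norm_nonneg _) (norm_nonneg _)), sq]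
    exact sum_mul_le_sum_mul_sum (fun _ => norm_nonneg _) (fun _ => norm_nonneg _)
  have hqd_le : ∑ k, |hqd m d m' d' k| * ‖f k‖ ≤
      ‖m - m'‖ * (∑ k, ‖d k - d' k‖) * (∑ k, ‖f k‖) := by
    refine (sum_mul_le_sum_mul_sum (fun _ => abs_nonneg _) (fun _ => norm_nonneg _)).trans ?_
    refine mul_le_mul_of_nonneg_right ?_ (Finset.sum_nonneg fun _ _ => norm_nonneg _)
    rw [Finset.mul_sum]
    exact Finset.sum_le_sum fun k _ => abs_real_inner_le_norm _ _
  rw [hq_eq]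
  linarith

/-- The leading term l × v is orthogonal to l. Otherwise an ‖l‖² term would remain, of the same
order as the coercive term and with no small factor. -/
theorem norm_leib_crossL_le (u : E3) (d : Fin 3 → E3) (l : E3) (v : E3) (d' : Fin 3 → E3)
    (l' : E3) : |⟪l, leib crossL u d l v d' l'⟫_ℝ| ≤
      ‖l‖ * (2 * (∑ k, ‖d k‖) * (∑ k, ‖d' k‖) + ‖u‖ * ‖l'‖) := by
  have h : ⟪l, leib crossL u d l v d' l'⟫_ℝ =
      ⟪l, (2 : ℝ) • ∑ k, cross (d k) (d' k) + cross u l'⟫_ℝ := by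
    have : ⟪l, cross l v⟫_ℝ = 0 := by
      simp only [inner_E3, cross_zero_apply, cross_one_apply, cross_two_apply]; ring
    simp only [leib, crossL_apply, inner_add_right, this]; ring
  rw [h]
  refine (abs_real_inner_le_norm _ _).trans ?_
  gcongr
  refine (norm_add_le _ _).trans (add_le_add ?_ (norm_cross_le _ _))
  rw [norm_smul, Real.norm_eq_abs, abs_two, mul_assoc]
  gcongr
  exact (norm_sum_le _ _).trans ((Finset.sum_le_sum fun k _ => norm_cross_le _ _).trans
    (sum_mul_le_sum_mul_sum (fun _ => norm_nonneg _) (fun _ => norm_nonneg _)))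

set_option maxHeartbeats 1000000 in
/-- The pointwise differential inequality behind the energy estimate. -/
theorem weakForm_difference_le {α : ℝ} (h : ℝ) (hα : 0 < α) {m m' a a' : E3} {d d' : Fin 3 → E3}
    {l l' c c' : E3} (hm : SphereJet m d l) (hm' : SphereJet m' d' l')
    (hc : ⟪c, m⟫_ℝ = 0) (hc' : ⟪c', m'⟫_ℝ = 0)
    {J A b G Λ x y : ℝ} (hb : b = ∑ k, ‖d k - d' k‖) (hG : G = ∑ k, ‖d k‖ + ∑ k, ‖d' k‖)
    (hΛ : Λ = ‖l‖ + ‖l'‖) (hx : x = ‖l - l'‖) (hy : y = ‖m - m'‖)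
    (hJ : ‖c - c'‖ ≤ J * b) (hA : y ≤ A) :
    (1 + α ^ 2) * ⟪a - a', m - m'⟫_ℝ + α * x ^ 2 ≤
    weakForm α h m a d l c (m - m' + α • cross m m')
        (fun k => d k - d' k + α • (cross (d k) m' + cross m (d' k)))
        (l - l' + α • leib crossL m d l m' d' l') +
      α ^ 2 * weakForm α h m a d l c (hq m m' • m)
        (fun k => hqd m d m' d' k • m + hq m m' • d k)
        (sleib (hq m m') (hqd m d m' d') (hql m d l m' d' l') m d l) -
      (weakForm α h m' a' d' l' c' (m - m' + α • cross m m')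
        (fun k => d k - d' k + α • (cross (d k) m' + cross m (d' k)))
        (l - l' + α • leib crossL m d l m' d' l') -
      α ^ 2 * weakForm α h m' a' d' l' c' (hq m m' • m')
        (fun k => hqd m d m' d' k • m' + hq m m' • d' k)
        (sleib (hq m m') (hqd m d m' d') (hql m d l m' d' l') m' d' l')) +
    ((1 + α) * A * (J * b) + (1 + α) * (x * y) + α * A * (y * Λ) + |h| * α * (y * y)
      + 2 * (x * b * G) + (1 + 2 * α) * A * (x * Λ) + 2 * α * (Λ * b * b)
      + 4 * α * A * (b * G * Λ) + α * A ^ 2 * (Λ * Λ)) := by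
  have hm1 : ‖m‖ = 1 := by
    have := hm.unit; rw [real_inner_self_eq_norm_sq] at this
    nlinarith [norm_nonneg m]
  have hm1' : ‖m'‖ = 1 := by
    have := hm'.unit; rw [real_inner_self_eq_norm_sq] at this
    nlinarith [norm_nonneg m']
  have hx0 : 0 ≤ x := hx ▸ norm_nonneg _
  have hy0 : 0 ≤ y := hy ▸ norm_nonneg _
  have hb0 : 0 ≤ b := hb ▸ Finset.sum_nonneg fun _ _ => norm_nonneg _
  have hd0 : 0 ≤ ∑ k, ‖d k‖ := Finset.sum_nonneg fun _ _ => norm_nonneg _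
  have hd0' : 0 ≤ ∑ k, ‖d' k‖ := Finset.sum_nonneg fun _ _ => norm_nonneg _
  have hl0 := norm_nonneg l
  have hl0' := norm_nonneg l'
  have hΛ0 : 0 ≤ Λ := by rw [hΛ]; positivity
  have hG0 : 0 ≤ G := hG ▸ add_nonneg hd0 hd0'
  have hA0 : 0 ≤ A := hy0.trans hA
  have hJb : 0 ≤ J * b := (norm_nonneg _).trans hJ
  have hq_eq : hq m m' = y ^ 2 / 2 := by rw [hq, real_inner_self_eq_norm_sq, hy]
  have hC : ‖cross m m'‖ ≤ y := by
    -- Since m' × m' = 0, the cross product is controlled by the difference.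
    have : cross m m' = cross (m - m') m' := by
      apply E3.ext_three <;> simp <;> ring
    rw [this, hy]
    simpa [hm1'] using norm_cross_le (m - m') m'
  rw [weakForm_difference α h hm hm' hc hc', real_inner_self_eq_norm_sq, ← hx]
  have e1 : |⟪c - c', m - m' + α • cross m m'⟫_ℝ| ≤ (1 + α) * A * (J * b) := by
    refine (abs_real_inner_le_norm _ _).trans ?_
    have : ‖m - m' + α • cross m m'‖ ≤ (1 + α) * A := by
      refine (norm_add_le _ _).trans ?_
      rw [norm_smul, Real.norm_of_nonneg hα.le, ← hy, one_add_mul]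
      gcongr
      exact hC.trans hA
    calc _ ≤ (J * b) * ((1 + α) * A) := by gcongr
      _ = _ := by ring
  have e2 : |⟪l - l', cross m m'⟫_ℝ| ≤ x * y := by
    refine (abs_real_inner_le_norm _ _).trans ?_
    rw [← hx]; gcongr
  have e3 : |⟪l - l', m - m'⟫_ℝ| ≤ x * y := by
    refine (abs_real_inner_le_norm _ _).trans ?_
    rw [← hx, ← hy]
  have e4 : |⟪l, m⟫_ℝ + ⟪l', m'⟫_ℝ| ≤ Λ := by
    rw [hΛ]
    refine (abs_add_le _ _).trans (add_le_add ?_ ?_)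
    · simpa [hm1] using abs_real_inner_le_norm l m
    · simpa [hm1'] using abs_real_inner_le_norm l' m'
  have e5 : |⟪e₃, m + m'⟫_ℝ| ≤ 2 := by
    refine (abs_real_inner_le_norm _ _).trans ?_
    rw [norm_e₃, one_mul]
    exact (norm_add_le _ _).trans (by rw [hm1, hm1']; norm_num)
  have e6 := norm_leib_crossL_le (m - m') (fun k => d k - d' k) (l - l') m' d' l'
  have e7 := abs_inner_sleib_le (m := m) (m' := m') (d' := d') (l' := l') (d := d) (l := l) m d l l hm1
  have e8 := abs_inner_sleib_le (m := m) (m' := m') (d' := d') (l' := l') (d := d) (l := l) m' d' l' l' hm1'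
  rw [← hb, ← hx, ← hy] at e6 e7 e8
  -- One factor `y` is replaced by its uniform bound `A`; the other is kept for an L² estimate.
  have f4 : |α * hq m m' * (⟪l, m⟫_ℝ + ⟪l', m'⟫_ℝ)| ≤ α * A * (y * Λ) / 2 := by
    rw [abs_mul, hq_eq, abs_of_nonneg (by positivity)]
    calc α * (y ^ 2 / 2) * _ ≤ α * (y * A / 2) * Λ := by
          gcongr; nlinarith
      _ = _ := by ring
  have f5 : |h * α * hq m m' * ⟪e₃, m + m'⟫_ℝ| ≤ |h| * α * (y * y) := by
    rw [abs_mul, abs_mul, abs_mul, abs_of_pos hα, hq_eq, abs_of_nonneg (a := y ^ 2 / 2)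
      (by positivity)]
    calc |h| * α * (y ^ 2 / 2) * _ ≤ |h| * α * (y ^ 2 / 2) * 2 := by gcongr
      _ = _ := by ring
  have f6 : x * (2 * b * (∑ k, ‖d' k‖) + y * ‖l'‖) ≤ 2 * (x * b * G) + A * (x * Λ) := by
    calc x * (2 * b * (∑ k, ‖d' k‖) + y * ‖l'‖) ≤ x * (2 * b * G + A * Λ) := by
          gcongr
          · rw [hG]; linarith
          · rw [hΛ]; linarith
      _ = _ := by ring
  have f78 : ‖l‖ * (y * x + b ^ 2 + 2 * y * b * (∑ k, ‖d k‖) + y ^ 2 / 2 * ‖l‖) +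
      ‖l'‖ * (y * x + b ^ 2 + 2 * y * b * (∑ k, ‖d' k‖) + y ^ 2 / 2 * ‖l'‖) ≤
      A * (x * Λ) + Λ * b * b + 2 * A * (b * G * Λ) + A ^ 2 * (Λ * Λ) / 2 := by
    have hyA : y ^ 2 ≤ A ^ 2 := by gcongr
    have hGd : ∑ k, ‖d k‖ ≤ G := hG ▸ le_add_of_nonneg_right hd0'
    have hGd' : ∑ k, ‖d' k‖ ≤ G := hG ▸ le_add_of_nonneg_left hd0
    generalize ∑ k, ‖d k‖ = s at hGd hd0 ⊢
    generalize ∑ k, ‖d' k‖ = s' at hGd' hd0' ⊢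
    calc _ ≤ ‖l‖ * (A * x + b ^ 2 + 2 * A * b * G + A ^ 2 / 2 * Λ) +
      ‖l'‖ * (A * x + b ^ 2 + 2 * A * b * G + A ^ 2 / 2 * Λ) := by
          gcongr
          · rw [hΛ]; linarith
          · rw [hΛ]; linarith
      _ = _ := by rw [← add_mul, ← hΛ]; ring
  have g := abs_le.1 e1
  have g2 := abs_le.1 e2
  have g3 := abs_le.1 e3
  have g4 := abs_le.1 f4
  have g5 := abs_le.1 f5
  have g6 := abs_le.1 (e6.trans f6)
  have g78 := mul_le_mul_of_nonneg_left ((add_le_add (le_abs_self _) (le_abs_self _)).trans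
    ((add_le_add e7 e8).trans f78)) hα.le
  have g3' := mul_le_mul_of_nonneg_left g3.1 hα.le
  -- Several constants in the statement are rounded up; these signs pay for the excess.
  have p1 : 0 ≤ α * A * (y * Λ) := by positivity
  have p2 : 0 ≤ α * A * (x * Λ) := by positivity
  have p3 : 0 ≤ α * (Λ * b * b) := by positivity
  have p4 : 0 ≤ α * A * (b * G * Λ) := by positivity
  have p5 : 0 ≤ α * A ^ 2 * (Λ * Λ) := by positivity
  linarith [g.1, g2.2, g3', g4.2, g5.1, g6.2, g78]

/-! ### Calculus of test functions -/

section TestFunctions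

variable {F G H : Type*} [NormedAddCommGroup F] [NormedSpace ℝ F] [NormedAddCommGroup G]
  [NormedSpace ℝ G] [NormedAddCommGroup H] [NormedSpace ℝ H]

/-- Smooth compactly supported functions. -/
def IsTest (f : E3 → F) : Prop := ContDiff ℝ ∞ f ∧ HasCompactSupport f

/-- The `k`-th partial derivative. -/
def pd (k : Fin 3) (f : E3 → F) (x : E3) : F := fderiv ℝ f x (e k)

/-- The Laplacian as a sum of second partial derivatives. -/
def lap (f : E3 → F) (x : E3) : F := ∑ k, pd k (pd k f) x

theorem contDiff_pd {f : E3 → F} (hf : ContDiff ℝ ∞ f) (k : Fin 3) : ContDiff ℝ ∞ (pd k f) :=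
  (hf.fderiv_right (m := ∞) (by simp)).clm_apply contDiff_const

theorem contDiff_lap {f : E3 → F} (hf : ContDiff ℝ ∞ f) : ContDiff ℝ ∞ (lap f) :=
  ContDiff.sum fun k _ => contDiff_pd (contDiff_pd hf k) k

theorem HasCompactSupport.pd {f : E3 → F} (hf : HasCompactSupport f) (k : Fin 3) :
    HasCompactSupport (pd k f) :=
  hf.fderiv_apply ℝ (e k)

theorem IsTest.pd {f : E3 → F} (hf : IsTest f) (k : Fin 3) : IsTest (pd k f) :=
  ⟨contDiff_pd hf.1 k, HasCompactSupport.pd hf.2 k⟩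

theorem IsTest.zero : IsTest (0 : E3 → F) := ⟨contDiff_const, HasCompactSupport.zero⟩

theorem IsTest.add {f g : E3 → F} (hf : IsTest f) (hg : IsTest g) : IsTest (f + g) :=
  ⟨hf.1.add hg.1, hf.2.add hg.2⟩

theorem IsTest.clm {f : E3 → F} (hf : IsTest f) (A : F →L[ℝ] G) : IsTest (fun x => A (f x)) :=
  ⟨A.contDiff.comp hf.1, hf.2.comp_left (map_zero A)⟩

theorem IsTest.const_smul {f : E3 → F} (hf : IsTest f) (r : ℝ) : IsTest (r • f) :=
  hf.clm (r • ContinuousLinearMap.id ℝ F)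

theorem IsTest.lap {f : E3 → F} (hf : IsTest f) : IsTest (lap f) := by
  have : LLG.lap f = LLG.pd 0 (LLG.pd 0 f) + LLG.pd 1 (LLG.pd 1 f) + LLG.pd 2 (LLG.pd 2 f) := by
    ext x; simp [LLG.lap, Fin.sum_univ_three]
  rw [this]
  exact (((hf.pd 0).pd 0).add ((hf.pd 1).pd 1)).add ((hf.pd 2).pd 2)

theorem IsTest.continuous {f : E3 → F} (hf : IsTest f) : Continuous f := hf.1.continuous

theorem IsTest.memLp {f : E3 → F} (hf : IsTest f) (p : ℝ≥0∞) : MemLp f p volume :=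
  hf.continuous.memLp_of_hasCompactSupport hf.2

theorem IsTest.integrable {f : E3 → F} (hf : IsTest f) : Integrable f volume :=
  hf.continuous.integrable_of_hasCompactSupport hf.2

theorem differentiable_of_smooth {f : E3 → F} (hf : ContDiff ℝ ∞ f) : Differentiable ℝ f :=
  hf.differentiable (by simp)

theorem contDiff_bilin (B : F →L[ℝ] G →L[ℝ] H) {f : E3 → F} {g : E3 → G} (hf : ContDiff ℝ ∞ f)
    (hg : ContDiff ℝ ∞ g) : ContDiff ℝ ∞ (fun x => B (f x) (g x)) :=
  B.isBoundedBilinearMap.contDiff.comp (hf.prodMk hg)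

theorem IsTest.bilin_right (B : F →L[ℝ] G →L[ℝ] H) {f : E3 → F} {g : E3 → G}
    (hf : ContDiff ℝ ∞ f) (hg : IsTest g) : IsTest (fun x => B (f x) (g x)) :=
  ⟨contDiff_bilin B hf hg.1, hg.2.mono' fun x hx => subset_tsupport _ fun h0 => hx (by simp [h0])⟩

theorem IsTest.bilin_left (B : F →L[ℝ] G →L[ℝ] H) {f : E3 → F} {g : E3 → G}
    (hf : IsTest f) (hg : ContDiff ℝ ∞ g) : IsTest (fun x => B (f x) (g x)) :=
  IsTest.bilin_right B.flip hg hf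

theorem pd_add {f g : E3 → F} (hf : ContDiff ℝ ∞ f) (hg : ContDiff ℝ ∞ g) (k : Fin 3) :
    pd k (f + g) = pd k f + pd k g := by
  ext x
  simp [pd, fderiv_add (differentiable_of_smooth hf x) (differentiable_of_smooth hg x)]

theorem pd_clm {f : E3 → F} (hf : ContDiff ℝ ∞ f) (A : F →L[ℝ] G) (k : Fin 3) :
    pd k (fun x => A (f x)) = fun x => A (pd k f x) := by
  ext x
  have := (A.hasFDerivAt (x := f x)).comp x (differentiable_of_smooth hf x).hasFDerivAt
  rw [pd, HasFDerivAt.fderiv (f := fun x => A (f x)) this]; rfl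

theorem pd_bilin (B : F →L[ℝ] G →L[ℝ] H) {f : E3 → F} {g : E3 → G} (hf : ContDiff ℝ ∞ f)
    (hg : ContDiff ℝ ∞ g) (k : Fin 3) :
    pd k (fun x => B (f x) (g x)) = fun x => B (pd k f x) (g x) + B (f x) (pd k g x) := by
  ext x
  have := B.hasFDerivAt_of_bilinear (differentiable_of_smooth hf x).hasFDerivAt
    (differentiable_of_smooth hg x).hasFDerivAt
  rw [pd, this.fderiv]
  simp [pd, add_comm]

theorem lap_add {f g : E3 → F} (hf : ContDiff ℝ ∞ f) (hg : ContDiff ℝ ∞ g) :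
    lap (f + g) = lap f + lap g := by
  ext x
  simp [lap, pd_add hf hg, pd_add (contDiff_pd hf _) (contDiff_pd hg _), Finset.sum_add_distrib]

theorem lap_clm {f : E3 → F} (hf : ContDiff ℝ ∞ f) (A : F →L[ℝ] G) :
    lap (fun x => A (f x)) = fun x => A (lap f x) := by
  ext x
  simp [lap, pd_clm hf, pd_clm (contDiff_pd hf _)]

theorem lap_bilin (B : F →L[ℝ] G →L[ℝ] H) {f : E3 → F} {g : E3 → G} (hf : ContDiff ℝ ∞ f)
    (hg : ContDiff ℝ ∞ g) :
    lap (fun x => B (f x) (g x)) = fun x => B (lap f x) (g x) +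
      (2 : ℝ) • ∑ k, B (pd k f x) (pd k g x) + B (f x) (lap g x) := by
  ext x
  have h : ∀ k, pd k (pd k fun x => B (f x) (g x)) x = B (pd k (pd k f) x) (g x) +
      (2 : ℝ) • B (pd k f x) (pd k g x) + B (f x) (pd k (pd k g) x) := fun k => by
    have e1 := pd_add (contDiff_bilin B (contDiff_pd hf k) hg)
      (contDiff_bilin B hf (contDiff_pd hg k)) k
    rw [pd_bilin B hf hg]
    refine (congrFun e1 x).trans ?_
    rw [Pi.add_apply, pd_bilin B (contDiff_pd hf k) hg, pd_bilin B hf (contDiff_pd hg k)]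
    module
  simp only [lap, h, Finset.sum_add_distrib, map_sum, _root_.sum_apply, Finset.smul_sum]

theorem pd_comm {f : E3 → F} (hf : ContDiff ℝ ∞ f) (i k : Fin 3) :
    pd i (pd k f) = pd k (pd i f) := by
  have h : ∀ (i k : Fin 3) (x : E3), pd i (pd k f) x = fderiv ℝ (fderiv ℝ f) x (e i) (e k) := by
    intro i k x
    have hd : DifferentiableAt ℝ (fderiv ℝ f) x :=
      ((hf.fderiv_right (m := ∞) (by simp)).differentiable (by simp)) x
    have := (hd.hasFDerivAt.clm_apply (hasFDerivAt_const (e k) x)).fderiv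
    change fderiv ℝ (fun y => fderiv ℝ f y (e k)) x (e i) = _
    rw [this]; simp
  ext x
  rw [h, h]
  exact (hf.contDiffAt.isSymmSndFDerivAt (by simpa using WithTop.coe_le_coe.2 (le_top : (2 : ℕ∞) ≤ ⊤))) (e i) (e k)

theorem integral_bilin_pd (B : F →L[ℝ] G →L[ℝ] H) {f : E3 → F} {g : E3 → G}
    (hf : ContDiff ℝ ∞ f) (hg : IsTest g) (k : Fin 3) :
    ∫ x, B (f x) (pd k g x) = -∫ x, B (pd k f x) (g x) := by
  apply integral_bilinear_hasLineDerivAt_right_eq_neg_left_of_integrable (v := e k)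
  · exact (IsTest.bilin_right B (contDiff_pd hf k) hg).integrable
  · exact (IsTest.bilin_right B hf (hg.pd k)).integrable
  · exact (IsTest.bilin_right B hf hg).integrable
  · exact fun x _ => (differentiable_of_smooth hf x).hasFDerivAt.hasLineDerivAt (e k)
  · exact fun x _ => (differentiable_of_smooth hg.1 x).hasFDerivAt.hasLineDerivAt (e k)

theorem laplacian_eq_lap {f : E3 → F} (hf : ContDiff ℝ ∞ f) : Laplacian.laplacian f = lap f := by
  ext x
  rw [InnerProductSpace.laplacian_eq_iteratedFDeriv_orthonormalBasis f
    (EuclideanSpace.basisFun (Fin 3) ℝ)]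
  refine Finset.sum_congr rfl fun k _ => ?_
  have hd : DifferentiableAt ℝ (fderiv ℝ f) x :=
      ((hf.fderiv_right (m := ∞) (by simp)).differentiable (by simp)) x
  have := (hd.hasFDerivAt.clm_apply (hasFDerivAt_const (e k) x)).fderiv
  rw [iteratedFDeriv_two_apply]
  change _ = fderiv ℝ (fun y => fderiv ℝ f y (e k)) x (e k)
  rw [this]
  simp [e]

end TestFunctions

/-! ### Sobolev inequalities for test functions -/

/-- The resolvent symbol `(1 + ‖s ξ‖²)⁻¹`. -/
def symb (s : ℝ) (ξ : E3) : ℝ := (1 + ‖s • ξ‖ ^ 2)⁻¹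

/-- The square decays like |ξ|⁻⁴, and 4 exceeds the dimension 3. -/
theorem integrable_symb_sq : Integrable (fun ξ : E3 => symb 1 ξ ^ 2) := by
  have := integrable_rpow_neg_one_add_norm_sq (E := E3) (μ := volume) (r := 4) (by simp; norm_num)
  refine this.congr (Eventually.of_forall fun ξ => ?_)
  simp only [symb, one_smul]
  rw [show (-4 / 2 : ℝ) = ((-2 : ℤ) : ℝ) by norm_num, Real.rpow_intCast]
  simp [zpow_neg]

/-- Dilation: `symb s ξ = symb 1 (s • ξ)`, so the integral of the square scales like s⁻³. -/
theorem eLpNorm_symb {s : ℝ} (hs : 0 < s) : eLpNorm (symb s) 2 volume =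
    ENNReal.ofReal (√(s⁻¹ ^ 3 * ∫ ξ : E3, symb 1 ξ ^ 2)) := by
  have hc : ∀ s, Continuous (symb s) := fun s =>
    Continuous.inv₀ (by fun_prop) fun ξ => by positivity
  have h1 : MemLp (symb 1) 2 (volume : Measure E3) :=
    (memLp_two_iff_integrable_sq (hc 1).aestronglyMeasurable).2 integrable_symb_sq
  have hcomp : ∀ ξ, symb s ξ = symb 1 (s • ξ) := fun ξ => by simp [symb]
  have hs2 : MemLp (symb s) 2 (volume : Measure E3) := by
    refine (memLp_two_iff_integrable_sq (hc s).aestronglyMeasurable).2 ?_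
    simp_rw [hcomp]
    exact integrable_symb_sq.comp_smul (f := fun ξ => symb 1 ξ ^ 2) hs.ne'
  rw [hs2.eLpNorm_eq_integral_rpow_norm (by norm_num) (by norm_num), Real.sqrt_eq_rpow]
  have : ∫ ξ, symb s ξ ^ 2 = s⁻¹ ^ 3 * ∫ ξ, symb 1 ξ ^ 2 := by
    simp_rw [hcomp]
    have := Measure.integral_comp_smul (volume : Measure E3) (fun ξ => symb 1 ξ ^ 2) s
    rw [this]
    simp [abs_of_pos hs]
  rw [← this]; simp

theorem eLpNorm_add_neg_smul_le {ε : ℝ} (hε : 0 ≤ ε) {f g : E3 → ℂ}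
    (hf : AEStronglyMeasurable f) (hg : AEStronglyMeasurable g) :
    eLpNorm (f + (-ε) • g) 2 volume ≤
      eLpNorm f 2 volume + ENNReal.ofReal ε * eLpNorm g 2 volume := by
  refine (eLpNorm_add_le hf (hg.const_smul (-ε)) (by norm_num)).trans_eq ?_
  rw [eLpNorm_const_smul, enorm_neg, Real.enorm_of_nonneg hε]

open FourierTransform SchwartzMap in
theorem eLpNorm_fourier (g : 𝓢(E3, ℂ)) :
    eLpNorm (𝓕 g : 𝓢(E3, ℂ)) 2 volume = eLpNorm g 2 volume := by
  have h := SchwartzMap.norm_fourier_toL2_eq g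
  generalize 𝓕 g = f at h ⊢
  rw [SchwartzMap.norm_toLp, SchwartzMap.norm_toLp] at h
  have hf : eLpNorm f 2 volume ≠ ⊤ := (f.memLp 2 volume).2.ne
  have hg : eLpNorm g 2 volume ≠ ⊤ := (g.memLp 2 volume).2.ne
  rw [← ENNReal.ofReal_toReal hf, ← ENNReal.ofReal_toReal hg]
  exact congrArg ENNReal.ofReal h

open SchwartzMap in
theorem schwartz_coe_add_smul (f g : 𝓢(E3, ℂ)) (r : ℝ) : ⇑(f + r • g) = ⇑f + r • ⇑g := by
  ext x; rw [_root_.add_apply, _root_.smul_apply]; rfl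

open FourierTransform SchwartzMap Real in
theorem fourier_laplacian (f : 𝓢(E3, ℂ)) (ξ : E3) :
    𝓕 (Laplacian.laplacian f : 𝓢(E3, ℂ)) ξ = -((2 * π) ^ 2 * ‖ξ‖ ^ 2 : ℝ) * 𝓕 f ξ := by
  have h := congrArg 𝓕 (SchwartzMap.laplacian_eq_fourierMultiplierCLM f)
  rw [h, FourierTransform.fourier_smul, SchwartzMap.fourierMultiplierCLM_apply,
    FourierTransform.fourier_fourierInv_eq]
  rw [_root_.smul_apply, SchwartzMap.smulLeftCLM_apply_apply (by fun_prop)]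
  simp [mul_assoc]

-- With g = f - (s/2π)²Δf the Fourier transforms satisfy f̂ = (1 + |sξ|²)⁻¹ ĝ. Fourier inversion
-- bounds f by ‖f̂‖₁, and Cauchy–Schwarz with Plancherel bounds that by ‖symb s‖₂‖g‖₂. The
-- coefficient of ‖Δf‖₂ is of order s² s^(-3/2), hence small for small s.
open FourierTransform SchwartzMap Real in
theorem enorm_schwartz_le (f : 𝓢(E3, ℂ)) (x : E3) {s : ℝ} (hs : 0 < s) :
    ‖f x‖ₑ ≤ ENNReal.ofReal (√(s⁻¹ ^ 3 * ∫ ξ : E3, symb 1 ξ ^ 2)) *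
      (eLpNorm f 2 volume + ENNReal.ofReal ((s / (2 * π)) ^ 2) *
        eLpNorm (Laplacian.laplacian f : 𝓢(E3, ℂ)) 2 volume) := by
  set ε : ℝ := (s / (2 * π)) ^ 2
  have hε : 0 ≤ ε := by positivity
  set g : 𝓢(E3, ℂ) := f + (-ε) • (Laplacian.laplacian f : 𝓢(E3, ℂ))
  have hg : ∀ ξ, 𝓕 f ξ = symb s ξ • 𝓕 g ξ := fun ξ => by
    have : 𝓕 g = 𝓕 f + (-ε) • 𝓕 (Laplacian.laplacian f : 𝓢(E3, ℂ)) := by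
      simp only [g]
      rw [FourierTransform.fourier_add, FourierTransform.fourier_smul]
    rw [this, _root_.add_apply, _root_.smul_apply, fourier_laplacian, symb]
    have h0 : (1 + (s : ℂ) ^ 2 * (‖ξ‖ : ℂ) ^ 2) ≠ 0 := by
      norm_cast; positivity
    simp only [norm_smul, mul_pow, Real.norm_eq_abs, sq_abs, Complex.real_smul, ε]
    push_cast
    field_simp
  have h1 : ‖f x‖ₑ ≤ eLpNorm (𝓕 f : 𝓢(E3, ℂ)) 1 volume := by
    have : f x = 𝓕⁻ (⇑(𝓕 f : 𝓢(E3, ℂ))) x := by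
      rw [← SchwartzMap.fourierInv_coe, FourierTransform.fourierInv_fourier_eq]
    rw [this, Real.fourierInv_eq, eLpNorm_one_eq_lintegral_enorm]
    refine (enorm_integral_le_lintegral_enorm _).trans_eq ?_
    congr 1; ext v
    rw [← ofReal_norm, ← ofReal_norm, Circle.norm_smul]
  have h2 : eLpNorm (𝓕 f : 𝓢(E3, ℂ)) 1 volume ≤ eLpNorm (symb s) 2 volume * eLpNorm (𝓕 g : 𝓢(E3, ℂ)) 2 volume := by
    have e : ⇑(𝓕 f : 𝓢(E3, ℂ)) = (symb s) • ⇑(𝓕 g : 𝓢(E3, ℂ)) := funext hg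
    rw [e]
    exact eLpNorm_smul_le_mul_eLpNorm (𝓕 g).continuous.aestronglyMeasurable
      (Continuous.inv₀ (by fun_prop) fun ξ => by positivity).aestronglyMeasurable
  have h3 : eLpNorm (𝓕 g : 𝓢(E3, ℂ)) 2 volume = eLpNorm g 2 volume := by
    exact eLpNorm_fourier g
  have h4 : eLpNorm g 2 volume ≤ eLpNorm f 2 volume + ENNReal.ofReal ε *
        eLpNorm (Laplacian.laplacian f : 𝓢(E3, ℂ)) 2 volume := by
    rw [show ⇑g = ⇑f + (-ε) • ⇑(Laplacian.laplacian f : 𝓢(E3, ℂ)) from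
      schwartz_coe_add_smul f _ _]
    exact eLpNorm_add_neg_smul_le hε f.continuous.aestronglyMeasurable
      (Laplacian.laplacian f : 𝓢(E3, ℂ)).continuous.aestronglyMeasurable
  refine h1.trans (h2.trans ?_)
  rw [h3, eLpNorm_symb hs]
  gcongr

/-- A complex valued test function as a Schwartz function, built from a component of a vector
valued one. -/
def componentSchwartz {f : E3 → E3} (hf : IsTest f) (v : E3) : SchwartzMap E3 ℂ :=
  HasCompactSupport.toSchwartzMap
    (f := fun x => (Complex.ofRealCLM.comp (innerSL ℝ v)) (f x))
    (hf.clm (Complex.ofRealCLM.comp (innerSL ℝ v))).2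
    (hf.clm (Complex.ofRealCLM.comp (innerSL ℝ v))).1

theorem enorm_component_le (v w : E3) :
    ‖(Complex.ofRealCLM.comp (innerSL ℝ v)) w‖ₑ ≤ ‖v‖ₑ * ‖w‖ₑ := by
  rw [← ofReal_norm, ← ofReal_norm, ← ofReal_norm, ← ENNReal.ofReal_mul (norm_nonneg _)]
  refine ENNReal.ofReal_le_ofReal ?_
  simpa using abs_real_inner_le_norm v w

theorem eLpNorm_component_le (f : E3 → E3) (v : E3) :
    eLpNorm (fun x => (Complex.ofRealCLM.comp (innerSL ℝ v)) (f x)) 2 volume ≤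
      ‖v‖ₑ * eLpNorm f 2 volume := by
  refine (eLpNorm_le_nnreal_smul_eLpNorm_of_ae_le_mul (c := ‖v‖₊)
    (Eventually.of_forall fun x => ?_) 2).trans_eq rfl
  exact ENNReal.coe_le_coe.1 ((enorm_component_le v (f x)).trans_eq (ENNReal.coe_mul _ _).symm)

/-- Apply the scalar inequality to the component of f along the fixed vector f(x): its value at x is
|f(x)|², and one factor |f(x)| divides out. -/
theorem enorm_test_le {f : E3 → E3} (hf : IsTest f) (x : E3) {s : ℝ} (hs : 0 < s) :
    ‖f x‖ₑ ≤ ENNReal.ofReal (√(s⁻¹ ^ 3 * ∫ ξ : E3, symb 1 ξ ^ 2)) *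
      (eLpNorm f 2 volume + ENNReal.ofReal ((s / (2 * Real.pi)) ^ 2) *
        eLpNorm (lap f) 2 volume) := by
  rcases eq_or_ne (f x) 0 with h0 | h0
  · simp [h0]
  set v := f x
  have h := enorm_schwartz_le (componentSchwartz hf v) x hs
  have hL : ⇑(Laplacian.laplacian (componentSchwartz hf v) : SchwartzMap E3 ℂ) =
      fun x => (Complex.ofRealCLM.comp (innerSL ℝ v)) (lap f x) := by
    ext y
    rw [SchwartzMap.laplacian_apply, laplacian_eq_lap (SchwartzMap.smooth _ _)]
    exact congrFun (lap_clm hf.1 (Complex.ofRealCLM.comp (innerSL ℝ v))) y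
  have hx : ‖componentSchwartz hf v x‖ₑ = ‖v‖ₑ * ‖v‖ₑ := by
    change ‖(Complex.ofRealCLM.comp (innerSL ℝ v)) v‖ₑ = _
    rw [← ofReal_norm, ← ofReal_norm, ← ENNReal.ofReal_mul (norm_nonneg _)]
    simp [sq]
  have hv0 : ‖v‖ₑ ≠ 0 := by simpa using h0
  have hvt : ‖v‖ₑ ≠ ⊤ := enorm_ne_top
  rw [hx, hL] at h
  refine (ENNReal.mul_le_mul_iff_right hv0 hvt).1 (h.trans ?_)
  rw [mul_left_comm ‖v‖ₑ]
  gcongr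
  rw [mul_add, mul_left_comm ‖v‖ₑ]
  gcongr
  · exact eLpNorm_component_le f v
  · exact eLpNorm_component_le (lap f) v

/-- The Sobolev inequality `‖f‖_∞ ≤ δ ‖Δf‖₂ + C ‖f‖₂`. -/
theorem exists_enorm_test_le {δ : ℝ≥0} (hδ : 0 < δ) : ∃ C : ℝ≥0, ∀ f : E3 → E3, IsTest f →
    ∀ x, ‖f x‖ₑ ≤ δ * eLpNorm (lap f) 2 volume + C * eLpNorm f 2 volume := by
  set I := ∫ ξ : E3, symb 1 ξ ^ 2
  have hI : 0 ≤ I := integral_nonneg fun _ => sq_nonneg _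
  have hδ' : (0 : ℝ) < δ := hδ
  -- The squared coefficient of ‖Δf‖₂ is at most s⁻³ I s⁴ = s I, which this choice keeps below δ².
  set s : ℝ := (δ : ℝ) ^ 2 / (I + 1)
  have hs : 0 < s := by positivity
  refine ⟨(√(s⁻¹ ^ 3 * I)).toNNReal, fun f hf x => (enorm_test_le hf x hs).trans ?_⟩
  rw [mul_add, add_comm, ← mul_assoc, ← ENNReal.ofReal_mul (Real.sqrt_nonneg _)]
  gcongr
  · rw [← ENNReal.ofReal_coe_nnreal]
    refine ENNReal.ofReal_le_ofReal (abs_le_of_sq_le_sq' ?_ hδ'.le).2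
    rw [mul_pow, Real.sq_sqrt (by positivity)]
    have hpi : (1 : ℝ) ≤ 2 * Real.pi := by linarith [Real.pi_gt_three]
    calc s⁻¹ ^ 3 * I * ((s / (2 * Real.pi)) ^ 2) ^ 2 ≤ s⁻¹ ^ 3 * I * (s ^ 2) ^ 2 := by
          gcongr; exact div_le_self hs.le hpi
      _ = s * I := by field_simp
      _ = (δ : ℝ) ^ 2 * (I / (I + 1)) := by simp only [s]; ring
      _ ≤ (δ : ℝ) ^ 2 * 1 := by
          gcongr; exact (div_le_one (by positivity)).2 (by linarith)
      _ = _ := mul_one _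
  · rfl

theorem eLpNorm_sq_eq {f : E3 → E3} (hf : MemLp f 2 volume) :
    eLpNorm f 2 volume ^ 2 = ENNReal.ofReal (∫ x, ⟪f x, f x⟫_ℝ) := by
  rw [hf.eLpNorm_eq_integral_rpow_norm (by norm_num) (by norm_num),
    ← ENNReal.ofReal_pow (by positivity)]
  congr 1
  simp only [real_inner_self_eq_norm_sq, ENNReal.toReal_ofNat, Real.rpow_ofNat]
  rw [← Real.rpow_natCast, ← Real.rpow_mul (by positivity)]
  norm_num

theorem integral_inner_le {f g : E3 → E3} (hf : MemLp f 2 volume) (hg : MemLp g 2 volume) :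
    ENNReal.ofReal (∫ x, ⟪f x, g x⟫_ℝ) ≤ eLpNorm f 2 volume * eLpNorm g 2 volume := by
  have h1 : ENNReal.ofReal (∫ x, ⟪f x, g x⟫_ℝ) ≤ eLpNorm (fun x => ⟪f x, g x⟫_ℝ) 1 volume := by
    rw [eLpNorm_one_eq_lintegral_enorm]
    refine le_trans ?_ (enorm_integral_le_lintegral_enorm _)
    rw [← ofReal_norm]
    exact ENNReal.ofReal_le_ofReal (le_abs_self _)
  refine h1.trans ?_
  have := eLpNorm_le_eLpNorm_mul_eLpNorm_of_nnnorm (p := 2) (q := 2) (r := 1) hf.1 hg.1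
    (fun a b => ⟪a, b⟫_ℝ) 1 (Eventually.of_forall fun x => by
      simpa using nnnorm_inner_le_nnnorm (𝕜 := ℝ) (f x) (g x))
  simpa using this

theorem integral_inner_pd {f g : E3 → E3} (hf : IsTest f) (hg : IsTest g) (k : Fin 3) :
    ∫ x, ⟪f x, pd k g x⟫_ℝ = -∫ x, ⟪pd k f x, g x⟫_ℝ :=
  integral_bilin_pd (innerSL ℝ) hf.1 hg k

theorem integrable_inner_test {f g : E3 → E3} (hf : IsTest f) (hg : IsTest g) :
    Integrable (fun x => ⟪f x, g x⟫_ℝ) :=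
  (IsTest.bilin_right (innerSL ℝ) hf.1 hg).integrable

/-- `‖∂ₖ f‖₂² ≤ ‖f‖₂ ‖Δf‖₂`. -/
theorem eLpNorm_pd_sq_le {f : E3 → E3} (hf : IsTest f) (k : Fin 3) :
    eLpNorm (pd k f) 2 volume ^ 2 ≤ eLpNorm f 2 volume * eLpNorm (lap f) 2 volume := by
  rw [eLpNorm_sq_eq ((hf.pd k).memLp 2)]
  have h : ∑ i, ∫ x, ⟪pd i f x, pd i f x⟫_ℝ = ∫ x, ⟪(-f) x, lap f x⟫_ℝ := by
    simp only [Pi.neg_apply, inner_neg_left, lap, inner_sum, Finset.sum_neg_distrib]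
    rw [integral_neg, integral_finsetSum _ fun i _ => integrable_inner_test hf ((hf.pd i).pd i),
      ← Finset.sum_neg_distrib]
    refine Finset.sum_congr rfl fun i _ => ?_
    rw [integral_inner_pd hf (hf.pd i), neg_neg]
  have hle : ∫ x, ⟪pd k f x, pd k f x⟫_ℝ ≤ ∑ i, ∫ x, ⟪pd i f x, pd i f x⟫_ℝ :=
    Finset.single_le_sum (f := fun i => ∫ x, ⟪pd i f x, pd i f x⟫_ℝ)
      (fun i _ => integral_nonneg fun x => real_inner_self_nonneg) (Finset.mem_univ k)
  rw [h] at hle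
  refine (ENNReal.ofReal_le_ofReal hle).trans ?_
  simpa using integral_inner_le (hf.memLp 2).neg (hf.lap.memLp 2)

/-- `‖∂ᵢ∂ₖ f‖₂ ≤ ‖Δf‖₂`. -/
theorem eLpNorm_pd_pd_le {f : E3 → E3} (hf : IsTest f) (i k : Fin 3) :
    eLpNorm (pd i (pd k f)) 2 volume ≤ eLpNorm (lap f) 2 volume := by
  refine (ENNReal.pow_le_pow_left_iff two_ne_zero).1 ?_
  rw [eLpNorm_sq_eq (((hf.pd k).pd i).memLp 2), eLpNorm_sq_eq (hf.lap.memLp 2)]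
  refine ENNReal.ofReal_le_ofReal ?_
  -- Two integrations by parts trade the mixed derivatives for pure ones; summing over both indices
  -- gives ‖Δf‖₂².
  have h : ∀ i k, ∫ x, ⟪pd i (pd k f) x, pd i (pd k f) x⟫_ℝ =
      ∫ x, ⟪pd k (pd k f) x, pd i (pd i f) x⟫_ℝ := fun i k => by
    rw [integral_inner_pd ((hf.pd k).pd i) (hf.pd k)]
    have e := integral_inner_pd ((hf.pd i).pd i) (hf.pd k) k
    rw [pd_comm hf.1 i k, pd_comm (contDiff_pd hf.1 i) i k, ← e]
    simp only [real_inner_comm]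
  have hs : ∫ x, ⟪lap f x, lap f x⟫_ℝ = ∑ i, ∑ k, ∫ x, ⟪pd i (pd k f) x, pd i (pd k f) x⟫_ℝ := by
    rw [Finset.sum_congr rfl fun i _ => Finset.sum_congr rfl fun k _ => h i k]
    simp_rw [lap, sum_inner, inner_sum]
    rw [integral_finsetSum _ fun i _ => integrable_finsetSum _ fun k _ =>
      integrable_inner_test ((hf.pd i).pd i) ((hf.pd k).pd k), Finset.sum_comm]
    exact Finset.sum_congr rfl fun i _ => integral_finsetSum _ fun k _ =>
      integrable_inner_test ((hf.pd i).pd i) ((hf.pd k).pd k)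
  rw [hs]
  have h0 : ∀ i k, 0 ≤ ∫ x, ⟪pd i (pd k f) x, pd i (pd k f) x⟫_ℝ := fun i k =>
    integral_nonneg fun x => real_inner_self_nonneg
  exact (Finset.single_le_sum (f := fun k => ∫ x, ⟪pd i (pd k f) x, pd i (pd k f) x⟫_ℝ)
    (fun k _ => h0 i k) (Finset.mem_univ k)).trans
    (Finset.single_le_sum (f := fun i => ∑ k, ∫ x, ⟪pd i (pd k f) x, pd i (pd k f) x⟫_ℝ)
    (fun i _ => Finset.sum_nonneg fun k _ => h0 i k) (Finset.mem_univ i))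

theorem norm_fderiv_le_sum (f : E3 → E3) (x : E3) : ‖fderiv ℝ f x‖ ≤ ∑ k, ‖pd k f x‖ := by
  refine ContinuousLinearMap.opNorm_le_bound _ (Finset.sum_nonneg fun _ _ => norm_nonneg _)
    fun v => ?_
  have hv : v = ∑ k, v k • e k := by
    have := (EuclideanSpace.basisFun (Fin 3) ℝ).sum_repr v
    simpa [e] using this.symm
  conv_lhs => rw [hv]
  rw [map_sum, Finset.sum_mul]
  refine (norm_sum_le _ _).trans (Finset.sum_le_sum fun k _ => ?_)
  rw [map_smul, norm_smul, mul_comm]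
  exact mul_le_mul_of_nonneg_left (PiLp.norm_apply_le v k) (norm_nonneg _)

/-- The constant in the Sobolev inequality `‖∂ₖf‖₆ ≤ C ‖Δf‖₂`. -/
theorem exists_eLpNorm_six_pd_le : ∃ C : ℝ≥0, ∀ f : E3 → E3, IsTest f → ∀ k,
    eLpNorm (pd k f) 6 volume ≤ C * eLpNorm (lap f) 2 volume := by
  refine ⟨eLpNormLESNormFDerivOfEqInnerConst (volume : Measure E3) 2 * 3, fun f hf k => ?_⟩
  -- Gagliardo–Nirenberg–Sobolev in dimension three: 1/6 = 1/2 - 1/3.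
  have h := eLpNorm_le_eLpNorm_fderiv_of_eq_inner (volume : Measure E3) (p := 2) (p' := 6)
    ((hf.pd k).1.of_le (by simp)) (hf.pd k).2 (by norm_num) (by simp) (by simp; norm_num)
  have h2 : eLpNorm (fderiv ℝ (pd k f)) 2 volume ≤ 3 * eLpNorm (lap f) 2 volume := by
    calc eLpNorm (fderiv ℝ (pd k f)) 2 volume
        ≤ eLpNorm (∑ i, fun x => ‖pd i (pd k f) x‖) 2 volume := by
          refine eLpNorm_mono_real fun x => ?_
          rw [Finset.sum_apply]
          exact norm_fderiv_le_sum _ x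
      _ ≤ ∑ i, eLpNorm (fun x => ‖pd i (pd k f) x‖) 2 volume :=
          eLpNorm_sum_le (fun i _ => ((hf.pd k).pd i).continuous.norm.aestronglyMeasurable)
            (by norm_num)
      _ ≤ ∑ i : Fin 3, eLpNorm (lap f) 2 volume :=
          Finset.sum_le_sum fun i _ => (eLpNorm_norm _).trans_le (eLpNorm_pd_pd_le hf i k)
      _ = _ := by simp
  refine (le_trans (by exact_mod_cast h) (mul_le_mul_right h2 _)).trans_eq ?_
  push_cast
  ring

/-- Interpolation of `L⁴` between `L²` and `L⁶`. -/
theorem eLpNorm_four_pow_le {f : E3 → E3} (hf : AEStronglyMeasurable f) :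
    eLpNorm f 4 volume ^ 4 ≤ eLpNorm f 2 volume * eLpNorm f 6 volume ^ 3 := by
  have hp : ∀ p : ℝ≥0∞, p ≠ 0 → p ≠ ⊤ → eLpNorm f p volume =
      (∫⁻ x, ‖f x‖ₑ ^ p.toReal) ^ (1 / p.toReal) := fun p h0 ht =>
    eLpNorm_eq_lintegral_rpow_enorm_toReal h0 ht
  have h := ENNReal.lintegral_mul_le_Lp_mul_Lq (volume : Measure E3) (p := 2) (q := 2)
    (by constructor <;> norm_num) (f := fun x => ‖f x‖ₑ) (g := fun x => ‖f x‖ₑ ^ 3)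
    hf.enorm (hf.enorm.pow_const 3)
  rw [hp 4 (by norm_num) (by norm_num), hp 2 (by norm_num) (by norm_num),
    hp 6 (by norm_num) (by norm_num)]
  simp only [ENNReal.toReal_ofNat]
  rw [← ENNReal.rpow_natCast, ← ENNReal.rpow_mul, ← ENNReal.rpow_natCast (_ ^ (1 / 6 : ℝ)),
    ← ENNReal.rpow_mul]
  norm_num at h ⊢
  refine le_trans (le_of_eq ?_) (h.trans (le_of_eq ?_))
  · congr 1; ext x; simp [← pow_succ']
  · congr 3
    ext x; rw [← pow_mul]

/-- Young's inequality in a crude form: b c³ = (δ⁻³ b)(δ c)³ is at most the fourth power of the sum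
of the two factors. -/
theorem le_of_pow_four_le {a b c : ℝ≥0∞} {δ : ℝ≥0} (hδ : 0 < δ) (h : a ^ 4 ≤ b * c ^ 3) :
    a ≤ δ * c + (δ⁻¹ ^ 3 : ℝ≥0) * b := by
  refine (ENNReal.pow_le_pow_left_iff four_ne_zero).1 (h.trans ?_)
  have e : b * c ^ 3 = (δ⁻¹ ^ 3 : ℝ≥0) * b * (δ * c) ^ 3 := by
    have : ((δ⁻¹ ^ 3 : ℝ≥0) : ℝ≥0∞) * (δ : ℝ≥0∞) ^ 3 = 1 := by
      norm_cast
      rw [← mul_pow, inv_mul_cancel₀ hδ.ne', one_pow]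
    calc b * c ^ 3 = ((δ⁻¹ ^ 3 : ℝ≥0) : ℝ≥0∞) * (δ : ℝ≥0∞) ^ 3 * (b * c ^ 3) := by
          rw [this, one_mul]
      _ = _ := by ring
  rw [e]
  calc _ ≤ (δ * c + (δ⁻¹ ^ 3 : ℝ≥0) * b) * (δ * c + (δ⁻¹ ^ 3 : ℝ≥0) * b) ^ 3 := by
        gcongr
        · exact le_add_self
        · exact le_self_add
    _ = _ := by ring

theorem le_of_pow_two_le {a b c : ℝ≥0∞} {δ : ℝ≥0} (hδ : 0 < δ) (h : a ^ 2 ≤ b * c) :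
    a ≤ δ * c + (δ⁻¹ : ℝ≥0) * b := by
  refine (ENNReal.pow_le_pow_left_iff two_ne_zero).1 (h.trans ?_)
  have e : b * c = (δ⁻¹ : ℝ≥0) * b * (δ * c) := by
    have : ((δ⁻¹ : ℝ≥0) : ℝ≥0∞) * (δ : ℝ≥0∞) = 1 := by
      norm_cast
      exact inv_mul_cancel₀ hδ.ne'
    calc b * c = ((δ⁻¹ : ℝ≥0) : ℝ≥0∞) * (δ : ℝ≥0∞) * (b * c) := by
          rw [this, one_mul]
      _ = _ := by ring
  rw [e, sq]
  gcongr
  · exact le_add_self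
  · exact le_self_add

/-- Interpolate L⁴ between L² and L⁶. The L⁶ norm is controlled by Δf, and the L² norm of the
gradient by Δf and f. -/
theorem exists_eLpNorm_four_pd_le {δ : ℝ≥0} (hδ : 0 < δ) : ∃ C : ℝ≥0, ∀ f : E3 → E3, IsTest f →
    ∀ k, eLpNorm (pd k f) 4 volume ≤ δ * eLpNorm (lap f) 2 volume + C * eLpNorm f 2 volume := by
  obtain ⟨K, hK⟩ := exists_eLpNorm_six_pd_le
  -- `η` makes the L⁶ contribution at most δ/2; `θ` does the same for the L² contribution, which the
  -- interpolation has inflated by η⁻³.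
  set η : ℝ≥0 := δ / (2 * (K + 1))
  have hη : 0 < η := by positivity
  set θ : ℝ≥0 := δ / (2 * η⁻¹ ^ 3)
  have hθ : 0 < θ := by positivity
  refine ⟨η⁻¹ ^ 3 * θ⁻¹, fun f hf k => ?_⟩
  have h4 := le_of_pow_four_le hη (eLpNorm_four_pow_le (hf.pd k).continuous.aestronglyMeasurable)
  have h2 := le_of_pow_two_le hθ (eLpNorm_pd_sq_le hf k)
  calc eLpNorm (pd k f) 4 volume
      ≤ η * (K * eLpNorm (lap f) 2 volume) + (η⁻¹ ^ 3 : ℝ≥0) *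
        (θ * eLpNorm (lap f) 2 volume + (θ⁻¹ : ℝ≥0) * eLpNorm f 2 volume) := by
        refine h4.trans ?_
        gcongr
        exact hK f hf k
    _ = (η * K + η⁻¹ ^ 3 * θ : ℝ≥0) * eLpNorm (lap f) 2 volume +
        (η⁻¹ ^ 3 * θ⁻¹ : ℝ≥0) * eLpNorm f 2 volume := by push_cast; ring
    _ ≤ _ := by
        gcongr
        have e1 : η * K ≤ δ / 2 := by
          calc η * K ≤ η * (K + 1) := by gcongr; simp
            _ = δ / 2 := by simp only [η]; field_simp
        have e2 : η⁻¹ ^ 3 * θ = δ / 2 := by simp only [θ]; field_simp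
        rw [e2]
        exact (add_le_add_left e1 _).trans_eq (add_halves δ)

/-! ### Convergence in `L^p` along sequences -/

/-- The sequence `f` converges to `u` in `L^p`. -/
def ConvLp (p : ℝ≥0∞) (f : ℕ → E3 → E3) (u : E3 → E3) : Prop :=
  Tendsto (fun n => eLpNorm (fun x => u x - f n x) p volume) atTop (𝓝 0)

theorem tendsto_zero_of_le {a b : ℕ → ℝ≥0∞} (hb : Tendsto b atTop (𝓝 0)) (h : ∀ n, a n ≤ b n) :
    Tendsto a atTop (𝓝 0) :=
  tendsto_of_tendsto_of_tendsto_of_le_of_le tendsto_const_nhds hb (fun _ => zero_le) h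

theorem tendsto_add_zero {a b : ℕ → ℝ≥0∞} (ha : Tendsto a atTop (𝓝 0))
    (hb : Tendsto b atTop (𝓝 0)) : Tendsto (fun n => a n + b n) atTop (𝓝 0) := by
  simpa using ha.add hb

theorem tendsto_const_mul_zero {a : ℕ → ℝ≥0∞} {c : ℝ≥0∞} (hc : c ≠ ⊤)
    (ha : Tendsto a atTop (𝓝 0)) : Tendsto (fun n => c * a n) atTop (𝓝 0) := by
  simpa using ENNReal.Tendsto.const_mul ha (Or.inr hc)

theorem ConvLp.add {p : ℝ≥0∞} (hp : 1 ≤ p) {f g : ℕ → E3 → E3} {u v : E3 → E3}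
    (hf : ∀ n, AEStronglyMeasurable (f n)) (hg : ∀ n, AEStronglyMeasurable (g n))
    (hu : AEStronglyMeasurable u) (hv : AEStronglyMeasurable v)
    (h : ConvLp p f u) (h' : ConvLp p g v) :
    ConvLp p (fun n x => f n x + g n x) (fun x => u x + v x) := by
  refine tendsto_zero_of_le (tendsto_add_zero h h') fun n => ?_
  simp only [add_sub_add_comm]
  exact eLpNorm_add_le (hu.sub (hf n)) (hv.sub (hg n)) hp

theorem ConvLp.clm {p : ℝ≥0∞} {f : ℕ → E3 → E3} {u : E3 → E3} (A : E3 →L[ℝ] E3)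
    (h : ConvLp p f u) : ConvLp p (fun n x => A (f n x)) (fun x => A (u x)) := by
  refine tendsto_zero_of_le (tendsto_const_mul_zero (c := (‖A‖₊ : ℝ≥0)) (by simp) h) fun n => ?_
  simp only [← map_sub]
  exact eLpNorm_le_nnreal_smul_eLpNorm_of_ae_le_mul
    (Eventually.of_forall fun x => A.le_opNNNorm _) p

theorem ConvLp.sum {p : ℝ≥0∞} (hp : 1 ≤ p) {f : Fin 3 → ℕ → E3 → E3} {u : Fin 3 → E3 → E3}
    (hf : ∀ k n, AEStronglyMeasurable (f k n)) (hu : ∀ k, AEStronglyMeasurable (u k))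
    (h : ∀ k, ConvLp p (f k) (u k)) :
    ConvLp p (fun n x => ∑ k, f k n x) (fun x => ∑ k, u k x) := by
  simp only [Fin.sum_univ_three]
  exact ((h 0).add hp (hf 0) (hf 1) (hu 0) (hu 1) (h 1)).add hp
    (fun n => (hf 0 n).add (hf 1 n)) (hf 2) ((hu 0).add (hu 1)) (hu 2) (h 2)

section Bilin

variable {Ω F : Type*} [MeasurableSpace Ω] {μ : Measure Ω} [NormedAddCommGroup F] [NormedSpace ℝ F]
  (B : E3 →L[ℝ] E3 →L[ℝ] F) {u v : Ω → E3}

theorem aestronglyMeasurable_bilin (hu : AEStronglyMeasurable u μ)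
    (hv : AEStronglyMeasurable v μ) : AEStronglyMeasurable (fun x => B (u x) (v x)) μ :=
  B.aestronglyMeasurable_comp₂ hu hv

theorem eLpNorm_bilin_le {p q r : ℝ≥0∞} [ENNReal.HolderTriple p q r]
    (hu : AEStronglyMeasurable u μ) (hv : AEStronglyMeasurable v μ) :
    eLpNorm (fun x => B (u x) (v x)) r μ ≤ ‖B‖₊ * eLpNorm u p μ * eLpNorm v q μ :=
  eLpNorm_le_eLpNorm_mul_eLpNorm_of_nnnorm hu hv (fun a b => B a b) ‖B‖₊
    (Eventually.of_forall fun x => B.le_opNorm₂ (u x) (v x))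

theorem MemLp.bilin {p q r : ℝ≥0∞} [ENNReal.HolderTriple p q r]
    (hu : MemLp u p μ) (hv : MemLp v q μ) : MemLp (fun x => B (u x) (v x)) r μ :=
  ⟨aestronglyMeasurable_bilin B hu.1 hv.1, (eLpNorm_bilin_le (p := p) (q := q) B hu.1 hv.1).trans_lt
    (ENNReal.mul_lt_top (ENNReal.mul_lt_top (by simp) hu.2) hv.2)⟩

end Bilin

theorem ConvLp.bilin (B : E3 →L[ℝ] E3 →L[ℝ] E3) {p q r : ℝ≥0∞} [ENNReal.HolderTriple p q r]
    (hr : 1 ≤ r) {f g : ℕ → E3 → E3} {u v : E3 → E3}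
    (hf : ∀ n, AEStronglyMeasurable (f n)) (hg : ∀ n, AEStronglyMeasurable (g n))
    (hu : MemLp u p volume) (hv : MemLp v q volume) (h : ConvLp p f u) (h' : ConvLp q g v) :
    ConvLp r (fun n x => B (f n x) (g n x)) (fun x => B (u x) (v x)) := by
  have e1 : Tendsto (fun n => ‖B‖₊ * eLpNorm (fun x => u x - f n x) p volume *
      eLpNorm v q volume) atTop (𝓝 0) := by
    have := tendsto_const_mul_zero (c := ‖B‖₊ * eLpNorm v q volume)
      (ENNReal.mul_ne_top (by simp) hv.2.ne) h
    exact this.congr fun n => by ring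
  have e2 : Tendsto (fun n => ‖B‖₊ * eLpNorm u p volume *
      eLpNorm (fun x => v x - g n x) q volume) atTop (𝓝 0) :=
    tendsto_const_mul_zero (ENNReal.mul_ne_top (by simp) hu.2.ne) h'
  have e3 : Tendsto (fun n => ‖B‖₊ * eLpNorm (fun x => u x - f n x) p volume *
      eLpNorm (fun x => v x - g n x) q volume) atTop (𝓝 0) := by
    have := ENNReal.Tendsto.mul (tendsto_const_mul_zero (c := ‖B‖₊) (by simp) h) (by simp) h'
      (by simp)
    simpa using this
  refine tendsto_zero_of_le (tendsto_add_zero (tendsto_add_zero e1 e2) e3) fun n => ?_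
  have hd := hu.1.sub (hf n)
  have hd' := hv.1.sub (hg n)
  -- The splitting puts the limits `u` and `v` in the linear terms and two null sequences in the
  -- remainder, so no uniform bounds on `f n` and `g n` are needed.
  have : (fun x => B (u x) (v x) - B (f n x) (g n x)) =
      (fun x => B (u x - f n x) (v x)) + (fun x => B (u x) (v x - g n x)) -
      (fun x => B (u x - f n x) (v x - g n x)) := by
    ext1 x
    simp only [Pi.add_apply, Pi.sub_apply, map_sub, _root_.sub_apply]
    abel
  rw [this]
  have m1 := aestronglyMeasurable_bilin B hd hv.1
  have m2 := aestronglyMeasurable_bilin B hu.1 hd'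
  have m3 := aestronglyMeasurable_bilin B hd hd'
  refine (eLpNorm_sub_le (m1.add m2) m3 hr).trans (add_le_add ((eLpNorm_add_le m1 m2 hr).trans
    (add_le_add ?_ ?_)) ?_)
  · exact eLpNorm_bilin_le B hd hv.1
  · exact eLpNorm_bilin_le B hu.1 hd'
  · exact eLpNorm_bilin_le B hd hd'

/-- Lower semicontinuity of the `L^q` norm under convergence in `L^p`. -/
theorem eLpNorm_le_of_convLp {p q : ℝ≥0∞} (hp : p ≠ 0) {f : ℕ → E3 → E3} {u : E3 → E3}
    (hf : ∀ n, AEStronglyMeasurable (f n)) (hu : AEStronglyMeasurable u) (h : ConvLp p f u)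
    {b : ℕ → ℝ≥0∞} {c : ℝ≥0∞} (hb : ∀ n, eLpNorm (f n) q volume ≤ b n)
    (hc : Tendsto b atTop (𝓝 c)) : eLpNorm u q volume ≤ c := by
  have hm : TendstoInMeasure volume f atTop u := by
    refine tendstoInMeasure_of_tendsto_eLpNorm hp hf hu (h.congr fun n => ?_)
    rw [← eLpNorm_neg]
    congr 1; ext1 x; simp
  obtain ⟨ns, hns, hae⟩ := hm.exists_seq_tendsto_ae
  refine (Lp.eLpNorm_lim_le_liminf_eLpNorm (fun n => hf (ns n)) u hae).trans ?_
  rw [← (hc.comp hns.tendsto_atTop).liminf_eq]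
  exact liminf_le_liminf (Eventually.of_forall fun n => hb (ns n))

theorem eLpNorm_le_add_conv {p : ℝ≥0∞} (hp : 1 ≤ p) {f u : E3 → E3} (hf : AEStronglyMeasurable f)
    (hu : AEStronglyMeasurable u) :
    eLpNorm f p volume ≤ eLpNorm u p volume + eLpNorm (fun x => u x - f x) p volume := by
  have : f = u - fun x => u x - f x := by ext1 x; simp
  conv_lhs => rw [this]
  exact eLpNorm_sub_le hu (hu.sub hf) hp

theorem ConvLp.tendsto_bound {p : ℝ≥0∞} {f : ℕ → E3 → E3} {u : E3 → E3} (h : ConvLp p f u) :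
    Tendsto (fun n => eLpNorm u p volume + eLpNorm (fun x => u x - f n x) p volume) atTop
      (𝓝 (eLpNorm u p volume)) := by
  simpa using tendsto_const_nhds.add h

/-! ### The `L²`-closure of the second order jets of test functions -/

/-- The sequence `f` of test functions converges to the second order jet `(u, D, L)` in `L²`. -/
structure JetConv (f : ℕ → E3 → E3) (u : E3 → E3) (D : Fin 3 → E3 → E3) (L : E3 → E3) : Prop where
  test : ∀ n, IsTest (f n)
  val : ConvLp 2 f u
  pd : ∀ k, ConvLp 2 (fun n => pd k (f n)) (D k)
  lap : ConvLp 2 (fun n => lap (f n)) L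

/-- `u` belongs to `H²` with first derivatives `D` and Laplacian `L`, in the sense that this jet is
a limit of jets of test functions. -/
structure H2 (u : E3 → E3) (D : Fin 3 → E3 → E3) (L : E3 → E3) : Prop where
  val : MemLp u 2 volume
  pd : ∀ k, MemLp (D k) 2 volume
  lap : MemLp L 2 volume
  approx : ∃ f, JetConv f u D L

theorem ConvLp.const (p : ℝ≥0∞) (f : E3 → E3) : ConvLp p (fun _ => f) f := by
  simp [ConvLp]

theorem H2.of_test {f : E3 → E3} (hf : IsTest f) : H2 f (fun k => LLG.pd k f) (LLG.lap f) :=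
  ⟨hf.memLp 2, fun k => (hf.pd k).memLp 2, hf.lap.memLp 2, fun _ => f, fun _ => hf,
    ConvLp.const _ _, fun _ => ConvLp.const _ _, ConvLp.const _ _⟩

variable {u v : E3 → E3} {D D' : Fin 3 → E3 → E3} {L L' : E3 → E3}

theorem H2.congr (h : H2 u D L) (hu : u =ᵐ[volume] v) (hD : ∀ k, D k =ᵐ[volume] D' k)
    (hL : L =ᵐ[volume] L') : H2 v D' L' := by
  obtain ⟨f, hf⟩ := h.approx
  refine ⟨h.val.ae_eq hu, fun k => (h.pd k).ae_eq (hD k), h.lap.ae_eq hL, f, hf.test, ?_,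
    fun k => ?_, ?_⟩
  · exact hf.val.congr fun n => eLpNorm_congr_ae (hu.mono fun x hx => by simp only [hx])
  · exact (hf.pd k).congr fun n => eLpNorm_congr_ae ((hD k).mono fun x hx => by simp only [hx])
  · exact hf.lap.congr fun n => eLpNorm_congr_ae (hL.mono fun x hx => by simp only [hx])

theorem H2.add (h : H2 u D L) (h' : H2 v D' L') :
    H2 (fun x => u x + v x) (fun k x => D k x + D' k x) (fun x => L x + L' x) := by
  obtain ⟨f, hf⟩ := h.approx
  obtain ⟨g, hg⟩ := h'.approx
  refine ⟨h.val.add h'.val, fun k => (h.pd k).add (h'.pd k), h.lap.add h'.lap,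
    fun n => f n + g n, fun n => (hf.test n).add (hg.test n), ?_, fun k => ?_, ?_⟩
  · exact hf.val.add one_le_two (fun n => ((hf.test n).memLp 2).1)
      (fun n => ((hg.test n).memLp 2).1) h.val.1 h'.val.1 hg.val
  · have := (hf.pd k).add one_le_two (fun n => (((hf.test n).pd k).memLp 2).1)
      (fun n => (((hg.test n).pd k).memLp 2).1) (h.pd k).1 (h'.pd k).1 (hg.pd k)
    exact this.congr fun n => by simp only [pd_add (hf.test n).1 (hg.test n).1]; rfl
  · have := hf.lap.add one_le_two (fun n => ((hf.test n).lap.memLp 2).1)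
      (fun n => ((hg.test n).lap.memLp 2).1) h.lap.1 h'.lap.1 hg.lap
    exact this.congr fun n => by simp only [lap_add (hf.test n).1 (hg.test n).1]; rfl

theorem H2.clm (h : H2 u D L) (A : E3 →L[ℝ] E3) :
    H2 (fun x => A (u x)) (fun k x => A (D k x)) (fun x => A (L x)) := by
  obtain ⟨f, hf⟩ := h.approx
  refine ⟨A.comp_memLp' h.val, fun k => A.comp_memLp' (h.pd k), A.comp_memLp' h.lap,
    fun n x => A (f n x), fun n => (hf.test n).clm A, hf.val.clm A, fun k => ?_, ?_⟩
  · exact ((hf.pd k).clm A).congr fun n => by simp only [pd_clm (hf.test n).1]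
  · exact (hf.lap.clm A).congr fun n => by simp only [lap_clm (hf.test n).1]

theorem H2.smul (h : H2 u D L) (r : ℝ) :
    H2 (fun x => r • u x) (fun k x => r • D k x) (fun x => r • L x) :=
  h.clm (r • ContinuousLinearMap.id ℝ E3)

theorem H2.sub (h : H2 u D L) (h' : H2 v D' L') :
    H2 (fun x => u x - v x) (fun k x => D k x - D' k x) (fun x => L x - L' x) := by
  simpa [sub_eq_add_neg] using h.add (h'.smul (-1))

theorem H2.sub_test (h : H2 u D L) {f : E3 → E3} (hf : IsTest f) :
    H2 (fun x => u x - f x) (fun k x => D k x - LLG.pd k f x) (fun x => L x - LLG.lap f x) :=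
  h.sub (H2.of_test hf)

/-- Inequalities between norms of jets pass from test functions to `H²`. -/
theorem H2.transfer_le {p q : ℝ≥0∞} {c C : ℝ≥0} (h : H2 u D L) {g : (E3 → E3) → E3 → E3}
    {w : E3 → E3} (hg : ∀ f, IsTest f → AEStronglyMeasurable (g f)) (hw : AEStronglyMeasurable w)
    (hp : p ≠ 0) (hc : ∀ f, JetConv f u D L → ConvLp p (fun n => g (f n)) w)
    (hle : ∀ f, IsTest f → eLpNorm (g f) q volume ≤
      c * eLpNorm (LLG.lap f) 2 volume + C * eLpNorm f 2 volume) :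
    eLpNorm w q volume ≤ c * eLpNorm L 2 volume + C * eLpNorm u 2 volume := by
  obtain ⟨f, hf⟩ := h.approx
  refine eLpNorm_le_of_convLp hp (fun n => hg _ (hf.test n)) hw (hc f hf)
    (fun n => (hle _ (hf.test n)).trans (add_le_add
      (mul_le_mul_right (eLpNorm_le_add_conv one_le_two ((hf.test n).lap.memLp 2).1 h.lap.1) _)
      (mul_le_mul_right (eLpNorm_le_add_conv one_le_two ((hf.test n).memLp 2).1 h.val.1) _))) ?_
  exact (ENNReal.Tendsto.const_mul hf.lap.tendsto_bound (Or.inr (by simp))).add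
    (ENNReal.Tendsto.const_mul hf.val.tendsto_bound (Or.inr (by simp)))

theorem exists_H2_eLpNorm_top_le {δ : ℝ≥0} (hδ : 0 < δ) : ∃ C : ℝ≥0,
    ∀ (u : E3 → E3) (D : Fin 3 → E3 → E3) (L : E3 → E3), H2 u D L →
      eLpNorm u ⊤ volume ≤ δ * eLpNorm L 2 volume + C * eLpNorm u 2 volume := by
  obtain ⟨C, hC⟩ := exists_enorm_test_le hδ
  refine ⟨C, fun u D L h => h.transfer_le (g := fun f => f) (p := 2)
    (fun f hf => (hf.memLp 2).1) h.val.1 two_ne_zero (fun f hf => hf.val) fun f hf => ?_⟩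
  rw [eLpNorm_exponent_top]
  exact eLpNormEssSup_le_of_ae_enorm_bound (Eventually.of_forall (hC f hf))

theorem exists_H2_eLpNorm_four_le {δ : ℝ≥0} (hδ : 0 < δ) : ∃ C : ℝ≥0,
    ∀ (u : E3 → E3) (D : Fin 3 → E3 → E3) (L : E3 → E3), H2 u D L → ∀ k,
      eLpNorm (D k) 4 volume ≤ δ * eLpNorm L 2 volume + C * eLpNorm u 2 volume := by
  obtain ⟨C, hC⟩ := exists_eLpNorm_four_pd_le hδ
  exact ⟨C, fun u D L h k => h.transfer_le (g := fun f => LLG.pd k f) (p := 2)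
    (fun f hf => ((hf.pd k).memLp 2).1) (h.pd k).1 two_ne_zero (fun f hf => hf.pd k)
    fun f hf => hC f hf k⟩

theorem exists_H2_eLpNorm_six_le : ∃ C : ℝ≥0,
    ∀ (u : E3 → E3) (D : Fin 3 → E3 → E3) (L : E3 → E3), H2 u D L → ∀ k,
      eLpNorm (D k) 6 volume ≤ C * eLpNorm L 2 volume := by
  obtain ⟨C, hC⟩ := exists_eLpNorm_six_pd_le
  refine ⟨C, fun u D L h k => ?_⟩
  simpa using h.transfer_le (g := fun f => LLG.pd k f) (p := 2) (c := C) (C := 0)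
    (fun f hf => ((hf.pd k).memLp 2).1) (h.pd k).1 two_ne_zero (fun f hf => hf.pd k)
    fun f hf => by simpa using hC f hf k

theorem H2.memLp_top (h : H2 u D L) : MemLp u ⊤ volume := by
  obtain ⟨C, hC⟩ := exists_H2_eLpNorm_top_le one_pos
  exact ⟨h.val.1, (hC u D L h).trans_lt (ENNReal.add_lt_top.2
    ⟨ENNReal.mul_lt_top (by simp) h.lap.2, ENNReal.mul_lt_top (by simp) h.val.2⟩)⟩

theorem H2.memLp_four (h : H2 u D L) (k : Fin 3) : MemLp (D k) 4 volume := by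
  obtain ⟨C, hC⟩ := exists_H2_eLpNorm_four_le one_pos
  exact ⟨(h.pd k).1, (hC u D L h k).trans_lt (ENNReal.add_lt_top.2
    ⟨ENNReal.mul_lt_top (by simp) h.lap.2, ENNReal.mul_lt_top (by simp) h.val.2⟩)⟩

theorem H2.memLp_six (h : H2 u D L) (k : Fin 3) : MemLp (D k) 6 volume := by
  obtain ⟨C, hC⟩ := exists_H2_eLpNorm_six_le
  exact ⟨(h.pd k).1, (hC u D L h k).trans_lt (ENNReal.mul_lt_top (by simp) h.lap.2)⟩

/-- The difference u - f n is itself in `H2`, so the Sobolev inequality upgrades the L² convergence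
of its jet. -/
theorem JetConv.conv_top {f : ℕ → E3 → E3} (h : JetConv f u D L) (hu : H2 u D L) :
    ConvLp ⊤ f u := by
  obtain ⟨C, hC⟩ := exists_H2_eLpNorm_top_le one_pos
  exact tendsto_zero_of_le (tendsto_add_zero (tendsto_const_mul_zero (c := (1 : ℝ≥0)) (by simp)
    h.lap) (tendsto_const_mul_zero (c := C) (by simp) h.val))
    fun n => hC _ _ _ (hu.sub_test (h.test n))

theorem JetConv.conv_four {f : ℕ → E3 → E3} (h : JetConv f u D L) (hu : H2 u D L) (k : Fin 3) :
    ConvLp 4 (fun n => LLG.pd k (f n)) (D k) := by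
  obtain ⟨C, hC⟩ := exists_H2_eLpNorm_four_le one_pos
  exact tendsto_zero_of_le (tendsto_add_zero (tendsto_const_mul_zero (c := (1 : ℝ≥0)) (by simp)
    h.lap) (tendsto_const_mul_zero (c := C) (by simp) h.val))
    fun n => hC _ _ _ (hu.sub_test (h.test n)) k

instance holderTriple_four_four_two : ENNReal.HolderTriple 4 4 2 where
  inv_add_inv_eq_inv := by
    rw [show (4 : ℝ≥0∞) = 2 * 2 by norm_num, ENNReal.mul_inv (by simp) (by simp), ← two_mul,
      ← mul_assoc, ENNReal.mul_inv_cancel (by simp) (by simp), one_mul]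

/-- `H²` is stable under bilinear products. -/
theorem H2.bilin (B : E3 →L[ℝ] E3 →L[ℝ] E3) (h : H2 u D L) (h' : H2 v D' L') :
    H2 (fun x => B (u x) (v x)) (fun k x => B (D k x) (v x) + B (u x) (D' k x))
      (fun x => leib B (u x) (fun k => D k x) (L x) (v x) (fun k => D' k x) (L' x)) := by
  obtain ⟨f, hf⟩ := h.approx
  obtain ⟨g, hg⟩ := h'.approx
  have hut := h.memLp_top
  have hvt := h'.memLp_top
  have mf := fun n => ((hf.test n).memLp 2).1
  have mg := fun n => ((hg.test n).memLp 2).1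
  have mfk := fun k n => (((hf.test n).pd k).memLp 2).1
  have mgk := fun k n => (((hg.test n).pd k).memLp 2).1
  have mfl := fun n => ((hf.test n).lap.memLp 2).1
  have mgl := fun n => ((hg.test n).lap.memLp 2).1
  have m0 : MemLp (fun x => B (u x) (v x)) 2 volume := MemLp.bilin (p := ⊤) (q := 2) B hut h'.val
  have m1 : ∀ k, MemLp (fun x => B (D k x) (v x)) 2 volume := fun k =>
    MemLp.bilin (p := 2) (q := ⊤) B (h.pd k) hvt
  have m2 : ∀ k, MemLp (fun x => B (u x) (D' k x)) 2 volume := fun k =>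
    MemLp.bilin (p := ⊤) (q := 2) B hut (h'.pd k)
  have m3 : MemLp (fun x => B (L x) (v x)) 2 volume := MemLp.bilin (p := 2) (q := ⊤) B h.lap hvt
  have m4 : MemLp (fun x => B (u x) (L' x)) 2 volume := MemLp.bilin (p := ⊤) (q := 2) B hut h'.lap
  -- The product of first derivatives is where L⁴ is indispensable: L² factors would only give L¹.
  have m5 : ∀ k, MemLp (fun x => B (D k x) (D' k x)) 2 volume := fun k =>
    MemLp.bilin (p := 4) (q := 4) B (h.memLp_four k) (h'.memLp_four k)
  have m6 : MemLp (fun x => ∑ k, B (D k x) (D' k x)) 2 volume :=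
    memLp_finsetSum _ fun k _ => m5 k
  have m7 : MemLp (fun x => (2 : ℝ) • ∑ k, B (D k x) (D' k x)) 2 volume := m6.const_smul (2 : ℝ)
  refine ⟨m0, fun k => (m1 k).add (m2 k), (m3.add m7).add m4, fun n x => B (f n x) (g n x),
    fun n => IsTest.bilin_right B (hf.test n).1 (hg.test n), ?_, fun k => ?_, ?_⟩
  · exact ConvLp.bilin (p := ⊤) (q := 2) B one_le_two mf mg hut h'.val (hf.conv_top h) hg.val
  · have c1 := ConvLp.bilin (p := 2) (q := ⊤) (r := 2) B one_le_two (mfk k) mg (h.pd k) hvt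
      (hf.pd k) (hg.conv_top h')
    have c2 := ConvLp.bilin (p := ⊤) (q := 2) (r := 2) B one_le_two mf (mgk k) hut (h'.pd k)
      (hf.conv_top h) (hg.pd k)
    have := c1.add one_le_two (fun n => aestronglyMeasurable_bilin B (mfk k n) (mg n))
      (fun n => aestronglyMeasurable_bilin B (mf n) (mgk k n)) (m1 k).1 (m2 k).1 c2
    exact this.congr fun n => by simp only [pd_bilin B (hf.test n).1 (hg.test n).1]
  · have c3 := ConvLp.bilin (p := 2) (q := ⊤) (r := 2) B one_le_two mfl mg h.lap hvt
      hf.lap (hg.conv_top h')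
    have c4 := ConvLp.bilin (p := ⊤) (q := 2) (r := 2) B one_le_two mf mgl hut h'.lap
      (hf.conv_top h) hg.lap
    have c5 : ∀ k, ConvLp 2 (fun n x => B (LLG.pd k (f n) x) (LLG.pd k (g n) x))
        (fun x => B (D k x) (D' k x)) := fun k =>
      ConvLp.bilin (p := 4) (q := 4) (r := 2) B one_le_two (mfk k) (mgk k) (h.memLp_four k)
        (h'.memLp_four k) (hf.conv_four h k) (hg.conv_four h' k)
    have ms := fun k n => aestronglyMeasurable_bilin B (mfk k n) (mgk k n)
    have c6 := ConvLp.sum one_le_two ms (fun k => (m5 k).1) c5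
    have c7 := c6.clm ((2 : ℝ) • ContinuousLinearMap.id ℝ E3)
    have ms' : ∀ n, AEStronglyMeasurable (fun x => ∑ k, B (LLG.pd k (f n) x) (LLG.pd k (g n) x)) :=
      fun n => Finset.aestronglyMeasurable_fun_sum _ fun k _ => ms k n
    have ms3 := fun n => aestronglyMeasurable_bilin B (mfl n) (mg n)
    have := (c3.add one_le_two ms3 (fun n => (ms' n).const_smul (2 : ℝ)) m3.1 m7.1 c7).add
      one_le_two (fun n => (ms3 n).add ((ms' n).const_smul (2 : ℝ)))
      (fun n => aestronglyMeasurable_bilin B (mf n) (mgl n)) (m3.add m7).1 m4.1 c4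
    exact this.congr fun n => by simp only [lap_bilin B (hf.test n).1 (hg.test n).1]; rfl

/-! ### Uniqueness of the derivatives -/

theorem enorm_integral_smul_le {φ : E3 → ℝ} {g : E3 → E3} (hφ : MemLp φ 2 volume)
    (hg : AEStronglyMeasurable g) :
    ‖∫ x, φ x • g x‖ₑ ≤ eLpNorm φ 2 volume * eLpNorm g 2 volume := by
  refine (enorm_integral_le_lintegral_enorm _).trans ?_
  rw [← eLpNorm_one_eq_lintegral_enorm]
  exact eLpNorm_smul_le_mul_eLpNorm (p := 2) (q := 2) (r := 1) (f := g) (φ := φ) hg hφ.1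

theorem ConvLp.tendsto_integral_smul {f : ℕ → E3 → E3} {φ : E3 → ℝ} (h : ConvLp 2 f u)
    (hf : ∀ n, MemLp (f n) 2 volume) (hu : MemLp u 2 volume) (hφ : MemLp φ 2 volume) :
    Tendsto (fun n => ∫ x, φ x • f n x) atTop (𝓝 (∫ x, φ x • u x)) := by
  rw [tendsto_iff_edist_tendsto_0]
  refine tendsto_zero_of_le (tendsto_const_mul_zero hφ.2.ne h) fun n => ?_
  have i1 : Integrable (fun x => φ x • u x) := memLp_one_iff_integrable.1 (hu.smul (r := 1) hφ)
  have i2 : Integrable (fun x => φ x • f n x) := memLp_one_iff_integrable.1 ((hf n).smul (r := 1) hφ)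
  rw [edist_comm, edist_eq_enorm_sub, ← integral_sub i1 i2]
  simp only [← smul_sub]
  exact enorm_integral_smul_le hφ (hu.1.sub (hf n).1)

theorem integral_smul_pd {φ : E3 → ℝ} {f : E3 → E3} (hφ : ContDiff ℝ ∞ φ) (hf : IsTest f)
    (k : Fin 3) : ∫ x, φ x • pd k f x = -∫ x, pd k φ x • f x :=
  integral_bilin_pd (ContinuousLinearMap.lsmul ℝ ℝ) hφ hf k

theorem integral_smul_lap {φ : E3 → ℝ} {f : E3 → E3} (hφ : ContDiff ℝ ∞ φ) (hf : IsTest f) :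
    ∫ x, φ x • lap f x = ∫ x, lap φ x • f x := by
  have i : ∀ {ψ : E3 → ℝ} {g : E3 → E3}, ContDiff ℝ ∞ ψ → IsTest g →
      Integrable (fun x => ψ x • g x) := fun hψ hg =>
    (IsTest.bilin_right (ContinuousLinearMap.lsmul ℝ ℝ) hψ hg).integrable
  simp only [lap, Finset.smul_sum, Finset.sum_smul]
  rw [integral_finsetSum _ fun k _ => i hφ ((hf.pd k).pd k),
    integral_finsetSum _ fun k _ => i (contDiff_pd (contDiff_pd hφ k) k) hf]
  exact Finset.sum_congr rfl fun k _ => by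
    rw [integral_smul_pd hφ (hf.pd k), integral_smul_pd (contDiff_pd hφ k) hf, neg_neg]

theorem H2.integral_pd (h : H2 u D L) {φ : E3 → ℝ} (hφ : IsTest φ) (k : Fin 3) :
    ∫ x, φ x • D k x = -∫ x, LLG.pd k φ x • u x := by
  obtain ⟨f, hf⟩ := h.approx
  have h1 := (hf.pd k).tendsto_integral_smul (fun n => ((hf.test n).pd k).memLp 2) (h.pd k)
    (hφ.memLp 2)
  have h2 := hf.val.tendsto_integral_smul (fun n => (hf.test n).memLp 2) h.val
    ((hφ.pd k).memLp 2)
  simp only [integral_smul_pd hφ.1 (hf.test _)] at h1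
  exact tendsto_nhds_unique h1 h2.neg

theorem H2.integral_lap (h : H2 u D L) {φ : E3 → ℝ} (hφ : IsTest φ) :
    ∫ x, φ x • L x = ∫ x, LLG.lap φ x • u x := by
  obtain ⟨f, hf⟩ := h.approx
  have h1 := hf.lap.tendsto_integral_smul (fun n => (hf.test n).lap.memLp 2) h.lap (hφ.memLp 2)
  have h2 := hf.val.tendsto_integral_smul (fun n => (hf.test n).memLp 2) h.val (hφ.lap.memLp 2)
  simp only [integral_smul_lap hφ.1 (hf.test _)] at h1
  exact tendsto_nhds_unique h1 h2

/-- Pairing with test functions recovers `D` and `L` from u alone. The lemma allows pointwise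
identities between fields to be differentiated. -/
theorem H2.unique (h : H2 u D L) (h' : H2 v D' L') (huv : u =ᵐ[volume] v) :
    (∀ k, D k =ᵐ[volume] D' k) ∧ L =ᵐ[volume] L' := by
  have hc : ∀ φ : E3 → ℝ, ∫ x, φ x • u x = ∫ x, φ x • v x := fun φ =>
    integral_congr_ae (huv.mono fun x hx => by simp only [hx])
  refine ⟨fun k => ?_, ?_⟩
  · refine ae_eq_of_integral_contDiff_smul_eq ((h.pd k).locallyIntegrable one_le_two)
      ((h'.pd k).locallyIntegrable one_le_two) fun φ h1 h2 => ?_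
    rw [h.integral_pd ⟨h1, h2⟩, h'.integral_pd ⟨h1, h2⟩, hc]
  · refine ae_eq_of_integral_contDiff_smul_eq (h.lap.locallyIntegrable one_le_two)
      (h'.lap.locallyIntegrable one_le_two) fun φ h1 h2 => ?_
    rw [h.integral_lap ⟨h1, h2⟩, h'.integral_lap ⟨h1, h2⟩, hc]

/-! ### A countable dense family of test functions -/

/-- Needed because the null set of exceptional times depends on the test function. Jets of test
functions form a subset of a finite product of copies of L², which is separable, so a countable
subset is dense among them. -/
theorem exists_countable_test : ∃ 𝓕 : Set (E3 → E3), 𝓕.Countable ∧ (∀ f ∈ 𝓕, IsTest f) ∧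
    ∀ (u : E3 → E3) (D : Fin 3 → E3 → E3) (L : E3 → E3), H2 u D L →
      ∃ f, JetConv f u D L ∧ ∀ n, f n ∈ 𝓕 := by
  let X := Lp E3 2 (volume : Measure E3) × (Fin 3 → Lp E3 2 (volume : Measure E3)) ×
    Lp E3 2 (volume : Measure E3)
  have hX : SecondCountableTopology (Lp E3 2 (volume : Measure E3)) := by
    have : Fact ((2 : ℝ≥0∞) ≠ ⊤) := ⟨by simp⟩
    exact Lp.SecondCountableTopology
  have hX' : TopologicalSpace.SeparableSpace (Lp E3 2 (volume : Measure E3)) :=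
    TopologicalSpace.SecondCountableTopology.to_separableSpace
  have hs : TopologicalSpace.SeparableSpace X := by
    simp only [X]
    infer_instance
  have : Nonempty {f : E3 → E3 // IsTest f} := ⟨⟨0, IsTest.zero⟩⟩
  let J : {f : E3 → E3 // IsTest f} → X := fun f => ((f.2.memLp 2).toLp,
    fun k => ((f.2.pd k).memLp 2).toLp, (f.2.lap.memLp 2).toLp)
  obtain ⟨c, hc, hcc, hcd⟩ :=
    (TopologicalSpace.IsSeparable.of_separableSpace (range J)).exists_countable_dense_subset
  choose! S hS using fun x (hx : x ∈ c) => hc hx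
  have conv : ∀ {F : ℕ → Lp E3 2 (volume : Measure E3)} {G : Lp E3 2 (volume : Measure E3)}
      {f : ℕ → E3 → E3} {g : E3 → E3}, (∀ n, F n =ᵐ[volume] f n) → G =ᵐ[volume] g →
      Tendsto F atTop (𝓝 G) → ConvLp 2 f g := fun {F G f g} hF hG h => by
    rw [tendsto_iff_edist_tendsto_0] at h
    refine h.congr fun n => ?_
    rw [edist_comm, Lp.edist_def]
    refine eLpNorm_congr_ae ?_
    filter_upwards [hF n, hG] with x h1 h2
    simp [h1, h2]
  refine ⟨(fun x => (S x).1) '' c, hcc.image _, ?_, fun u D L h => ?_⟩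
  · rintro _ ⟨x, -, rfl⟩
    exact (S x).2
  obtain ⟨f, hf⟩ := h.approx
  let y : X := (h.val.toLp, fun k => (h.pd k).toLp, h.lap.toLp)
  have lim : ∀ {g : ℕ → E3 → E3} {w : E3 → E3} (hg : ∀ n, MemLp (g n) 2 volume)
      (hw : MemLp w 2 volume), ConvLp 2 g w →
      Tendsto (fun n => (hg n).toLp) atTop (𝓝 hw.toLp) := fun {g w} hg hw h => by
    rw [tendsto_iff_edist_tendsto_0]
    refine h.congr fun n => ?_
    rw [edist_comm, Lp.edist_toLp_toLp]
    rfl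
  have hy : y ∈ closure (range J) := by
    refine mem_closure_of_tendsto (f := fun n => J ⟨f n, hf.test n⟩) (b := atTop) ?_
      (Eventually.of_forall fun n => mem_range_self _)
    refine Tendsto.prodMk_nhds (lim _ _ hf.val) (Tendsto.prodMk_nhds ?_ (lim _ _ hf.lap))
    exact tendsto_pi_nhds.2 fun k => lim _ _ (hf.pd k)
  obtain ⟨x, hx, hxy⟩ := mem_closure_iff_seq_limit.1 (closure_minimal hcd isClosed_closure hy)
  have hJ : ∀ n, J (S (x n)) = x n := fun n => hS _ (hx n)
  rw [show x = fun n => J (S (x n)) from funext fun n => (hJ n).symm] at hxy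
  refine ⟨fun n => (S (x n)).1, ⟨fun n => (S (x n)).2, ?_, fun k => ?_, ?_⟩,
    fun n => mem_image_of_mem _ (hx n)⟩
  · exact conv (fun n => MemLp.coeFn_toLp ((S (x n)).2.memLp 2)) (MemLp.coeFn_toLp h.val)
      ((continuous_fst.tendsto y).comp hxy)
  · exact conv (fun n => MemLp.coeFn_toLp (((S (x n)).2.pd k).memLp 2)) (MemLp.coeFn_toLp (h.pd k))
      (((continuous_apply k).comp (continuous_fst.comp continuous_snd)).tendsto y |>.comp hxy)
  · exact conv (fun n => MemLp.coeFn_toLp ((S (x n)).2.lap.memLp 2)) (MemLp.coeFn_toLp h.lap)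
      ((continuous_snd.comp continuous_snd).tendsto y |>.comp hxy)

/-! ### Mollification -/

/-- Translations are continuous in `L²`. -/
theorem exists_translation_le {g : E3 → E3} (hg : MemLp g 2 volume) {ε : ℝ≥0∞} (hε : 0 < ε) :
    ∃ δ > 0, ∀ y : E3, ‖y‖ < δ → eLpNorm (fun x => g (x - y) - g x) 2 volume ≤ ε := by
  let T : C(E3, C(E3, E3)) := ContinuousMap.curry ⟨fun p : E3 × E3 => p.2 - p.1, by fun_prop⟩
  have hT : ∀ y, MeasurePreserving (T y) (volume : Measure E3) volume := fun y =>
    measurePreserving_sub_right volume y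
  have hc : Continuous fun y => Lp.compMeasurePreserving (T y) (hT y) hg.toLp :=
    Continuous.compMeasurePreservingLp continuous_const T.continuous hT (by simp)
  have h0 := hc.tendsto 0
  rw [tendsto_iff_edist_tendsto_0] at h0
  have h1 := h0.eventually (ge_mem_nhds hε)
  obtain ⟨δ, hδ, hb⟩ := Metric.eventually_nhds_iff.1 h1
  refine ⟨δ, hδ, fun y hy => ?_⟩
  have h2 := hb (y := y) (by simpa using hy)
  rw [Lp.edist_def] at h2
  refine (le_of_eq (eLpNorm_congr_ae ?_)).trans h2
  have e : ∀ y, (Lp.compMeasurePreserving (T y) (hT y) hg.toLp : E3 → E3) =ᵐ[volume]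
      fun x => g (x - y) := fun y =>
    (Lp.coeFn_compMeasurePreserving _ _).trans
      ((hT y).quasiMeasurePreserving.ae_eq_comp hg.coeFn_toLp)
  filter_upwards [e y, e 0] with x h3 h4
  rw [Pi.sub_apply, h3, h4, sub_zero]

/-- Jensen's inequality for the probability density r, by Cauchy–Schwarz after splitting r into two
square roots. -/
theorem sq_lintegral_mul_le {r G : E3 → ℝ≥0∞} (hr : AEMeasurable r) (hG : AEMeasurable G)
    (h1 : ∫⁻ y, r y = 1) : (∫⁻ y, r y * G y) ^ 2 ≤ ∫⁻ y, r y * G y ^ 2 := by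
  have h := ENNReal.lintegral_mul_le_Lp_mul_Lq (volume : Measure E3) (p := 2) (q := 2)
    (by constructor <;> norm_num) (f := fun y => r y ^ (1 / 2 : ℝ))
    (g := fun y => r y ^ (1 / 2 : ℝ) * G y) (hr.pow_const _) ((hr.pow_const _).mul hG)
  have hsq : ∀ a : ℝ≥0∞, a ^ (1 / 2 : ℝ) * a ^ (1 / 2 : ℝ) = a := fun a => by
    rw [← ENNReal.rpow_add_of_nonneg _ _ (by norm_num) (by norm_num)]; norm_num
  have hsq2 : ∀ a : ℝ≥0∞, (a ^ (1 / 2 : ℝ)) ^ (2 : ℝ) = a := fun a => by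
    rw [← ENNReal.rpow_mul]; norm_num
  simp only [Pi.mul_apply, ← mul_assoc, hsq, hsq2, h1, ENNReal.mul_rpow_of_nonneg _ _ zero_le_two,
    ENNReal.one_rpow, one_mul, ENNReal.rpow_two] at h
  calc _ ≤ ((∫⁻ y, r y * G y ^ 2) ^ (1 / 2 : ℝ)) ^ 2 := pow_le_pow_left' h 2
    _ = _ := by rw [sq, hsq]

/-- Mollification of a field. -/
def moll (ρ : ContDiffBump (0 : E3)) (g : E3 → E3) (x : E3) : E3 :=
  convolution (ρ.normed volume) g (ContinuousLinearMap.lsmul ℝ ℝ) volume x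

theorem moll_eq (ρ : ContDiffBump (0 : E3)) (g : E3 → E3) (x : E3) :
    moll ρ g x = ∫ y, ρ.normed volume y • g (x - y) := rfl

theorem integrable_moll (ρ : ContDiffBump (0 : E3)) {g : E3 → E3} (hg : LocallyIntegrable g)
    (x : E3) : Integrable (fun y => ρ.normed volume y • g (x - y)) :=
  ρ.hasCompactSupport_normed.convolutionExists_left (ContinuousLinearMap.lsmul ℝ ℝ)
    ρ.continuous_normed hg x

theorem eLpNorm_two_sq_eq {Ω F : Type*} [MeasurableSpace Ω] {μ : Measure Ω}
    [NormedAddCommGroup F] (f : Ω → F) : eLpNorm f 2 μ ^ 2 = ∫⁻ x, ‖f x‖ₑ ^ 2 ∂μ := by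
  rw [eLpNorm_eq_lintegral_rpow_enorm_toReal two_ne_zero (by simp), ← ENNReal.rpow_natCast,
    ← ENNReal.rpow_mul]
  simp

/-- The difference g - `moll ρ g` averages differences of translates against a probability density.
Jensen and Tonelli reduce to single translates, and only those in the support of ρ matter. -/
theorem eLpNorm_moll_sub_le (ρ : ContDiffBump (0 : E3)) {g : E3 → E3} (hg : MemLp g 2 volume)
    {ε : ℝ≥0∞}
    (h : ∀ y : E3, ‖y‖ < ρ.rOut → eLpNorm (fun x => g (x - y) - g x) 2 volume ≤ ε) :
    eLpNorm (fun x => g x - moll ρ g x) 2 volume ≤ ε := by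
  set r : E3 → ℝ≥0∞ := fun y => ‖ρ.normed volume y‖ₑ
  have hrm : Measurable r := ρ.continuous_normed.measurable.enorm
  have hr1 : ∫⁻ y, r y = 1 := by
    have : ∀ y, r y = ENNReal.ofReal (ρ.normed volume y) := fun y =>
      Real.enorm_of_nonneg (ρ.nonneg_normed y)
    simp_rw [this]
    rw [← ofReal_integral_eq_lintegral_ofReal ρ.integrable_normed
      (Eventually.of_forall ρ.nonneg_normed), ρ.integral_normed, ENNReal.ofReal_one]
  have hsub : AEStronglyMeasurable (fun p : E3 × E3 => g (p.1 - p.2) - g p.1)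
      ((volume : Measure E3).prod volume) :=
    (hg.1.comp_quasiMeasurePreserving (quasiMeasurePreserving_sub_of_right_invariant _ _)).sub
      hg.1.comp_fst
  have hpt : ∀ x, ‖g x - moll ρ g x‖ₑ ^ 2 ≤ ∫⁻ y, r y * ‖g (x - y) - g x‖ₑ ^ 2 := fun x => by
    have e : moll ρ g x - g x = ∫ y, ρ.normed volume y • (g (x - y) - g x) := by
      simp only [smul_sub]
      rw [integral_sub (integrable_moll ρ (hg.locallyIntegrable one_le_two) x)
        (ρ.integrable_normed.smul_const _), ρ.integral_normed_smul, moll_eq]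
    have e2 : ‖g x - moll ρ g x‖ₑ ≤ ∫⁻ y, r y * ‖g (x - y) - g x‖ₑ := by
      rw [← neg_sub, enorm_neg, e]
      refine (enorm_integral_le_lintegral_enorm _).trans_eq ?_
      simp only [enorm_smul, r]
    refine (pow_le_pow_left' e2 2).trans (sq_lintegral_mul_le hrm.aemeasurable ?_ hr1)
    exact ((hg.1.comp_quasiMeasurePreserving
      (quasiMeasurePreserving_sub_left_of_right_invariant volume x)).sub
      aestronglyMeasurable_const).enorm
  refine (ENNReal.pow_le_pow_left_iff two_ne_zero).1 ?_
  rw [eLpNorm_two_sq_eq]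
  calc ∫⁻ x, ‖g x - moll ρ g x‖ₑ ^ 2 ≤ ∫⁻ x, ∫⁻ y, r y * ‖g (x - y) - g x‖ₑ ^ 2 :=
        lintegral_mono hpt
    _ = ∫⁻ y, ∫⁻ x, r y * ‖g (x - y) - g x‖ₑ ^ 2 := by
        refine lintegral_lintegral_swap ?_
        exact (hrm.comp measurable_snd).aemeasurable.mul (hsub.enorm.pow_const 2)
    _ ≤ ∫⁻ y, r y * ε ^ 2 := by
        refine lintegral_mono fun y => ?_
        rcases lt_or_ge ‖y‖ ρ.rOut with hy | hy
        · rw [lintegral_const_mul' _ _ enorm_ne_top]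
          gcongr
          have := h y hy
          rw [← eLpNorm_two_sq_eq (fun x => g (x - y) - g x)]
          exact pow_le_pow_left' this 2
        · have : r y = 0 := by
            have hs : y ∉ Function.support (ρ.normed volume) := by
              rw [ρ.support_normed_eq]; simpa using hy
            simpa [r] using hs
          simp [this]
    _ = ε ^ 2 := by rw [lintegral_mul_const _ hrm, hr1, one_mul]

/-- A sequence of mollifiers with radii tending to zero. -/
def bumpSeq (n : ℕ) : ContDiffBump (0 : E3) :=
  ⟨1 / (2 * (n + 1)), 1 / (n + 1), by positivity, by
    apply one_div_lt_one_div_of_lt <;> linarith [(Nat.cast_nonneg n : (0 : ℝ) ≤ n)]⟩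

theorem convLp_moll {g : E3 → E3} (hg : MemLp g 2 volume) :
    ConvLp 2 (fun n => moll (bumpSeq n) g) g := by
  refine ENNReal.tendsto_nhds_zero.2 fun ε hε => ?_
  obtain ⟨δ, hδ, h⟩ := exists_translation_le hg hε
  have ht : Tendsto (fun n : ℕ => (1 : ℝ) / (n + 1)) atTop (𝓝 0) :=
    tendsto_one_div_add_atTop_nhds_zero_nat
  filter_upwards [ht.eventually (gt_mem_nhds hδ)] with n hn
  exact eLpNorm_moll_sub_le _ hg fun y hy => h y (hy.trans hn)

theorem memLp_moll (ρ : ContDiffBump (0 : E3)) {g : E3 → E3} (hg : MemLp g 2 volume)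
    (hc : Continuous (moll ρ g)) : MemLp (moll ρ g) 2 volume := by
  -- The crude modulus 2‖g‖₂ is valid for every translation, whatever the radius of ρ.
  have hle := eLpNorm_moll_sub_le ρ hg (ε := 2 * eLpNorm g 2 volume) fun y _ => by
    have e : eLpNorm (fun x => g (x - y)) 2 volume = eLpNorm g 2 volume :=
      eLpNorm_comp_measurePreserving hg.1 (measurePreserving_sub_right volume y)
    refine (eLpNorm_sub_le (hg.comp_measurePreserving (measurePreserving_sub_right volume y)).1
      hg.1 one_le_two).trans ?_
    change eLpNorm (fun x => g (x - y)) 2 volume + _ ≤ _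
    rw [e, two_mul]
  refine ⟨hc.aestronglyMeasurable, (eLpNorm_le_add_conv one_le_two hc.aestronglyMeasurable
    hg.1).trans_lt (ENNReal.add_lt_top.2 ⟨hg.2, hle.trans_lt
      (ENNReal.mul_lt_top (by simp) hg.2)⟩)⟩

theorem contDiff_moll (ρ : ContDiffBump (0 : E3)) {g : E3 → E3} (hg : LocallyIntegrable g) :
    ContDiff ℝ ∞ (moll ρ g) :=
  ρ.hasCompactSupport_normed.contDiff_convolution_left _ ρ.contDiff_normed hg

/-- The field `g` is the weak `k`-th derivative of `u`, tested with smooth functions. -/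
def WeakPd (k : Fin 3) (u g : E3 → E3) : Prop :=
  ∀ φ : E3 → ℝ, IsTest φ → ∫ x, pd k φ x • u x = -∫ x, φ x • g x

/-- The derivative first falls on the kernel. As a function of y, ρ(x - y) is a test function, and
the sign from the reflection matches the sign in the weak derivative. -/
theorem pd_moll (ρ : ContDiffBump (0 : E3)) {k : Fin 3} {u g : E3 → E3}
    (hu : LocallyIntegrable u) (h : WeakPd k u g) : pd k (moll ρ u) = moll ρ g := by
  ext1 x
  have h1 := ρ.hasCompactSupport_normed.hasFDerivAt_convolution_left
    (ContinuousLinearMap.lsmul ℝ ℝ (E := E3)) (ρ.contDiff_normed (μ := volume) (n := 1)) hu x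
  have hex : ConvolutionExistsAt (fderiv ℝ (ρ.normed volume)) u x
      ((ContinuousLinearMap.lsmul ℝ ℝ (E := E3)).precompL E3) volume :=
    (ρ.hasCompactSupport_normed.fderiv ℝ).convolutionExists_left _
      ((ρ.contDiff_normed (n := 1)).continuous_fderiv (by simp)) hu x
  have h2 : pd k (moll ρ u) x = ∫ y, pd k (ρ.normed volume) y • u (x - y) := by
    change fderiv ℝ (convolution _ _ _ _) x (e k) = _
    rw [h1.fderiv, convolution_def, ContinuousLinearMap.integral_apply hex]
    rfl
  set ψ : E3 → ℝ := fun y => ρ.normed volume (x - y)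
  have hψ : IsTest ψ := ⟨ρ.contDiff_normed.comp (contDiff_const.sub contDiff_id),
    ρ.hasCompactSupport_normed.comp_homeomorph (Homeomorph.subLeft x)⟩
  have hpd : ∀ y, pd k ψ y = -pd k (ρ.normed volume) (x - y) := fun y => by
    have hd : HasFDerivAt (fun y => x - y) (-ContinuousLinearMap.id ℝ E3) y := by
      simpa using (hasFDerivAt_id y).const_sub x
    have hρ : DifferentiableAt ℝ (ρ.normed volume) (x - y) :=
      (ρ.contDiff_normed (n := 1)).differentiable (by simp) _
    have := hρ.hasFDerivAt.comp y hd
    change fderiv ℝ (ρ.normed volume ∘ fun y => x - y) y (e k) = _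
    rw [this.fderiv]
    simp [pd]
  have h3 := h ψ hψ
  simp only [hpd, neg_smul, integral_neg, neg_inj] at h3
  rw [h2, moll_eq, ← integral_sub_left_eq_self (fun y => pd k (ρ.normed volume) y • u (x - y))
    volume x, ← integral_sub_left_eq_self (fun y => ρ.normed volume y • g (x - y)) volume x]
  simpa [ψ] using h3

/-! ### Cutoff -/

section Scaling

variable {F : Type*} [NormedAddCommGroup F] [NormedSpace ℝ F]

theorem pd_comp_smul {f : E3 → F} (c : ℝ) (k : Fin 3) :
    pd k (fun x => f (c • x)) = fun x => c • pd k f (c • x) := by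
  ext1 x
  simp [pd, fderiv_comp_smul]

theorem lap_comp_smul {f : E3 → F} (hf : ContDiff ℝ ∞ f) (c : ℝ) :
    lap (fun x => f (c • x)) = fun x => c ^ 2 • lap f (c • x) := by
  ext1 x
  simp only [lap, Finset.smul_sum]
  refine Finset.sum_congr rfl fun k _ => ?_
  rw [pd_comp_smul]
  have h1 : ContDiff ℝ ∞ (fun x => pd k f (c • x)) :=
    (contDiff_pd hf k).comp (contDiff_const_smul c)
  have := congrFun (pd_clm h1 (c • ContinuousLinearMap.id ℝ F) k) x
  simp only [_root_.smul_apply, ContinuousLinearMap.id_apply, pd_comp_smul] at this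
  rw [this, smul_smul, sq]

end Scaling

/-- A smooth bump function equal to one on the unit ball. -/
def unitBump : ContDiffBump (0 : E3) := ⟨1, 2, one_pos, one_lt_two⟩

/-- Smooth cutoff functions at radius `n + 1`. -/
def cutoff (n : ℕ) (x : E3) : ℝ := unitBump (((n : ℝ) + 1)⁻¹ • x)

theorem isTest_unitBump : IsTest unitBump := ⟨unitBump.contDiff, unitBump.hasCompactSupport⟩

theorem isTest_cutoff (n : ℕ) : IsTest (cutoff n) :=
  ⟨isTest_unitBump.1.comp (contDiff_const_smul _),
    isTest_unitBump.2.comp_smul (by positivity)⟩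

theorem cutoff_le_one (n : ℕ) (x : E3) : |1 - cutoff n x| ≤ 1 := by
  simp only [cutoff]
  rw [abs_of_nonneg (sub_nonneg.2 unitBump.le_one)]
  exact sub_le_self _ unitBump.nonneg

theorem eventually_cutoff_eq_one (x : E3) : ∀ᶠ n : ℕ in atTop, cutoff n x = 1 := by
  obtain ⟨N, hN⟩ := exists_nat_ge ‖x‖
  filter_upwards [eventually_ge_atTop N] with n hn
  refine unitBump.one_of_mem_closedBall ?_
  rw [mem_closedBall_zero_iff, norm_smul, norm_inv, Real.norm_of_nonneg (by positivity)]
  change _ ≤ (1 : ℝ)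
  rw [inv_mul_le_one₀ (by positivity)]
  have : (N : ℝ) ≤ n := by exact_mod_cast hn
  linarith

theorem tendsto_eLpNorm_cutoff {g : E3 → E3} (hg : MemLp g 2 volume) :
    Tendsto (fun n => eLpNorm (fun x => (1 - cutoff n x) • g x) 2 volume) atTop (𝓝 0) := by
  have h : Tendsto (fun n => ∫⁻ x, ‖(1 - cutoff n x) • g x‖ₑ ^ 2) atTop
      (𝓝 (∫⁻ _ : E3, 0)) := by
    refine tendsto_lintegral_of_dominated_convergence' (fun x => ‖g x‖ₑ ^ 2) (fun n => ?_)
      (fun n => Eventually.of_forall fun x => ?_) ?_ (Eventually.of_forall fun x => ?_)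
    · exact (((continuous_const.sub (isTest_cutoff n).continuous).aestronglyMeasurable.smul
        hg.1).enorm.pow_const 2)
    · simp only [enorm_smul]
      gcongr
      refine mul_le_of_le_one_left' ?_
      rw [← ofReal_norm, Real.norm_eq_abs]
      exact ENNReal.ofReal_le_one.2 (cutoff_le_one n x)
    · rw [← eLpNorm_two_sq_eq]
      exact ENNReal.pow_ne_top hg.2.ne
    · refine tendsto_const_nhds.congr' ?_
      filter_upwards [eventually_cutoff_eq_one x] with n hn
      simp [hn]
  simp only [← eLpNorm_two_sq_eq, lintegral_zero] at h
  have h2 := h.ennrpow_const (1 / 2)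
  refine (h2.congr fun n => ?_).trans (by simp)
  rw [← ENNReal.rpow_two, ← ENNReal.rpow_mul]
  norm_num

theorem eLpNorm_smul_le_of_bound {φ : E3 → ℝ} {M : ℝ≥0} (hφ : ∀ x, ‖φ x‖₊ ≤ M) (g : E3 → E3) :
    eLpNorm (fun x => φ x • g x) 2 volume ≤ M * eLpNorm g 2 volume :=
  eLpNorm_le_nnreal_smul_eLpNorm_of_ae_le_mul (Eventually.of_forall fun x => by
    rw [nnnorm_smul]; gcongr; exact hφ x) 2

theorem IsTest.exists_nnnorm_le {φ : E3 → ℝ} (hφ : IsTest φ) : ∃ M : ℝ≥0, ∀ x, ‖φ x‖₊ ≤ M := by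
  obtain ⟨C, hC⟩ := hφ.continuous.bounded_above_of_compact_support hφ.2
  exact ⟨C.toNNReal, fun x => by
    rw [← NNReal.coe_le_coe, coe_nnnorm]
    exact (hC x).trans (Real.le_coe_toNNReal C)⟩

theorem tendsto_nnreal_inv : Tendsto (fun n : ℕ => (((n : ℝ≥0) + 1)⁻¹ : ℝ≥0)) atTop (𝓝 0) := by
  rw [← NNReal.tendsto_coe]
  exact tendsto_one_div_add_atTop_nhds_zero_nat.congr fun n => by simp

theorem tendsto_eLpNorm_scaled {φ : E3 → ℝ} (hφ : IsTest φ) {g : E3 → E3} (hg : MemLp g 2 volume) :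
    Tendsto (fun n : ℕ => eLpNorm (fun x => (((n : ℝ) + 1)⁻¹ * φ (((n : ℝ) + 1)⁻¹ • x)) • g x) 2
      volume) atTop (𝓝 0) := by
  obtain ⟨M, hM⟩ := hφ.exists_nnnorm_le
  have h : Tendsto (fun n : ℕ => ((((n : ℝ≥0) + 1)⁻¹ * M : ℝ≥0) : ℝ≥0∞) * eLpNorm g 2 volume)
      atTop (𝓝 0) := by
    have h1 : Tendsto (fun n : ℕ => ((((n : ℝ≥0) + 1)⁻¹ * M : ℝ≥0) : ℝ≥0∞)) atTop (𝓝 0) := by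
      have := tendsto_nnreal_inv.mul_const M
      rw [zero_mul] at this
      exact ENNReal.tendsto_coe.2 this
    simpa using ENNReal.Tendsto.mul_const h1 (Or.inr hg.2.ne)
  refine tendsto_zero_of_le h fun n => eLpNorm_smul_le_of_bound (fun x => ?_) g
  rw [nnnorm_mul, nnnorm_inv]
  gcongr
  · refine le_of_eq (NNReal.eq ?_)
    rw [coe_nnnorm, Real.norm_of_nonneg (by positivity)]
    simp
  · exact hM _

/-- A smooth field whose jet is square integrable is in `H²`. -/
theorem H2.of_smooth {v : E3 → E3} (hv : ContDiff ℝ ∞ v) (h0 : MemLp v 2 volume)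
    (h1 : ∀ k, MemLp (LLG.pd k v) 2 volume) (h2 : MemLp (LLG.lap v) 2 volume) :
    H2 v (fun k => LLG.pd k v) (LLG.lap v) := by
  have hB : ∀ n, ContDiff ℝ ∞ (cutoff n) := fun n => (isTest_cutoff n).1
  have hpc : ∀ k n, LLG.pd k (cutoff n) = fun x =>
      ((n : ℝ) + 1)⁻¹ * LLG.pd k unitBump (((n : ℝ) + 1)⁻¹ • x) := fun k n =>
    pd_comp_smul (f := unitBump) _ k
  have hlc : ∀ n, LLG.lap (cutoff n) = fun x =>
      (((n : ℝ) + 1)⁻¹) ^ 2 * LLG.lap unitBump (((n : ℝ) + 1)⁻¹ • x) := fun n =>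
    lap_comp_smul isTest_unitBump.1 _
  have m : ∀ {φ : E3 → ℝ} {g : E3 → E3}, Continuous φ → Continuous g →
      AEStronglyMeasurable (fun x => φ x • g x) := fun hφ hg => (hφ.smul hg).aestronglyMeasurable
  have cpd : ∀ k, Continuous (LLG.pd k v) := fun k => (contDiff_pd hv k).continuous
  have clap : Continuous (LLG.lap v) := (contDiff_lap hv).continuous
  have c1 : ∀ n, Continuous fun x => 1 - cutoff n x := fun n =>
    continuous_const.sub (isTest_cutoff n).continuous
  refine ⟨h0, h1, h2, fun n x => cutoff n x • v x, fun n =>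
    IsTest.bilin_left (ContinuousLinearMap.lsmul ℝ ℝ) (isTest_cutoff n) hv, ?_, fun k => ?_, ?_⟩
  · refine (tendsto_eLpNorm_cutoff h0).congr fun n => ?_
    simp only [sub_smul, one_smul]
  -- The error is a tail of ∂ₖv plus v times the derivative of the cutoff, which is of size 1/(n +
  -- 1).
  · have hs := tendsto_add_zero (tendsto_eLpNorm_cutoff (h1 k))
      (tendsto_eLpNorm_scaled (isTest_unitBump.pd k) h0)
    refine tendsto_zero_of_le hs fun n => ?_
    have e := pd_bilin (ContinuousLinearMap.lsmul ℝ ℝ (E := E3)) (hB n) hv k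
    simp only [ContinuousLinearMap.lsmul_apply] at e
    beta_reduce
    rw [e]
    refine le_trans (le_of_eq ?_) (eLpNorm_sub_le (m (c1 n) (cpd k))
      (m (((isTest_cutoff n).pd k).continuous) hv.continuous) one_le_two) |>.trans ?_
    · congr 1; ext1 x
      simp only [Pi.sub_apply, sub_smul, one_smul]
      abel
    · rw [hpc k n]
  · have hs := tendsto_add_zero (tendsto_add_zero (tendsto_eLpNorm_cutoff h2)
      (tendsto_const_mul_zero (c := 2) (by simp) (tendsto_add_zero (tendsto_add_zero
        (tendsto_eLpNorm_scaled (isTest_unitBump.pd 0) (h1 0))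
        (tendsto_eLpNorm_scaled (isTest_unitBump.pd 1) (h1 1)))
        (tendsto_eLpNorm_scaled (isTest_unitBump.pd 2) (h1 2)))))
      (tendsto_eLpNorm_scaled isTest_unitBump.lap h0)
    refine tendsto_zero_of_le hs fun n => ?_
    have e := lap_bilin (ContinuousLinearMap.lsmul ℝ ℝ (E := E3)) (hB n) hv
    simp only [ContinuousLinearMap.lsmul_apply, Fin.sum_univ_three] at e
    beta_reduce
    rw [e]
    have q : ∀ k, AEStronglyMeasurable (fun x => LLG.pd k (cutoff n) x • LLG.pd k v x) := fun k =>
      m ((isTest_cutoff n).pd k).continuous (cpd k)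
    have e2 : (fun x => LLG.lap v x - (LLG.lap (cutoff n) x • v x +
        (2 : ℝ) • (LLG.pd 0 (cutoff n) x • LLG.pd 0 v x + LLG.pd 1 (cutoff n) x • LLG.pd 1 v x +
          LLG.pd 2 (cutoff n) x • LLG.pd 2 v x) + cutoff n x • LLG.lap v x)) =
        (fun x => (1 - cutoff n x) • LLG.lap v x) - (2 : ℝ) • (((fun x => LLG.pd 0 (cutoff n) x •
          LLG.pd 0 v x) + fun x => LLG.pd 1 (cutoff n) x • LLG.pd 1 v x) +
          fun x => LLG.pd 2 (cutoff n) x • LLG.pd 2 v x) - fun x => LLG.lap (cutoff n) x • v x := by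
      ext1 x
      simp only [Pi.sub_apply, Pi.add_apply, Pi.smul_apply, sub_smul, one_smul]
      abel
    rw [e2]
    have mS := ((q 0).add (q 1)).add (q 2)
    refine (eLpNorm_sub_le ((m (c1 n) clap).sub (mS.const_smul (2 : ℝ)))
      (m (isTest_cutoff n).lap.continuous hv.continuous) one_le_two).trans (add_le_add
      ((eLpNorm_sub_le (m (c1 n) clap) (mS.const_smul (2 : ℝ)) one_le_two).trans
        (add_le_add le_rfl ?_)) ?_)
    · rw [eLpNorm_const_smul]
      refine mul_le_mul' (by simp [Real.enorm_eq_ofReal]) ?_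
      refine (eLpNorm_add_le ((q 0).add (q 1)) (q 2) one_le_two).trans (add_le_add
        ((eLpNorm_add_le (q 0) (q 1) one_le_two).trans (add_le_add ?_ ?_)) ?_) <;> rw [hpc]
    · rw [hlc]
      -- The Laplacian of the cutoff carries the factor (n + 1)⁻²; one power is discarded to reuse
      -- `tendsto_eLpNorm_scaled`.
      refine eLpNorm_mono fun x => ?_
      rw [norm_smul, norm_smul]
      gcongr
      rw [norm_mul, norm_mul, norm_pow]
      gcongr
      have : ‖((n : ℝ) + 1)⁻¹‖ ≤ 1 := by
        rw [norm_inv, Real.norm_of_nonneg (by positivity)]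
        exact inv_le_one_of_one_le₀ (by linarith [(Nat.cast_nonneg n : (0 : ℝ) ≤ n)])
      exact pow_le_of_le_one (norm_nonneg _) this two_ne_zero

/-- `H²` is closed under convergence of jets. -/
theorem H2.of_limit {u : E3 → E3} {D : Fin 3 → E3 → E3} {L : E3 → E3} (h0 : MemLp u 2 volume)
    (h1 : ∀ k, MemLp (D k) 2 volume) (h2 : MemLp L 2 volume) {v : ℕ → E3 → E3}
    {E : ℕ → Fin 3 → E3 → E3} {M : ℕ → E3 → E3} (hv : ∀ n, H2 (v n) (E n) (M n))
    (c0 : ConvLp 2 v u) (c1 : ∀ k, ConvLp 2 (fun n => E n k) (D k)) (c2 : ConvLp 2 M L) :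
    H2 u D L := by
  have hε : ∀ n : ℕ, (0 : ℝ≥0∞) < ((((n : ℝ≥0) + 1)⁻¹ : ℝ≥0) : ℝ≥0∞) := fun n => by
    simp
  -- Diagonal choice: one test function within 1/(n + 1) of the n-th jet in all its components.
  have hap : ∀ n, ∃ f, IsTest f ∧
      eLpNorm (fun x => v n x - f x) 2 volume ≤ ((((n : ℝ≥0) + 1)⁻¹ : ℝ≥0) : ℝ≥0∞) ∧
      (∀ k, eLpNorm (fun x => E n k x - LLG.pd k f x) 2 volume ≤
        ((((n : ℝ≥0) + 1)⁻¹ : ℝ≥0) : ℝ≥0∞)) ∧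
      eLpNorm (fun x => M n x - LLG.lap f x) 2 volume ≤ ((((n : ℝ≥0) + 1)⁻¹ : ℝ≥0) : ℝ≥0∞) := by
    intro n
    obtain ⟨f, hf⟩ := (hv n).approx
    have ev := ((hf.val.eventually (ge_mem_nhds (hε n))).and
      ((eventually_all.2 fun k => (hf.pd k).eventually (ge_mem_nhds (hε n))).and
        (hf.lap.eventually (ge_mem_nhds (hε n))))).exists
    obtain ⟨i, a, b, c⟩ := ev
    exact ⟨f i, hf.test i, a, b, c⟩
  choose f hf a b c using hap
  have hz : Tendsto (fun n : ℕ => ((((n : ℝ≥0) + 1)⁻¹ : ℝ≥0) : ℝ≥0∞)) atTop (𝓝 0) := by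
    exact ENNReal.tendsto_coe.2 tendsto_nnreal_inv
  have key : ∀ {p q r : ℕ → E3 → E3} {w : E3 → E3}, (∀ n, MemLp (q n) 2 volume) →
      (∀ n, MemLp (r n) 2 volume) → MemLp w 2 volume → ConvLp 2 q w →
      (∀ n, eLpNorm (fun x => q n x - r n x) 2 volume ≤ ((((n : ℝ≥0) + 1)⁻¹ : ℝ≥0) : ℝ≥0∞)) →
      ConvLp 2 r w := fun {p q r w} hq hr hw hc hb => by
    refine tendsto_zero_of_le (tendsto_add_zero hc hz) fun n => ?_
    have : (fun x => w x - r n x) = (fun x => w x - q n x) + fun x => q n x - r n x := by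
      ext1 x; simp
    rw [this]
    exact (eLpNorm_add_le (hw.1.sub (hq n).1) ((hq n).1.sub (hr n).1) one_le_two).trans
      (add_le_add le_rfl (hb n))
  exact ⟨h0, h1, h2, f, hf,
    key (p := f) (fun n => (hv n).val) (fun n => (hf n).memLp 2) h0 c0 a,
    fun k => key (p := f) (fun n => (hv n).pd k) (fun n => ((hf n).pd k).memLp 2) (h1 k) (c1 k)
      fun n => b n k,
    key (p := f) (fun n => (hv n).lap) (fun n => (hf n).lap.memLp 2) h2 c2 c⟩

/-- Fields with square integrable weak derivatives belong to `H²` (Meyers–Serrin). -/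
theorem H2.of_weak {u : E3 → E3} {D D2 : Fin 3 → E3 → E3} (h0 : MemLp u 2 volume)
    (h1 : ∀ k, MemLp (D k) 2 volume) (h2 : ∀ k, MemLp (D2 k) 2 volume)
    (w1 : ∀ k, WeakPd k u (D k)) (w2 : ∀ k, WeakPd k (D k) (D2 k)) :
    H2 u D (fun x => ∑ k, D2 k x) := by
  have hL : MemLp (fun x => ∑ k, D2 k x) 2 volume := memLp_finsetSum _ fun k _ => h2 k
  have l0 := h0.locallyIntegrable one_le_two
  have l1 := fun k => (h1 k).locallyIntegrable one_le_two
  have l2 := fun k => (h2 k).locallyIntegrable one_le_two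
  have hlap : ∀ ρ : ContDiffBump (0 : E3), LLG.lap (moll ρ u) = moll ρ (fun x => ∑ k, D2 k x) := by
    intro ρ
    ext1 x
    simp only [LLG.lap]
    simp only [pd_moll ρ l0 (w1 _), pd_moll ρ (l1 _) (w2 _), moll_eq, Finset.smul_sum]
    exact (integral_finsetSum _ fun k _ => integrable_moll ρ (l2 k) x).symm
  have hpd : ∀ ρ k, LLG.pd k (moll ρ u) = moll ρ (D k) := fun ρ k => pd_moll ρ l0 (w1 k)
  have hs : ∀ n, H2 (moll (bumpSeq n) u) (fun k => LLG.pd k (moll (bumpSeq n) u))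
      (LLG.lap (moll (bumpSeq n) u)) := fun n => by
    refine H2.of_smooth (contDiff_moll _ l0) (memLp_moll _ h0 (contDiff_moll _ l0).continuous)
      (fun k => ?_) ?_
    · rw [hpd]
      exact memLp_moll _ (h1 k) (contDiff_moll _ (l1 k)).continuous
    · rw [hlap]
      exact memLp_moll _ hL (contDiff_moll _ (hL.locallyIntegrable one_le_two)).continuous
  refine H2.of_limit h0 h1 hL hs (convLp_moll h0) (fun k => ?_) ?_
  · exact (convLp_moll (h1 k)).congr fun n => by simp only [hpd]
  · exact (convLp_moll hL).congr fun n => by simp only [hlap]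

theorem IsWeakPartial.weakPd {k : Fin 3} {u g : E3 → E3} (h : IsWeakPartial k u g) :
    WeakPd k u g := fun φ hφ =>
  h.2.2 ⟨φ, by simpa using hφ.1, hφ.2, by simp⟩

/-! ### Hölder exponents of the pairings -/

instance holderTriple_four_two : ENNReal.HolderTriple 4 2 (4 / 3) :=
  ENNReal.HolderTriple.of_toReal ⟨by norm_num [ENNReal.toReal_div], by norm_num, by norm_num⟩

instance holderTriple_four_thirds_four : ENNReal.HolderTriple (4 / 3) 4 1 :=
  ENNReal.HolderTriple.of_toReal
    ⟨by norm_num [ENNReal.toReal_div], by norm_num [ENNReal.toReal_div], by norm_num⟩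

instance holderTriple_six_fifths_six : ENNReal.HolderTriple (6 / 5) 6 1 :=
  ENNReal.HolderTriple.of_toReal
    ⟨by norm_num [ENNReal.toReal_div], by norm_num [ENNReal.toReal_div], by norm_num⟩

/-! ### The weak formulation as a functional on `H²` -/

section Pairing

variable {Ω : Type*} [MeasurableSpace Ω] {μ : Measure Ω}

theorem integrable_inner_of_memLp {p q : ℝ≥0∞} [ENNReal.HolderTriple p q 1] {u v : Ω → E3}
    (hu : MemLp u p μ) (hv : MemLp v q μ) : Integrable (fun x => ⟪u x, v x⟫_ℝ) μ :=
  memLp_one_iff_integrable.1 (MemLp.bilin (innerSL ℝ) (r := 1) hu hv)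

variable {m a l c ψ ψl : Ω → E3} {d ψd : Fin 3 → Ω → E3}

theorem memLp_top_of_sphere (hm : ∀ᵐ x ∂μ, ‖m x‖ = 1) (hm2 : MemLp (fun x => m x - e₃) 2 μ) :
    MemLp m ⊤ μ := by
  refine memLp_top_of_bound ?_ 1 (hm.mono fun x hx => hx.le)
  exact (hm2.1.add (aestronglyMeasurable_const (b := e₃))).congr (Eventually.of_forall fun x => by simp)

/-- The constant field h e₃ is not square integrable on ℝ³, but m × e₃ = (m - e₃) × e₃ is. -/
theorem cross_sub_const (m : E3) (h : ℝ) (v : E3) :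
    cross m (v - h • e₃) = cross m v - h • cross (m - e₃) e₃ := by
  apply E3.ext_three <;> simp <;> ring

theorem memLp_weakForm_leading (α h : ℝ) (hm : ∀ᵐ x ∂μ, ‖m x‖ = 1)
    (hm2 : MemLp (fun x => m x - e₃) 2 μ) (ha : MemLp a 2 μ) (hl : MemLp l 2 μ) :
    MemLp (fun x => a x - cross (m x) (α • a x + l x - h • e₃)) 2 μ := by
  have h1 := MemLp.bilin crossL (r := 2) (memLp_top_of_sphere hm hm2) ((ha.const_smul α).add hl)
  have h2 := ((crossL.flip e₃).comp_memLp' hm2).const_smul h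
  refine (ha.sub (h1.sub h2)).ae_eq (Eventually.of_forall fun x => ?_)
  simp only [cross_sub_const]
  rfl

theorem weakForm_eq_pairings (α h : ℝ) (m a : E3) (d : Fin 3 → E3) (l c ψ : E3) (ψd : Fin 3 → E3)
    (ψl : E3) : weakForm α h m a d l c ψ ψd ψl =
      ⟪a - cross m (α • a + l - h • e₃), ψ⟫_ℝ + ⟪c, ψ⟫_ℝ - ⟪cross m l, ψl⟫_ℝ -
        2 * ∑ k, ⟪cross (d k) l, ψd k⟫_ℝ := by
  rw [weakForm, inner_add_left]

/-- Integrability of the coefficients of the weak formulation as a functional of the test jet. -/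
structure PairingBounds (α h : ℝ) (m a : Ω → E3) (d : Fin 3 → Ω → E3) (l c : Ω → E3)
    (μ : Measure Ω) : Prop where
  leading : MemLp (fun x => a x - cross (m x) (α • a x + l x - h • e₃)) 2 μ
  top : MemLp (fun x => cross (m x) (l x)) 2 μ
  mid : ∀ k, MemLp (fun x => cross (d k x) (l x)) (4 / 3) μ
  cur : MemLp c 1 μ

theorem pairingBounds (α h : ℝ) (hm : ∀ᵐ x ∂μ, ‖m x‖ = 1)
    (hm2 : MemLp (fun x => m x - e₃) 2 μ) (ha : MemLp a 2 μ) (hl : MemLp l 2 μ)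
    (hd : ∀ k, MemLp (d k) 4 μ) (hc : MemLp c 1 μ) : PairingBounds α h m a d l c μ where
  leading := memLp_weakForm_leading α h hm hm2 ha hl
  top := MemLp.bilin crossL (r := 2) (memLp_top_of_sphere hm hm2) hl
  mid k := MemLp.bilin crossL (r := 4 / 3) (hd k) hl
  cur := hc

/-- The dual exponents are 2–2, 1–∞, 2–2 and 4/3–4; the requirements on the test jet are exactly
those met by a jet in `H2`. -/
theorem PairingBounds.integrable {α h : ℝ} (H : PairingBounds α h m a d l c μ)
    (h2 : MemLp ψ 2 μ) (ht : MemLp ψ ⊤ μ) (hd : ∀ k, MemLp (ψd k) 4 μ) (hl : MemLp ψl 2 μ) :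
    Integrable (fun x => weakForm α h (m x) (a x) (fun k => d k x) (l x) (c x) (ψ x)
      (fun k => ψd k x) (ψl x)) μ := by
  simp only [weakForm_eq_pairings]
  exact (((integrable_inner_of_memLp H.leading h2).add (integrable_inner_of_memLp H.cur ht)).sub
    (integrable_inner_of_memLp H.top hl)).sub ((integrable_finsetSum _ fun k _ =>
      integrable_inner_of_memLp (H.mid k) (hd k)).const_mul 2)

theorem PairingBounds.integral {α h : ℝ} (H : PairingBounds α h m a d l c μ)
    (h2 : MemLp ψ 2 μ) (ht : MemLp ψ ⊤ μ) (hd : ∀ k, MemLp (ψd k) 4 μ) (hl : MemLp ψl 2 μ) :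
    ∫ x, weakForm α h (m x) (a x) (fun k => d k x) (l x) (c x) (ψ x) (fun k => ψd k x) (ψl x) ∂μ =
      ∫ x, ⟪a x - cross (m x) (α • a x + l x - h • e₃), ψ x⟫_ℝ ∂μ + ∫ x, ⟪c x, ψ x⟫_ℝ ∂μ -
        ∫ x, ⟪cross (m x) (l x), ψl x⟫_ℝ ∂μ -
        2 * ∑ k, ∫ x, ⟪cross (d k x) (l x), ψd k x⟫_ℝ ∂μ := by
  simp only [weakForm_eq_pairings]
  have i1 := integrable_inner_of_memLp H.leading h2
  have i2 := integrable_inner_of_memLp H.cur ht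
  have i3 := integrable_inner_of_memLp H.top hl
  have i4 := fun k => integrable_inner_of_memLp (H.mid k) (hd k)
  rw [integral_sub, integral_sub, integral_add i1 i2, integral_const_mul,
    integral_finsetSum _ fun k _ => i4 k]
  exacts [i1.add i2, i3, (i1.add i2).sub i3, (integrable_finsetSum _ fun k _ => i4 k).const_mul 2]

end Pairing

theorem ConvLp.tendsto_integral_inner {p q : ℝ≥0∞} [ENNReal.HolderTriple p q 1]
    {f : ℕ → E3 → E3} {u g : E3 → E3} (h : ConvLp q f u) (hg : MemLp g p volume)
    (hf : ∀ n, MemLp (f n) q volume) (hu : MemLp u q volume) :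
    Tendsto (fun n => ∫ x, ⟪g x, f n x⟫_ℝ) atTop (𝓝 (∫ x, ⟪g x, u x⟫_ℝ)) := by
  rw [tendsto_iff_edist_tendsto_0]
  refine tendsto_zero_of_le (tendsto_const_mul_zero
    (c := ‖(innerSL ℝ : E3 →L[ℝ] E3 →L[ℝ] ℝ)‖₊ * eLpNorm g p volume)
    (ENNReal.mul_ne_top (by simp) hg.2.ne) h) fun n => ?_
  rw [edist_comm, edist_eq_enorm_sub, ← integral_sub (integrable_inner_of_memLp hg hu)
    (integrable_inner_of_memLp hg (hf n))]
  simp only [← inner_sub_right]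
  refine (enorm_integral_le_lintegral_enorm _).trans ?_
  rw [← eLpNorm_one_eq_lintegral_enorm]
  exact eLpNorm_bilin_le (innerSL ℝ) (r := 1) hg.1 (hu.1.sub (hf n).1)

variable {m a l c ψ ψl : E3 → E3} {d ψd : Fin 3 → E3 → E3}

/-- If the weak formulation vanishes along test functions that approximate a jet of class `H²`,
it vanishes at that jet. -/
theorem PairingBounds.integral_eq_zero {α h : ℝ} (H : PairingBounds α h m a d l c volume)
    (hψ : H2 ψ ψd ψl) {f : ℕ → E3 → E3} (hf : JetConv f ψ ψd ψl)
    (h0 : ∀ n, ∫ x, weakForm α h (m x) (a x) (fun k => d k x) (l x) (c x) (f n x)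
      (fun k => LLG.pd k (f n) x) (LLG.lap (f n) x) = 0) :
    ∫ x, weakForm α h (m x) (a x) (fun k => d k x) (l x) (c x) (ψ x) (fun k => ψd k x) (ψl x) =
      0 := by
  rw [H.integral hψ.val hψ.memLp_top hψ.memLp_four hψ.lap]
  have T := fun n => hf.test n
  have t1 := hf.val.tendsto_integral_inner H.leading (fun n => (T n).memLp 2) hψ.val
  have t2 := (hf.conv_top hψ).tendsto_integral_inner H.cur (fun n => (T n).memLp ⊤) hψ.memLp_top
  have t3 := hf.lap.tendsto_integral_inner H.top (fun n => (T n).lap.memLp 2) hψ.lap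
  have t4 := fun k => (hf.conv_four hψ k).tendsto_integral_inner (H.mid k)
    (fun n => ((T n).pd k).memLp 4) (hψ.memLp_four k)
  refine tendsto_nhds_unique (((t1.add t2).sub t3).sub
    ((tendsto_finsetSum Finset.univ fun k _ => t4 k).const_mul 2)) ?_
  refine tendsto_const_nhds.congr fun n => ?_
  rw [← h0 n, H.integral ((T n).memLp 2) ((T n).memLp ⊤) (fun k => ((T n).pd k).memLp 4)
    ((T n).lap.memLp 2)]

/-! ### Sphere valued fields -/

theorem dot_expand (x : E3) : ⟪x, x⟫_ℝ = ⟪x - e₃, x - e₃⟫_ℝ + 2 * ⟪e₃, x - e₃⟫_ℝ + 1 := by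
  have h := inner_e₃_self
  simp only [inner_sub_left, inner_sub_right, h, real_inner_comm]
  ring

/-- The jet of a sphere valued field of class `H²` satisfies the pointwise constraints. -/
theorem H2.sphereJet (hm : ∀ᵐ x, ‖m x‖ = 1) (hu : H2 (fun x => m x - e₃) d l) :
    ∀ᵐ x, SphereJet (m x) (fun k => d k x) (l x) := by
  -- This is the jet of (|m|² - 1) e₃, written through m - e₃; it vanishes, so `H2.unique` yields
  -- the constraints. The vector e₃ is a carrier that turns a scalar into a field to which `H2`
  -- applies.
  have h1 := (hu.bilin dotL hu).add ((hu.clm (dotL e₃)).smul 2)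
  have h0 : H2 (fun _ => (0 : E3)) (fun _ _ => 0) (fun _ => 0) := by
    have := hu.sub hu
    simpa using this
  have e0 : (fun x => dotL (m x - e₃) (m x - e₃) + (2 : ℝ) • dotL e₃ (m x - e₃)) =ᵐ[volume]
      fun _ => (0 : E3) := by
    filter_upwards [hm] with x hx
    have hxx : ⟪m x, m x⟫_ℝ = 1 := by rw [real_inner_self_eq_norm_sq, hx]; norm_num
    rw [dot_expand] at hxx
    simp only [dotL_apply, smul_smul, ← add_smul]
    rw [show ⟪m x - e₃, m x - e₃⟫_ℝ + 2 * ⟪e₃, m x - e₃⟫_ℝ = 0 by linarith, zero_smul]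
  obtain ⟨hd, hl⟩ := h1.unique h0 e0
  have hne : e₃ ≠ 0 := fun h => by simpa [h] using norm_e₃
  filter_upwards [hm, ae_all_iff.2 hd, hl] with x hx hdx hlx
  have hxx : ⟪m x, m x⟫_ℝ = 1 := by rw [real_inner_self_eq_norm_sq, hx]; norm_num
  refine ⟨hxx, fun k => ?_, ?_⟩
  · have := hdx k
    simp only [dotL_apply, smul_smul, ← add_smul] at this
    have := (smul_eq_zero.1 this).resolve_right hne
    rw [inner_sub_left, inner_sub_right] at this
    linarith [real_inner_comm (d k x) e₃, real_inner_comm (d k x) (m x)]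
  · simp only [leib, dotL_apply, smul_smul, ← add_smul, ← Finset.sum_smul] at hlx
    have := (smul_eq_zero.1 hlx).resolve_right hne
    rw [inner_sub_left, inner_sub_right, real_inner_comm (m x) (l x), real_inner_comm e₃ (l x)]
      at this
    linarith

/-! ### The test fields -/

section Jets

variable {m m' l l' : E3 → E3} {d d' : Fin 3 → E3 → E3}

theorem H2.diff (hu : H2 (fun x => m x - e₃) d l) (hu' : H2 (fun x => m' x - e₃) d' l') :
    H2 (fun x => m x - m' x) (fun k x => d k x - d' k x) (fun x => l x - l' x) := by
  simpa using hu.sub hu'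

/-- Expand both factors around e₃. Since e₃ × e₃ = 0, every remaining term contains a field of class
`H2`. -/
theorem H2.cross_sphere (hu : H2 (fun x => m x - e₃) d l) (hu' : H2 (fun x => m' x - e₃) d' l') :
    H2 (fun x => cross (m x) (m' x)) (fun k x => cross (d k x) (m' x) + cross (m x) (d' k x))
      (fun x => leib crossL (m x) (fun k => d k x) (l x) (m' x) (fun k => d' k x) (l' x)) := by
  refine (((hu.bilin crossL hu').add (hu'.clm (crossL e₃))).add
    (hu.clm (crossL.flip e₃))).congr ?_ (fun k => ?_) ?_
  all_goals
    refine Eventually.of_forall fun x => ?_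
    simp only [leib, crossL_apply, ContinuousLinearMap.flip_apply]
    apply E3.ext_three <;> simp <;> ring

theorem H2.test_field (α : ℝ) (hu : H2 (fun x => m x - e₃) d l)
    (hu' : H2 (fun x => m' x - e₃) d' l') :
    H2 (fun x => m x - m' x + α • cross (m x) (m' x))
      (fun k x => d k x - d' k x + α • (cross (d k x) (m' x) + cross (m x) (d' k x)))
      (fun x => l x - l' x +
        α • leib crossL (m x) (fun k => d k x) (l x) (m' x) (fun k => d' k x) (l' x)) :=
  (hu.diff hu').add ((hu.cross_sphere hu').smul α)

theorem H2.half_sq (hu : H2 (fun x => m x - e₃) d l) (hu' : H2 (fun x => m' x - e₃) d' l') :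
    H2 (fun x => hq (m x) (m' x) • e₃)
      (fun k x => hqd (m x) (fun k => d k x) (m' x) (fun k => d' k x) k • e₃)
      (fun x => hql (m x) (fun k => d k x) (l x) (m' x) (fun k => d' k x) (l' x) • e₃) := by
  refine (((hu.diff hu').bilin dotL (hu.diff hu')).smul (1 / 2)).congr ?_ (fun k => ?_) ?_
  all_goals
    refine Eventually.of_forall fun x => ?_
    simp only [leib, dotL_apply, hq, hqd, hql, smul_smul, ← add_smul, ← Finset.sum_smul]
    congr 1
  · ring
  · rw [real_inner_comm]; ring
  · rw [real_inner_comm]; ring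

/-- The field n is not in L², so q n is split as q (n - e₃) + q e₃; `scalL` reads the scalar q off
its carrier e₃. -/
theorem H2.half_sq_smul {n p : E3 → E3} {f : Fin 3 → E3 → E3}
    (hu : H2 (fun x => m x - e₃) d l) (hu' : H2 (fun x => m' x - e₃) d' l')
    (hn : H2 (fun x => n x - e₃) f p) :
    H2 (fun x => hq (m x) (m' x) • n x)
      (fun k x => hqd (m x) (fun k => d k x) (m' x) (fun k => d' k x) k • n x +
        hq (m x) (m' x) • f k x)
      (fun x => sleib (hq (m x) (m' x)) (hqd (m x) (fun k => d k x) (m' x) (fun k => d' k x))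
        (hql (m x) (fun k => d k x) (l x) (m' x) (fun k => d' k x) (l' x)) (n x)
        (fun k => f k x) (p x)) := by
  refine (((hu.half_sq hu').bilin scalL hn).add (hu.half_sq hu')).congr ?_ (fun k => ?_) ?_
  all_goals
    refine Eventually.of_forall fun x => ?_
    simp only [leib, sleib, scalL_apply, inner_smul_right, inner_e₃_self, mul_one, smul_sub]
    abel

end Jets

/-! ### Integral bounds -/

/-- `f` is integrable with integral at most `c`. -/
def IntLE (f : E3 → ℝ) (c : ℝ) : Prop := Integrable f ∧ ∫ x, f x ≤ c

theorem IntLE.add {f g : E3 → ℝ} {a b : ℝ} (hf : IntLE f a) (hg : IntLE g b) :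
    IntLE (fun x => f x + g x) (a + b) :=
  ⟨hf.1.add hg.1, by rw [integral_add hf.1 hg.1]; exact add_le_add hf.2 hg.2⟩

theorem IntLE.const_mul {f : E3 → ℝ} {a r : ℝ} (hr : 0 ≤ r) (hf : IntLE f a) :
    IntLE (fun x => r * f x) (r * a) :=
  ⟨hf.1.const_mul r, by rw [integral_const_mul]; exact mul_le_mul_of_nonneg_left hf.2 hr⟩

theorem eLpNorm_mul_le_real {p q r : ℝ≥0∞} [ENNReal.HolderTriple p q r] {f g : E3 → ℝ}
    (hf : AEStronglyMeasurable f) (hg : AEStronglyMeasurable g) :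
    eLpNorm (fun x => f x * g x) r volume ≤ eLpNorm f p volume * eLpNorm g q volume :=
  eLpNorm_smul_le_mul_eLpNorm (p := p) (q := q) (r := r) (f := g) (φ := f) hg hf

theorem memLp_mul_real {p q r : ℝ≥0∞} [ENNReal.HolderTriple p q r] {f g : E3 → ℝ}
    (hf : MemLp f p volume) (hg : MemLp g q volume) : MemLp (fun x => f x * g x) r volume :=
  ⟨hf.1.mul hg.1, (eLpNorm_mul_le_real (p := p) (q := q) hf.1 hg.1).trans_lt
    (ENNReal.mul_lt_top hf.2 hg.2)⟩

theorem intLE_mul {p q : ℝ≥0∞} [ENNReal.HolderTriple p q 1] {f g : E3 → ℝ} {a b : ℝ}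
    (hf : MemLp f p volume) (hg : MemLp g q volume) (ha : eLpNorm f p volume ≤ ENNReal.ofReal a)
    (hb : eLpNorm g q volume ≤ ENNReal.ofReal b) (ha0 : 0 ≤ a) (hb0 : 0 ≤ b) :
    IntLE (fun x => f x * g x) (a * b) := by
  have hi := memLp_one_iff_integrable.1 (memLp_mul_real (r := 1) hf hg)
  refine ⟨hi, ?_⟩
  have h1 : ‖∫ x, f x * g x‖ₑ ≤ ENNReal.ofReal (a * b) := by
    refine (enorm_integral_le_lintegral_enorm _).trans ?_
    rw [← eLpNorm_one_eq_lintegral_enorm, ENNReal.ofReal_mul ha0]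
    exact (eLpNorm_mul_le_real (p := p) (q := q) hf.1 hg.1).trans (mul_le_mul' ha hb)
  rw [← ofReal_norm, ENNReal.ofReal_le_ofReal_iff (by positivity)] at h1
  exact (Real.le_norm_self _).trans h1

theorem eLpNorm_mul_le_ofReal {p q r : ℝ≥0∞} [ENNReal.HolderTriple p q r] {f g : E3 → ℝ} {a b : ℝ}
    (hf : MemLp f p volume) (hg : MemLp g q volume) (ha : eLpNorm f p volume ≤ ENNReal.ofReal a)
    (hb : eLpNorm g q volume ≤ ENNReal.ofReal b) (ha0 : 0 ≤ a) :
    eLpNorm (fun x => f x * g x) r volume ≤ ENNReal.ofReal (a * b) := by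
  rw [ENNReal.ofReal_mul ha0]
  exact (eLpNorm_mul_le_real (p := p) (q := q) hf.1 hg.1).trans (mul_le_mul' ha hb)

theorem memLp_sum_norm {p : ℝ≥0∞} {f : Fin 3 → E3 → E3} (hf : ∀ k, MemLp (f k) p volume) :
    MemLp (fun x => ∑ k, ‖f k x‖) p volume :=
  memLp_finsetSum _ fun k _ => (hf k).norm

theorem eLpNorm_sum_norm_le {p : ℝ≥0∞} (hp : 1 ≤ p) {f : Fin 3 → E3 → E3} {c : ℝ}
    (hf : ∀ k, MemLp (f k) p volume) (hc : ∀ k, eLpNorm (f k) p volume ≤ ENNReal.ofReal c) :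
    eLpNorm (fun x => ∑ k, ‖f k x‖) p volume ≤ ENNReal.ofReal (3 * c) := by
  have e : (fun x => ∑ k, ‖f k x‖) = ∑ k, fun x => ‖f k x‖ := by ext1 x; simp
  rw [e]
  refine (eLpNorm_sum_le (fun k _ => (hf k).1.norm) hp).trans ?_
  simp only [eLpNorm_norm]
  refine (Finset.sum_le_sum fun k _ => hc k).trans (le_of_eq ?_)
  rw [Finset.sum_const, Finset.card_univ, Fintype.card_fin, ENNReal.ofReal_mul (by norm_num)]
  simp

/-! ### Absorption -/

/-- `δ` is fixed before `C`, because the constant `C` of the Sobolev inequalities depends on δ. Only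
`K` may depend on `C`. -/
theorem exists_absorb {α p q r s t : ℝ} (hα : 0 < α) (hp : 0 ≤ p) (hr : 0 ≤ r)
    (ht : 0 ≤ t) : ∃ δ : ℝ, 0 < δ ∧ ∀ C : ℝ, 0 ≤ C → ∃ K : ℝ, 0 ≤ K ∧ ∀ X Y S : ℝ, 0 ≤ X → 0 ≤ Y →
      S = δ * X + C * Y →
      p * (S * X) + q * (X * Y) + t * (S * Y) + s * (Y * Y) + r * (S * S) ≤
        α * X ^ 2 + K * Y ^ 2 := by
  -- The terms S X and S² cost at most (p + 2r)δ ≤ α/2 in front of X². The other α/2 is spent on the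
  -- mixed term X Y, and δ ≤ 1 gives δ² ≤ δ.
  set δ : ℝ := min 1 (α / (2 * (p + 2 * r) + 1)) with hδ
  have hδ0 : 0 < δ := lt_min one_pos (by positivity)
  have hδ1 : δ ≤ 1 := min_le_left _ _
  have hδ2 : (p + 2 * r) * δ ≤ α / 2 := by
    have h1 : δ * (2 * (p + 2 * r) + 1) ≤ α :=
      (le_div_iff₀ (by positivity)).1 (min_le_right _ _)
    nlinarith
  refine ⟨δ, hδ0, fun C hC => ?_⟩
  set Q : ℝ := p * C + |q| + t with hQ
  have hQ0 : 0 ≤ Q := by positivity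
  refine ⟨Q ^ 2 / (2 * α) + t * C + |s| + 2 * r * C ^ 2, by positivity, fun X Y S hX hY hS => ?_⟩
  have hXY : 0 ≤ X * Y := mul_nonneg hX hY
  have e1 : S * S ≤ 2 * δ * X ^ 2 + 2 * C ^ 2 * Y ^ 2 := by
    rw [hS]
    have : δ ^ 2 ≤ δ := by nlinarith
    nlinarith [sq_nonneg (δ * X - C * Y), mul_le_mul_of_nonneg_right this (sq_nonneg X)]
  have e2 : S * Y ≤ X * Y + C * Y ^ 2 := by
    rw [hS]; nlinarith
  have e3 : p * (S * X) = p * δ * X ^ 2 + p * C * (X * Y) := by rw [hS]; ring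
  have e4 : q * (X * Y) ≤ |q| * (X * Y) := mul_le_mul_of_nonneg_right (le_abs_self q) hXY
  have e5 : s * (Y * Y) ≤ |s| * Y ^ 2 := by
    rw [← sq]; exact mul_le_mul_of_nonneg_right (le_abs_self s) (sq_nonneg Y)
  have e6 : Q * (X * Y) ≤ α / 2 * X ^ 2 + Q ^ 2 / (2 * α) * Y ^ 2 := by
    have : 0 ≤ (α * X - Q * Y) ^ 2 / (2 * α) := by positivity
    have e : (α * X - Q * Y) ^ 2 / (2 * α) =
        α / 2 * X ^ 2 + Q ^ 2 / (2 * α) * Y ^ 2 - Q * (X * Y) := by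
      field_simp; ring
    linarith
  have e7 := mul_le_mul_of_nonneg_left e1 hr
  have e8 := mul_le_mul_of_nonneg_left e2 ht
  have e9 := mul_le_mul_of_nonneg_right hδ2 (sq_nonneg X)
  rw [hQ] at e6
  rw [e3]
  nlinarith

/-! ### The energy estimate at a fixed time -/

/-- The transport term `(j · ∇) m`. -/
def transport (j : E3) (d : Fin 3 → E3) : E3 := ∑ k, j k • d k

theorem inner_transport {m l : E3} {d : Fin 3 → E3} (hm : SphereJet m d l) (j : E3) :
    ⟪transport j d, m⟫_ℝ = 0 := by
  rw [transport, sum_inner]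
  refine Finset.sum_eq_zero fun k _ => ?_
  rw [inner_smul_left, real_inner_comm, hm.tangent k, mul_zero]

theorem norm_transport_sub_le (j : E3) (d d' : Fin 3 → E3) :
    ‖transport j d - transport j d'‖ ≤ ‖j‖ * ∑ k, ‖d k - d' k‖ := by
  rw [transport, transport, ← Finset.sum_sub_distrib, Finset.mul_sum]
  refine (norm_sum_le _ _).trans (Finset.sum_le_sum fun k _ => ?_)
  rw [← smul_sub, norm_smul]
  exact mul_le_mul_of_nonneg_right (PiLp.norm_apply_le j k) (norm_nonneg _)

theorem memLp_transport {Ω : Type*} [MeasurableSpace Ω] {μ : Measure Ω} {j : Ω → E3}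
    {d : Fin 3 → Ω → E3} (hj : MemLp j (6 / 5) μ) (hd : ∀ k, MemLp (d k) 6 μ) :
    MemLp (fun x => transport (j x) (fun k => d k x)) 1 μ := by
  refine memLp_finsetSum _ fun k _ => ?_
  exact (hd k).smul (r := 1) (p := 6 / 5) ((EuclideanSpace.proj (𝕜 := ℝ) k).comp_memLp' hj)

/-- The properties at a fixed time of a solution with second order jet `(m, D, L)`, velocity `a`
and current `j`, with bounds by `M`. -/
structure Slice (α h : ℝ) (M : ℝ≥0) (j m a : E3 → E3) (D : Fin 3 → E3 → E3) (L : E3 → E3) :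
    Prop where
  unit : ∀ᵐ x, ‖m x‖ = 1
  jet : H2 (fun x => m x - e₃) D L
  lap_le : eLpNorm L 2 volume ≤ M
  pd_le : ∀ k, eLpNorm (D k) 4 volume ≤ M
  cur : AEStronglyMeasurable j volume
  cur_le : eLpNorm j (6 / 5) volume ≤ M
  vel : MemLp a 2 volume
  weak : ∀ ψ ψd ψl, H2 ψ ψd ψl → ∫ x, weakForm α h (m x) (a x) (fun k => D k x) (L x)
    (transport (j x) fun k => D k x) (ψ x) (fun k => ψd k x) (ψl x) = 0

variable {α h : ℝ} {M : ℝ≥0} {j m a m' a' L L' : E3 → E3} {D D' : Fin 3 → E3 → E3}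

theorem Slice.memLp_cur (H : Slice α h M j m a D L) : MemLp j (6 / 5) volume :=
  ⟨H.cur, H.cur_le.trans_lt ENNReal.coe_lt_top⟩

theorem Slice.pairing (H : Slice α h M j m a D L) : PairingBounds α h m a D L
    (fun x => transport (j x) fun k => D k x) volume :=
  pairingBounds α h H.unit H.jet.val H.vel H.jet.lap H.jet.memLp_four
    (memLp_transport H.memLp_cur H.jet.memLp_six)

theorem Slice.intLE (H : Slice α h M j m a D L) {ψ ψl : E3 → E3} {ψd : Fin 3 → E3 → E3}
    (hψ : H2 ψ ψd ψl) : Integrable (fun x => weakForm α h (m x) (a x) (fun k => D k x) (L x)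
      (transport (j x) fun k => D k x) (ψ x) (fun k => ψd k x) (ψl x)) :=
  H.pairing.integrable hψ.val hψ.memLp_top hψ.memLp_four hψ.lap

/-- Integrate `weakForm_difference_le` with `A` = `S`. The single number `S` bounds both the
supremum of the difference and the L⁴ norm of its summed derivatives. -/
theorem Slice.energy_aux (hα : 0 < α) (H : Slice α h M j m a D L) (H' : Slice α h M j m' a' D' L')
    {X Y S T : ℝ} (hS0 : 0 ≤ S) (hT0 : 0 ≤ T)
    (hX : X = (eLpNorm (fun x => L x - L' x) 2 volume).toReal)
    (hY : Y = (eLpNorm (fun x => m x - m' x) 2 volume).toReal)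
    (hA : eLpNorm (fun x => m x - m' x) ⊤ volume ≤ ENNReal.ofReal S)
    (hB : ∀ k, eLpNorm (fun x => D k x - D' k x) 4 volume ≤ ENNReal.ofReal (S / 3))
    (hT : ∀ k, eLpNorm (fun x => D k x - D' k x) 6 volume ≤ ENNReal.ofReal T) :
    (1 + α ^ 2) * (∫ x, ⟪a x - a' x, m x - m' x⟫_ℝ) + α * X ^ 2 ≤
      (1 + α) * S * (M * (3 * T)) + (1 + α) * (X * Y) + α * S * (Y * (2 * M)) + |h| * α * (Y * Y)
      + 2 * (X * S * (6 * M)) + (1 + 2 * α) * S * (X * (2 * M)) + 2 * α * (2 * M * S * S)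
      + 4 * α * S * (S * (6 * M) * (2 * M)) + α * S ^ 2 * (2 * M * (2 * M)) := by
  have hw := H.jet.diff H'.jet
  have hX0 : 0 ≤ X := hX ▸ ENNReal.toReal_nonneg
  have hY0 : 0 ≤ Y := hY ▸ ENNReal.toReal_nonneg
  have hM0 : (0 : ℝ) ≤ M := M.2
  set x : E3 → ℝ := fun z => ‖L z - L' z‖ with hx
  set y : E3 → ℝ := fun z => ‖m z - m' z‖ with hy
  set b : E3 → ℝ := fun z => ∑ k, ‖D k z - D' k z‖ with hb
  set G : E3 → ℝ := fun z => ∑ k, ‖D k z‖ + ∑ k, ‖D' k z‖ with hG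
  set Λ : E3 → ℝ := fun z => ‖L z‖ + ‖L' z‖ with hΛ
  set J : E3 → ℝ := fun z => ‖j z‖ with hJ
  have mx : MemLp x 2 volume := hw.lap.norm
  have my : MemLp y 2 volume := hw.val.norm
  have mb4 : MemLp b 4 volume := memLp_sum_norm hw.memLp_four
  have mb6 : MemLp b 6 volume := memLp_sum_norm hw.memLp_six
  have mG : MemLp G 4 volume :=
    (memLp_sum_norm H.jet.memLp_four).add (memLp_sum_norm H'.jet.memLp_four)
  have mΛ : MemLp Λ 2 volume := H.jet.lap.norm.add H'.jet.lap.norm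
  have mJ : MemLp J (6 / 5) volume := H.memLp_cur.norm
  have hM : ∀ {c : ℝ≥0∞}, c ≤ (M : ℝ≥0∞) → c ≤ ENNReal.ofReal (M : ℝ) := fun hc => by
    rwa [ENNReal.ofReal_coe_nnreal]
  have ex : eLpNorm x 2 volume ≤ ENNReal.ofReal X := by
    rw [hX, ENNReal.ofReal_toReal hw.lap.2.ne, eLpNorm_norm (fun z => L z - L' z)]
  have ey : eLpNorm y 2 volume ≤ ENNReal.ofReal Y := by
    rw [hY, ENNReal.ofReal_toReal hw.val.2.ne, eLpNorm_norm (fun z => m z - m' z)]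
  have eb4 : eLpNorm b 4 volume ≤ ENNReal.ofReal S := by
    have := eLpNorm_sum_norm_le (by norm_num) hw.memLp_four hB
    rwa [mul_div_cancel₀ _ (by norm_num : (3 : ℝ) ≠ 0)] at this
  have eb6 : eLpNorm b 6 volume ≤ ENNReal.ofReal (3 * T) :=
    eLpNorm_sum_norm_le (by norm_num) hw.memLp_six hT
  have eG : eLpNorm G 4 volume ≤ ENNReal.ofReal (6 * M) := by
    have h1 := eLpNorm_sum_norm_le (by norm_num) H.jet.memLp_four fun k => hM (H.pd_le k)
    have h2 := eLpNorm_sum_norm_le (by norm_num) H'.jet.memLp_four fun k => hM (H'.pd_le k)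
    refine (eLpNorm_add_le (memLp_sum_norm H.jet.memLp_four).1
      (memLp_sum_norm H'.jet.memLp_four).1 (by norm_num)).trans ((add_le_add h1 h2).trans ?_)
    rw [← ENNReal.ofReal_add (by positivity) (by positivity)]
    exact ENNReal.ofReal_le_ofReal (by linarith)
  have eΛ : eLpNorm Λ 2 volume ≤ ENNReal.ofReal (2 * M) := by
    refine (eLpNorm_add_le H.jet.lap.1.norm H'.jet.lap.1.norm one_le_two).trans ?_
    rw [eLpNorm_norm, eLpNorm_norm]
    refine (add_le_add (hM H.lap_le) (hM H'.lap_le)).trans ?_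
    rw [← ENNReal.ofReal_add (by positivity) (by positivity)]
    exact ENNReal.ofReal_le_ofReal (by linarith)
  have eJ : eLpNorm J (6 / 5) volume ≤ ENNReal.ofReal M := by
    rw [eLpNorm_norm]; exact hM H.cur_le
  have hyS : ∀ᵐ z, y z ≤ S := by
    have h1 := ae_le_eLpNormEssSup (f := fun z => m z - m' z) (μ := volume)
    filter_upwards [h1] with z hz
    rw [← eLpNorm_exponent_top] at hz
    have := hz.trans hA
    rwa [← ofReal_norm, ENNReal.ofReal_le_ofReal_iff hS0] at this
  -- The transport term: the current in L^{6/5} against the gradient difference in L⁶, with the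
  -- remaining factor bounded uniformly by `S`.
  have t1 := (intLE_mul mJ mb6 eJ eb6 hM0 (by positivity)).const_mul
    (r := (1 + α) * S) (by positivity)
  have t2 := (intLE_mul mx my ex ey hX0 hY0).const_mul (r := 1 + α) (by positivity)
  have t3 := (intLE_mul my mΛ ey eΛ hY0 (by positivity)).const_mul (r := α * S) (by positivity)
  have t4 := (intLE_mul my my ey ey hY0 hY0).const_mul (r := |h| * α) (by positivity)
  -- Three factors with 1/2 + 1/4 + 1/4 = 1, grouped as L^{4/3} against L⁴.
  have t5 := (intLE_mul (p := 4 / 3) (memLp_mul_real (p := 2) (q := 4) mx mb4) mG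
    (eLpNorm_mul_le_ofReal (p := 2) (q := 4) mx mb4 ex eb4 hX0) eG
    (by positivity) (by positivity)).const_mul (r := 2) (by positivity)
  have t6 := (intLE_mul mx mΛ ex eΛ hX0 (by positivity)).const_mul (r := (1 + 2 * α) * S)
    (by positivity)
  have t7 := (intLE_mul (p := 4 / 3) (memLp_mul_real (p := 2) (q := 4) mΛ mb4) mb4
    (eLpNorm_mul_le_ofReal (p := 2) (q := 4) mΛ mb4 eΛ eb4 (by positivity)) eb4
    (by positivity) (by positivity)).const_mul (r := 2 * α) (by positivity)
  have t8 := (intLE_mul (p := 2) (memLp_mul_real (p := 4) (q := 4) mb4 mG) mΛ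
    (eLpNorm_mul_le_ofReal (p := 4) (q := 4) mb4 mG eb4 eG hS0) eΛ
    (by positivity) (by positivity)).const_mul (r := 4 * α * S) (by positivity)
  have t9 := (intLE_mul mΛ mΛ eΛ eΛ (by positivity) (by positivity)).const_mul
    (r := α * S ^ 2) (by positivity)
  have tt := (((((((t1.add t2).add t3).add t4).add t5).add t6).add t7).add t8).add t9
  have T1 := H.jet.test_field α H'.jet
  have T2 := H.jet.half_sq_smul H'.jet H.jet
  have T3 := H.jet.half_sq_smul H'.jet H'.jet
  have i1 := H.intLE T1
  have i2 := (H.intLE T2).const_mul (α ^ 2)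
  have i3 := H'.intLE T1
  have i4 := (H'.intLE T3).const_mul (α ^ 2)
  -- Both equations are tested with the common field, and each with its own parallel correction; all
  -- four integrals vanish.
  have z1 := H.weak _ _ _ T1
  have z2 := H.weak _ _ _ T2
  have z3 := H'.weak _ _ _ T1
  have z4 := H'.weak _ _ _ T3
  have jaw : Integrable fun z => ⟪a z - a' z, m z - m' z⟫_ℝ :=
    integrable_inner_of_memLp (H.vel.sub H'.vel) hw.val
  have jx : Integrable fun z => x z ^ 2 := mx.integrable_sq
  have hpt := (H.jet.sphereJet H.unit).and (H'.jet.sphereJet H'.unit)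
  have key := integral_mono_ae ((jaw.const_mul (1 + α ^ 2)).add (jx.const_mul α))
    (((i1.add i2).sub (i3.sub i4)).add tt.1) (by
      filter_upwards [hpt, hyS] with z hz hzS
      exact weakForm_difference_le h hα hz.1 hz.2 (inner_transport hz.1 _)
        (inner_transport hz.2 _) rfl rfl rfl rfl rfl (norm_transport_sub_le _ _ _) hzS)
  have hX2 : ∫ z, x z ^ 2 = X ^ 2 := by
    have h1 := eLpNorm_sq_eq hw.lap
    have h2 : ∫ z, x z ^ 2 = ∫ z, ⟪L z - L' z, L z - L' z⟫_ℝ := by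
      simp only [hx, real_inner_self_eq_norm_sq]
    rw [h2, hX, ← ENNReal.toReal_pow, h1, ENNReal.toReal_ofReal]
    exact integral_nonneg fun z => real_inner_self_nonneg
  have hL : ∫ z, ((1 + α ^ 2) * ⟪a z - a' z, m z - m' z⟫_ℝ + α * x z ^ 2) =
      (1 + α ^ 2) * (∫ z, ⟪a z - a' z, m z - m' z⟫_ℝ) + α * X ^ 2 := by
    rw [integral_add (jaw.const_mul _) (jx.const_mul _), integral_const_mul, integral_const_mul,
      hX2]
  refine hL.symm.le.trans (key.trans ?_)
  rw [integral_add' ((i1.add i2).sub (i3.sub i4)) tt.1, integral_sub' (i1.add i2) (i3.sub i4),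
    integral_add' i1 i2, integral_sub' i3 i4, integral_const_mul, integral_const_mul, z1, z2, z3,
    z4]
  simpa using tt.2

theorem exists_energy_le (hα : 0 < α) (h : ℝ) (M : ℝ≥0) : ∃ K : ℝ, 0 ≤ K ∧
    ∀ (j m a m' a' L L' : E3 → E3) (D D' : Fin 3 → E3 → E3), Slice α h M j m a D L →
      Slice α h M j m' a' D' L' → ∫ x, ⟪a x - a' x, m x - m' x⟫_ℝ ≤
        K * (eLpNorm (fun x => m x - m' x) 2 volume).toReal ^ 2 := by
  obtain ⟨C6, hC6⟩ := exists_H2_eLpNorm_six_le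
  have hM0 : (0 : ℝ) ≤ M := M.2
  -- The coefficients are read off from `Slice.energy_aux` with `T` = C6 X: p collects S X, q
  -- collects X Y, r collects S², s collects Y² and t collects S Y.
  obtain ⟨δ, hδ, hab⟩ := exists_absorb (α := α)
    (p := (1 + α) * (M * (3 * C6)) + 12 * M + (1 + 2 * α) * (2 * M)) (q := 1 + α)
    (r := 4 * α * M + 48 * α * M ^ 2 + 4 * α * M ^ 2) (s := |h| * α) (t := 2 * α * M) hα
    (by positivity) (by positivity) (by positivity)
  lift δ to ℝ≥0 using hδ.le
  obtain ⟨C1, hC1⟩ := exists_H2_eLpNorm_top_le (NNReal.coe_pos.1 hδ)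
  -- Each of the three partial derivatives may use a third of `S`; hence δ/3 here and 3 C2 in the
  -- constant.
  obtain ⟨C2, hC2⟩ := exists_H2_eLpNorm_four_le (δ := δ / 3) (by
    have := NNReal.coe_pos.1 hδ; positivity)
  obtain ⟨K, hK, hKle⟩ := hab (C1 + 3 * C2) (by positivity)
  refine ⟨K, hK, fun j m a m' a' L L' D D' H H' => ?_⟩
  have hw := H.jet.diff H'.jet
  set X := (eLpNorm (fun x => L x - L' x) 2 volume).toReal with hX
  set Y := (eLpNorm (fun x => m x - m' x) 2 volume).toReal with hY
  have hX0 : 0 ≤ X := ENNReal.toReal_nonneg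
  have hY0 : 0 ≤ Y := ENNReal.toReal_nonneg
  have eX : eLpNorm (fun x => L x - L' x) 2 volume = ENNReal.ofReal X :=
    (ENNReal.ofReal_toReal hw.lap.2.ne).symm
  have eY : eLpNorm (fun x => m x - m' x) 2 volume = ENNReal.ofReal Y :=
    (ENNReal.ofReal_toReal hw.val.2.ne).symm
  have conv : ∀ c C : ℝ≥0, (c : ℝ≥0∞) * ENNReal.ofReal X + C * ENNReal.ofReal Y =
      ENNReal.ofReal (c * X + C * Y) := fun c C => by
    rw [ENNReal.ofReal_add (by positivity) (by positivity), ENNReal.ofReal_mul c.coe_nonneg,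
      ENNReal.ofReal_mul C.coe_nonneg, ENNReal.ofReal_coe_nnreal, ENNReal.ofReal_coe_nnreal]
  have hA : eLpNorm (fun x => m x - m' x) ⊤ volume ≤
      ENNReal.ofReal (δ * X + (C1 + 3 * C2) * Y) := by
    refine (hC1 _ _ _ hw).trans ?_
    rw [eX, eY, conv]
    refine ENNReal.ofReal_le_ofReal ?_
    nlinarith [mul_nonneg C2.coe_nonneg hY0]
  have hB : ∀ k, eLpNorm (fun x => D k x - D' k x) 4 volume ≤
      ENNReal.ofReal ((δ * X + (C1 + 3 * C2) * Y) / 3) := fun k => by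
    refine (hC2 _ _ _ hw k).trans ?_
    rw [eX, eY, conv]
    refine ENNReal.ofReal_le_ofReal ?_
    push_cast
    nlinarith [mul_nonneg C1.coe_nonneg hY0]
  have hT : ∀ k, eLpNorm (fun x => D k x - D' k x) 6 volume ≤ ENNReal.ofReal (C6 * X) :=
    fun k => by
      refine (hC6 _ _ _ hw k).trans ?_
      rw [eX, ENNReal.ofReal_mul C6.coe_nonneg, ENNReal.ofReal_coe_nnreal]
  have key := H.energy_aux hα H' (by positivity) (by positivity) hX hY hA hB hT
  have hab := hKle X Y _ hX0 hY0 rfl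
  set S := δ * X + (C1 + 3 * C2) * Y
  have hI : (1 + α ^ 2) * ∫ x, ⟪a x - a' x, m x - m' x⟫_ℝ ≤ K * Y ^ 2 := by
    linear_combination key + hab
  -- The factor 1 + α² ≥ 1 on the left may be dropped when the integral is positive; otherwise the
  -- bound is trivial.
  by_cases hn : ∫ x, ⟪a x - a' x, m x - m' x⟫_ℝ ≤ 0
  · exact hn.trans (by positivity)
  · nlinarith [sq_nonneg α]

/-! ### Space-time slabs -/

/-- Lebesgue measure on the slab `(0,T) × ℝ³`. -/
def slab (T : ℝ) : Measure (ℝ × E3) := (volume.restrict (Ioo 0 T)).prod volume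

theorem slab_eq_restrict (T : ℝ) : slab T = spaceTimeMeasure.restrict (Ioo 0 T ×ˢ univ) := by
  rw [slab, spaceTimeMeasure, timeMeasure, ← Measure.prod_restrict, Measure.restrict_univ,
    Measure.restrict_restrict measurableSet_Ioo, inter_eq_self_of_subset_left Ioo_subset_Ioi_self]

theorem slab_le (T : ℝ) : slab T ≤ spaceTimeMeasure := by
  rw [slab_eq_restrict]; exact Measure.restrict_le_self

theorem ae_Ioo_of_timeMeasure {p : ℝ → Prop} (h : ∀ᵐ t ∂timeMeasure, p t) (T : ℝ) :
    ∀ᵐ t ∂(volume.restrict (Ioo 0 T)), p t :=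
  ae_mono (Measure.restrict_mono Ioo_subset_Ioi_self le_rfl) h

theorem ae_eq_prod_of_slices {α β F : Type*} [MeasurableSpace α] [MeasurableSpace β]
    [NormedAddCommGroup F] {μ : Measure α} {ν : Measure β} [SFinite μ] [SFinite ν]
    {f g : α × β → F} (hf : AEStronglyMeasurable f (μ.prod ν))
    (hg : AEStronglyMeasurable g (μ.prod ν)) (h : ∀ᵐ t ∂μ, ∀ᵐ x ∂ν, f (t, x) = g (t, x)) :
    f =ᵐ[μ.prod ν] g := by
  have hm : AEMeasurable (fun z => ‖f z - g z‖ₑ) (μ.prod ν) := (hf.sub hg).enorm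
  have h0 : ∫⁻ z, ‖f z - g z‖ₑ ∂(μ.prod ν) = 0 := by
    rw [lintegral_prod _ hm, lintegral_eq_zero_of_ae_eq_zero]
    filter_upwards [h] with t ht
    exact lintegral_eq_zero_of_ae_eq_zero (ht.mono fun x hx => by simp [hx])
  filter_upwards [(lintegral_eq_zero_iff' hm).1 h0] with z hz
  simpa [sub_eq_zero] using hz

/-- Boundedness in time gives integrability only over bounded intervals. Slabs suffice because test
functions have compact support in time. -/
theorem memLp_slab {p : ℝ≥0∞} (hp0 : p ≠ 0) (hp : p ≠ ⊤) {u : ℝ → E3 → E3}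
    (hu : AEStronglyMeasurable (fun z : ℝ × E3 => u z.1 z.2) spaceTimeMeasure) {C : ℝ≥0}
    (hC : ∀ᵐ t ∂timeMeasure, eLpNorm (u t) p volume ≤ C) (T : ℝ) :
    MemLp (fun z : ℝ × E3 => u z.1 z.2) p (slab T) := by
  have hm := hu.mono_measure (slab_le T)
  refine ⟨hm, (eLpNorm_lt_top_iff_lintegral_rpow_enorm_lt_top hp0 hp).2 ?_⟩
  rw [slab, lintegral_prod _ (hm.enorm.pow_const _)]
  refine (lintegral_mono_ae (g := fun _ => (C : ℝ≥0∞) ^ p.toReal) ?_).trans_lt ?_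
  · filter_upwards [ae_Ioo_of_timeMeasure hC T] with t ht
    refine le_trans (le_of_eq ?_) (ENNReal.rpow_le_rpow ht ENNReal.toReal_nonneg)
    rw [eLpNorm_eq_lintegral_rpow_enorm_toReal hp0 hp, ← ENNReal.rpow_mul, one_div,
      inv_mul_cancel₀ (ENNReal.toReal_pos hp0 hp).ne', ENNReal.rpow_one]
  · rw [lintegral_const]
    refine ENNReal.mul_lt_top (ENNReal.rpow_lt_top_of_nonneg ENNReal.toReal_nonneg (by simp)) ?_
    simp

section TimeTest

variable {F : Type*} [NormedAddCommGroup F] [NormedSpace ℝ F]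
  {G : ℝ × E3 → F} {η : ℝ → ℝ}

theorem exists_tsupport_subset_Ioo (hc : HasCompactSupport η) (hs : tsupport η ⊆ Ioi 0) :
    ∃ T : ℝ, tsupport η ⊆ Ioo 0 T := by
  obtain ⟨B, hB⟩ := hc.isCompact.bddAbove
  exact ⟨B + 1, fun t ht => ⟨hs ht, (hB ht).trans_lt (lt_add_one B)⟩⟩

theorem integrableOn_slice (hG : ∀ T, Integrable G (slab T)) (T : ℝ) :
    IntegrableOn (fun t => ∫ x, G (t, x)) (Ioo 0 T) :=
  (hG T).integral_prod_left

theorem locallyIntegrableOn_of_Ioo {F : Type*} [NormedAddCommGroup F] {g : ℝ → F} (hg : ∀ T, IntegrableOn g (Ioo 0 T)) :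
    LocallyIntegrableOn g (Ioi 0) := fun t ht =>
  ⟨Ioo 0 (t + 1), mem_nhdsWithin_of_mem_nhds (Ioo_mem_nhds ht (lt_add_one t)), hg _⟩

theorem integral_time_test (hη : Continuous η) (hc : HasCompactSupport η)
    (hs : tsupport η ⊆ Ioi 0) (hG : ∀ T, Integrable G (slab T)) :
    Integrable (fun z : ℝ × E3 => η z.1 • G z) spaceTimeMeasure ∧
    ∫ z, η z.1 • G z ∂spaceTimeMeasure = ∫ t, η t • ∫ x, G (t, x) := by
  obtain ⟨T, hT⟩ := exists_tsupport_subset_Ioo hc hs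
  obtain ⟨B, hB⟩ := hη.bounded_above_of_compact_support hc
  have hz : ∀ t, t ∉ Ioo 0 T → η t = 0 := fun t ht =>
    image_eq_zero_of_notMem_tsupport fun h => ht (hT h)
  have hi : Integrable (fun z : ℝ × E3 => η z.1 • G z) (slab T) :=
    (hG T).bdd_smul B (hη.comp continuous_fst).aestronglyMeasurable
      (Eventually.of_forall fun z => hB z.1)
  have hsup : Function.support (fun z : ℝ × E3 => η z.1 • G z) ⊆ Ioo 0 T ×ˢ univ := by
    intro z h
    refine ⟨?_, mem_univ _⟩
    by_contra h1
    exact h (by simp [hz _ h1])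
  constructor
  · rw [← integrableOn_iff_integrable_of_support_subset hsup, IntegrableOn, ← slab_eq_restrict]
    exact hi
  · rw [← setIntegral_eq_integral_of_forall_compl_eq_zero
      (s := Ioo 0 T ×ˢ univ) fun z h => ?_, ← slab_eq_restrict]
    · rw [slab] at hi ⊢
      rw [integral_prod _ hi]
      simp only [integral_smul]
      exact setIntegral_eq_integral_of_forall_compl_eq_zero fun t ht => by simp [hz t ht]
    · have : z.1 ∉ Ioo 0 T := fun h1 => h ⟨h1, mem_univ _⟩
      simp [hz _ this]

/-- The fundamental lemma of the calculus of variations in time, applied to the spatial integrals of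
`G`. -/
theorem slice_eq_zero_of_time_test [CompleteSpace F] (hG : ∀ T, Integrable G (slab T))
    (h : ∀ η : ℝ → ℝ, ContDiff ℝ ∞ η → HasCompactSupport η → tsupport η ⊆ Ioi 0 →
      ∫ z, η z.1 • G z ∂spaceTimeMeasure = 0) : ∀ᵐ t ∂timeMeasure, ∫ x, G (t, x) = 0 := by
  refine (ae_restrict_iff' measurableSet_Ioi).2
    (isOpen_Ioi.ae_eq_zero_of_integral_contDiff_smul_eq_zero
      (locallyIntegrableOn_of_Ioo (integrableOn_slice hG)) fun η h1 h2 h3 => ?_)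
  rw [← (integral_time_test h1.continuous h2 h3 hG).2, h η h1 h2 h3]

end TimeTest

/-! ### Products of test functions in time and space -/

section TensorTest

variable {F : Type*} [NormedAddCommGroup F] [NormedSpace ℝ F]

/-- The test function `η(t) f(x)`. -/
def tensorTest {η : ℝ → ℝ} (h1 : ContDiff ℝ ∞ η) (h2 : HasCompactSupport η)
    (h3 : tsupport η ⊆ Ioi 0) {f : E3 → F} (hf : IsTest f) : 𝓓(spaceTime, F) where
  toFun z := η z.1 • f z.2
  contDiff' := by
    have := (h1.comp (contDiff_fst (E := ℝ) (F := E3))).smul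
      (hf.1.comp (contDiff_snd (E := ℝ) (F := E3)))
    exact this.of_le (by simp)
  hasCompactSupport' := by
    refine HasCompactSupport.intro (h2.isCompact.prod hf.2.isCompact) fun z hz => ?_
    by_contra h
    exact hz ⟨subset_tsupport _ fun h0 => h (by simp [h0]),
      subset_tsupport _ fun h0 => h (by simp [h0])⟩
  tsupport_subset' := by
    have h : Function.support (fun z : ℝ × E3 => η z.1 • f z.2) ⊆ tsupport η ×ˢ univ :=
      fun z hz => ⟨subset_tsupport _ fun h0 => hz (by simp [h0]), mem_univ _⟩
    exact (closure_minimal h ((isClosed_tsupport η).prod isClosed_univ)).trans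
      (prod_mono h3 le_rfl)

variable {η : ℝ → ℝ} (h1 : ContDiff ℝ ∞ η) (h2 : HasCompactSupport η)
    (h3 : tsupport η ⊆ Ioi 0) {f : E3 → F} (hf : IsTest f)

@[simp] theorem tensorTest_apply (z : ℝ × E3) : tensorTest h1 h2 h3 hf z = η z.1 • f z.2 := rfl

theorem tensorTest_pd (t : ℝ) (x : E3) (k : Fin 3) :
    fderiv ℝ (fun y : E3 => tensorTest h1 h2 h3 hf (t, y)) x (e k) = η t • pd k f x := by
  simp only [tensorTest_apply]
  exact congrFun (pd_clm hf.1 (η t • ContinuousLinearMap.id ℝ F) k) x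

theorem tensorTest_time (z : ℝ × E3) :
    fderiv ℝ (tensorTest h1 h2 h3 hf) z ((1 : ℝ), (0 : E3)) = deriv η z.1 • f z.2 := by
  have d1 : HasFDerivAt (fun z : ℝ × E3 => η z.1)
      ((fderiv ℝ η z.1).comp (ContinuousLinearMap.fst ℝ ℝ E3)) z :=
    ((h1.differentiable (by simp)) z.1).hasFDerivAt.comp z hasFDerivAt_fst
  have d2 : HasFDerivAt (fun z : ℝ × E3 => f z.2)
      ((fderiv ℝ f z.2).comp (ContinuousLinearMap.snd ℝ ℝ E3)) z :=
    (differentiable_of_smooth hf.1 z.2).hasFDerivAt.comp z hasFDerivAt_snd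
  have := (d1.smul d2).fderiv
  change fderiv ℝ ((fun z : ℝ × E3 => η z.1) • fun z : ℝ × E3 => f z.2) z _ = _
  rw [this]
  simp

theorem tensorTest_lap {f : E3 → E3} (hf : IsTest f) (t : ℝ) (x : E3) :
    Laplacian.laplacian (fun y : E3 => tensorTest h1 h2 h3 hf (t, y)) x = η t • lap f x := by
  simp only [tensorTest_apply]
  have : ContDiff ℝ ∞ fun y => η t • f y := (hf.const_smul (η t)).1
  rw [laplacian_eq_lap this]
  exact congrFun (lap_clm hf.1 (η t • ContinuousLinearMap.id ℝ E3)) x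

end TensorTest

/-! ### Solutions at almost every time -/

instance : SFinite timeMeasure := by unfold timeMeasure; infer_instance

theorem MemLinfLp.memLp_slice {p : ℝ≥0∞} {u : ℝ → E3 → E3} (hu : MemLinfLp p u) :
    ∀ᵐ t ∂timeMeasure, MemLp (u t) p volume := by
  obtain ⟨hm, C, hC⟩ := hu
  filter_upwards [hm.prodMk_left, hC] with t ht hCt
  exact ⟨ht, hCt.trans_lt ENNReal.coe_lt_top⟩

theorem MemLinfLp.memLp_slab {p : ℝ≥0∞} (hp0 : p ≠ 0) (hp : p ≠ ⊤) {u : ℝ → E3 → E3}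
    (hu : MemLinfLp p u) (T : ℝ) : MemLp (fun z : ℝ × E3 => u z.1 z.2) p (slab T) := by
  obtain ⟨hm, C, hC⟩ := hu
  exact LLG.memLp_slab hp0 hp hm hC T

theorem memLp_slice_of_memLp {u : ℝ → E3 → E3}
    (hu : MemLp (fun z : ℝ × E3 => u z.1 z.2) 2 spaceTimeMeasure) :
    ∀ᵐ t ∂timeMeasure, MemLp (u t) 2 volume := by
  have h1 := (memLp_two_iff_integrable_sq_norm hu.1).1 hu
  filter_upwards [h1.prod_right_ae, hu.1.prodMk_left] with t h1t h2t
  exact (memLp_two_iff_integrable_sq_norm h2t).2 h1t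

theorem MemLinfLp.sum {p : ℝ≥0∞} (hp : 1 ≤ p) {u : Fin 3 → ℝ → E3 → E3}
    (hu : ∀ k, MemLinfLp p (u k)) : MemLinfLp p (fun t x => ∑ k, u k t x) := by
  choose hm C hC using hu
  refine ⟨Finset.aestronglyMeasurable_fun_sum _ fun k _ => hm k, ∑ k, C k, ?_⟩
  filter_upwards [ae_all_iff.2 hC, ae_all_iff.2 fun k => (hm k).prodMk_left] with t ht hmt
  have e : (fun x => ∑ k, u k t x) = ∑ k, u k t := by ext1 x; simp
  rw [e]
  push_cast
  exact (eLpNorm_sum_le (fun k _ => hmt k) hp).trans (Finset.sum_le_sum fun k _ => ht k)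

variable {α h : ℝ} {j m mt : ℝ → E3 → E3} {D : Fin 3 → ℝ → E3 → E3}
  {D2 : Fin 3 → Fin 3 → ℝ → E3 → E3}

theorem IsRegular.jet (H : IsRegular m mt D D2) : ∀ᵐ t ∂timeMeasure,
    H2 (fun x => m t x - e₃) (fun k => D k t) (fun x => ∑ k, D2 k k t x) := by
  filter_upwards [H.memL2.memLp_slice, ae_all_iff.2 fun k => (H.memL2_D k).memLp_slice,
    ae_all_iff.2 fun k => (H.memL2_D2 k k).memLp_slice, H.weak_D, H.weak_D2] with t h0 h1 h2 w1 w2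
  exact H2.of_weak h0 h1 h2 (fun k => (w1 k).weakPd) fun k => (w2 k k).weakPd

theorem IsRegular.memLinf_lap (H : IsRegular m mt D D2) :
    MemLinfLp 2 (fun t x => ∑ k, D2 k k t x) :=
  MemLinfLp.sum one_le_two fun k => H.memL2_D2 k k

theorem IsRegular.memLinf_four (H : IsRegular m mt D D2) (k : Fin 3) : MemLinfLp 4 (D k) := by
  obtain ⟨C, hC⟩ := exists_H2_eLpNorm_four_le one_pos
  obtain ⟨-, A, hA⟩ := H.memL2
  obtain ⟨-, B, hB⟩ := H.memLinf_lap
  refine ⟨(H.memL2_D k).1, B + C * A, ?_⟩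
  filter_upwards [H.jet, hA, hB] with t ht hAt hBt
  push_cast
  refine (hC _ _ _ ht k).trans (add_le_add ?_ (mul_le_mul' le_rfl hAt))
  simpa using hBt

theorem IsRegular.memLinf_six (H : IsRegular m mt D D2) (k : Fin 3) : MemLinfLp 6 (D k) := by
  obtain ⟨C, hC⟩ := exists_H2_eLpNorm_six_le
  obtain ⟨-, B, hB⟩ := H.memLinf_lap
  refine ⟨(H.memL2_D k).1, C * B, ?_⟩
  filter_upwards [H.jet, hB] with t ht hBt
  push_cast
  exact (hC _ _ _ ht k).trans (mul_le_mul' le_rfl hBt)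

theorem IsRegular.aestronglyMeasurable (H : IsRegular m mt D D2) :
    AEStronglyMeasurable (fun z : ℝ × E3 => m z.1 z.2) spaceTimeMeasure :=
  (H.memL2.1.add (aestronglyMeasurable_const (b := e₃))).congr
    (Eventually.of_forall fun z => by simp)

theorem IsRegular.sphere_slab (H : IsRegular m mt D D2) (T : ℝ) :
    ∀ᵐ z ∂slab T, ‖m z.1 z.2‖ = 1 :=
  ae_eq_prod_of_slices (f := fun z : ℝ × E3 => ‖m z.1 z.2‖) (g := fun _ => (1 : ℝ))
    (H.aestronglyMeasurable.mono_measure (slab_le T)).norm aestronglyMeasurable_const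
    (ae_Ioo_of_timeMeasure H.sphere T)

theorem IsRegular.pairing_slab (H : IsRegular m mt D D2) (hj : MemLinfLp (6 / 5) j)
    (α h T : ℝ) : PairingBounds α h (fun z : ℝ × E3 => m z.1 z.2) (fun z => mt z.1 z.2)
      (fun k z => D k z.1 z.2) (fun z => ∑ k, D2 k k z.1 z.2)
      (fun z => transport (j z.1 z.2) fun k => D k z.1 z.2) (slab T) :=
  pairingBounds α h (H.sphere_slab T) (H.memL2.memLp_slab two_ne_zero (by simp) T)
    (H.memL2_mt.mono_measure (slab_le T)) (H.memLinf_lap.memLp_slab two_ne_zero (by simp) T)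
    (fun k => (H.memLinf_four k).memLp_slab (by norm_num) (by simp) T)
    (memLp_transport (hj.memLp_slab (by norm_num) (by
        exact ENNReal.div_ne_top (by simp) (by simp)) T)
      fun k => (H.memLinf_six k).memLp_slab (by norm_num) (by simp) T)

theorem IsTest.memLp_slab {f : E3 → E3} (hf : IsTest f) (p : ℝ≥0∞) (T : ℝ) :
    MemLp (fun z : ℝ × E3 => f z.2) p (slab T) :=
  (hf.memLp p).comp_snd _

/-- Product test functions η(t) f(x) localise the space-time equation in time. The exceptional null
set still depends on f. -/
theorem IsRegular.weak_test (H : IsRegular m mt D D2) (hj : MemLinfLp (6 / 5) j)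
    (hw : ∀ φ : 𝓓(spaceTime, E3),
      ∫ z, ⟪mt z.1 z.2, φ z⟫_ℝ ∂spaceTimeMeasure =
        ∫ z,
          (⟪cross (m z.1 z.2) (α • mt z.1 z.2 + ∑ k, D2 k k z.1 z.2 - h • e₃), φ z⟫_ℝ
          + ⟪cross (m z.1 z.2) (∑ k, D2 k k z.1 z.2),
              Laplacian.laplacian (fun y : E3 => φ (z.1, y)) z.2⟫_ℝ
          + 2 * ∑ k, ⟪cross (D k z.1 z.2) (∑ l, D2 l l z.1 z.2),
              fderiv ℝ (fun y : E3 => φ (z.1, y)) z.2 (e k)⟫_ℝ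
          - ⟪∑ k, (j z.1 z.2 k) • D k z.1 z.2, φ z⟫_ℝ) ∂spaceTimeMeasure)
    {f : E3 → E3} (hf : IsTest f) : ∀ᵐ t ∂timeMeasure,
      ∫ x, weakForm α h (m t x) (mt t x) (fun k => D k t x) (∑ k, D2 k k t x)
        (transport (j t x) fun k => D k t x) (f x) (fun k => pd k f x) (lap f x) = 0 := by
  have hG := fun T => (H.pairing_slab hj α h T).integrable (hf.memLp_slab 2 T)
    (hf.memLp_slab ⊤ T) (fun k => (hf.pd k).memLp_slab 4 T) (hf.lap.memLp_slab 2 T)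
  refine slice_eq_zero_of_time_test hG fun η h1 h2 h3 => ?_
  have hφ := hw (tensorTest h1 h2 h3 hf)
  simp only [tensorTest_pd, tensorTest_lap] at hφ
  simp only [tensorTest_apply] at hφ
  have i1 := (integral_time_test h1.continuous h2 h3 hG).1
  have i2 := (integral_time_test h1.continuous h2 h3 fun T => integrable_inner_of_memLp
    (H.memL2_mt.mono_measure (slab_le T)) (hf.memLp_slab 2 T)).1
  have e1 : ∀ z : ℝ × E3, η z.1 • weakForm α h (m z.1 z.2) (mt z.1 z.2) (fun k => D k z.1 z.2)
      (∑ k, D2 k k z.1 z.2) (transport (j z.1 z.2) fun k => D k z.1 z.2) (f z.2)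
      (fun k => pd k f z.2) (lap f z.2) = η z.1 • ⟪mt z.1 z.2, f z.2⟫_ℝ -
        (⟪cross (m z.1 z.2) (α • mt z.1 z.2 + ∑ k, D2 k k z.1 z.2 - h • e₃), η z.1 • f z.2⟫_ℝ
          + ⟪cross (m z.1 z.2) (∑ k, D2 k k z.1 z.2), η z.1 • lap f z.2⟫_ℝ
          + 2 * ∑ k, ⟪cross (D k z.1 z.2) (∑ l, D2 l l z.1 z.2), η z.1 • pd k f z.2⟫_ℝ
          - ⟪∑ k, (j z.1 z.2 k) • D k z.1 z.2, η z.1 • f z.2⟫_ℝ) := fun z => by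
    simp only [weakForm, transport, inner_add_left, inner_sub_left, inner_smul_right,
      ← Finset.mul_sum, smul_eq_mul]
    ring
  -- The equation asserts only an equality of integrals; integrability of its right-hand side is
  -- recovered as a difference of integrable functions.
  have i3 := (i2.sub i1).congr (Eventually.of_forall fun z => by
    simp only [Pi.sub_apply]
    rw [e1 z, sub_sub_cancel])
  refine (integral_congr_ae (Eventually.of_forall e1)).trans ?_
  rw [integral_sub i2 i3, ← hφ]
  simp only [inner_smul_right, smul_eq_mul, sub_self]

/-- Countably many null sets of times are discarded. At each remaining time the equation extends by
density to every test jet in `H2`, including those built from the solutions themselves. -/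
theorem IsSolution.exists_slice (hs : IsSolution α h j m) (hj : MemLinfLp (6 / 5) j) :
    ∃ (mt : ℝ → E3 → E3) (D : Fin 3 → ℝ → E3 → E3) (D2 : Fin 3 → Fin 3 → ℝ → E3 → E3) (M : ℝ≥0),
      IsRegular m mt D D2 ∧ ∀ᵐ t ∂timeMeasure, Slice α h M (j t) (m t) (mt t) (fun k => D k t)
        (fun x => ∑ k, D2 k k t x) := by
  obtain ⟨mt, D, D2, H, hw⟩ := hs
  obtain ⟨-, B, hB⟩ := H.memLinf_lap
  choose _ A hA using H.memLinf_four
  obtain ⟨hjm, C, hC⟩ := hj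
  obtain ⟨𝓕, hcount, htest, hdense⟩ := exists_countable_test
  have hweak : ∀ᵐ t ∂timeMeasure, ∀ f ∈ 𝓕,
      ∫ x, weakForm α h (m t x) (mt t x) (fun k => D k t x) (∑ k, D2 k k t x)
        (transport (j t x) fun k => D k t x) (f x) (fun k => pd k f x) (lap f x) = 0 :=
    (ae_ball_iff hcount).2 fun f hf => H.weak_test ⟨hjm, C, hC⟩ hw (htest f hf)
  refine ⟨mt, D, D2, B + (∑ k, A k) + C, H, ?_⟩
  have cB : (B : ℝ≥0∞) ≤ ((B + (∑ k, A k) + C : ℝ≥0) : ℝ≥0∞) := by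
    exact_mod_cast (le_self_add.trans le_self_add : B ≤ B + (∑ k, A k) + C)
  have cA : ∀ k, (A k : ℝ≥0∞) ≤ ((B + (∑ k, A k) + C : ℝ≥0) : ℝ≥0∞) := fun k => by
    have h1 : A k ≤ ∑ k, A k := Finset.single_le_sum (fun _ _ => zero_le) (Finset.mem_univ k)
    exact_mod_cast (h1.trans (le_add_self.trans le_self_add) : A k ≤ B + (∑ k, A k) + C)
  have cC : (C : ℝ≥0∞) ≤ ((B + (∑ k, A k) + C : ℝ≥0) : ℝ≥0∞) := by
    exact_mod_cast (le_add_self : C ≤ B + (∑ k, A k) + C)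
  filter_upwards [H.sphere, H.jet, hB, ae_all_iff.2 hA, hjm.prodMk_left, hC,
    memLp_slice_of_memLp H.memL2_mt, hweak] with t h1 h2 h3 h4 h5 h6 h7 h8
  have hp : PairingBounds α h (m t) (mt t) (fun k => D k t) (fun x => ∑ k, D2 k k t x)
      (fun x => transport (j t x) fun k => D k t x) volume :=
    pairingBounds α h h1 h2.val h7 h2.lap h2.memLp_four
      (memLp_transport ⟨h5, h6.trans_lt ENNReal.coe_lt_top⟩ h2.memLp_six)
  refine ⟨h1, h2, h3.trans cB, fun k => (h4 k).trans (cA k), h5, h6.trans cC, h7,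
    fun ψ ψd ψl hψ => ?_⟩
  obtain ⟨f, hf, hmem⟩ := hdense ψ ψd ψl hψ
  exact hp.integral_eq_zero hψ hf fun n => h8 _ (hmem n)

theorem Slice.mono {M N : ℝ≥0} (hMN : M ≤ N) {j m a L : E3 → E3} {D : Fin 3 → E3 → E3}
    (H : Slice α h M j m a D L) : Slice α h N j m a D L :=
  have h : (M : ℝ≥0∞) ≤ N := by exact_mod_cast hMN
  ⟨H.unit, H.jet, H.lap_le.trans h, fun k => (H.pd_le k).trans h, H.cur, H.cur_le.trans h, H.vel,
    H.weak⟩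

/-! ### Functions of time with a weak derivative -/

section Time

variable {g b η : ℝ → ℝ}

theorem intervalIntegrable_of_Ioo {s t : ℝ} (hb : ∀ T, IntegrableOn b (Ioo 0 T)) (hs : 0 ≤ s)
    (ht : 0 ≤ t) : IntervalIntegrable b volume s t := by
  have h : ∀ {u : ℝ}, 0 ≤ u → IntervalIntegrable b volume 0 u := fun {u} hu => by
    rw [intervalIntegrable_iff_integrableOn_Ioo_of_le hu]; exact hb u
  exact (h hs).symm.trans (h ht)

theorem absolutelyContinuous_primitive (hb : ∀ T, IntegrableOn b (Ioo 0 T)) {T : ℝ} (hT : 0 ≤ T) :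
    AbsolutelyContinuousOnInterval (fun t => ∫ s in 0..t, b s) 0 T :=
  (intervalIntegrable_of_Ioo hb le_rfl hT).absolutelyContinuousOnInterval_intervalIntegral
    left_mem_uIcc

theorem ae_deriv_primitive (hb : ∀ T, IntegrableOn b (Ioo 0 T)) {T : ℝ} (hT : 0 ≤ T) :
    ∀ᵐ t, t ∈ uIoc 0 T → deriv (fun t => ∫ s in 0..t, b s) t = b t := by
  filter_upwards [(intervalIntegrable_of_Ioo hb le_rfl hT).ae_hasDerivAt_integral] with t ht hm
  exact (ht (uIoc_subset_uIcc hm) 0 left_mem_uIcc).deriv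

theorem integral_eq_interval_of_tsupport {f : ℝ → ℝ} {T : ℝ} (hT : 0 ≤ T)
    (h : ∀ t, t ∉ Ioo 0 T → f t = 0) : ∫ t, f t = ∫ t in 0..T, f t := by
  rw [intervalIntegral.integral_of_le hT, integral_Ioc_eq_integral_Ioo]
  exact (setIntegral_eq_integral_of_forall_compl_eq_zero h).symm

/-- Integration by parts for absolutely continuous functions; η vanishes at both ends of the
interval. -/
theorem integral_deriv_mul_primitive (hb : ∀ T, IntegrableOn b (Ioo 0 T)) (h1 : ContDiff ℝ ∞ η)
    (h2 : HasCompactSupport η) (h3 : tsupport η ⊆ Ioi 0) :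
    ∫ t, deriv η t * ∫ s in 0..t, b s = -∫ t, η t * b t := by
  obtain ⟨T, hT⟩ := exists_tsupport_subset_Ioo h2 h3
  -- `T` may be negative when the support of η is empty.
  set S := max T 0
  have hS : (0 : ℝ) ≤ S := le_max_right _ _
  have hz : ∀ t, t ∉ Ioo 0 S → η t = 0 := fun t ht =>
    image_eq_zero_of_notMem_tsupport fun h => ht ⟨(hT h).1, (hT h).2.trans_le (le_max_left _ _)⟩
  have hz' : ∀ t, t ∉ Ioo 0 S → deriv η t = 0 := fun t ht =>
    image_eq_zero_of_notMem_tsupport fun h => ht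
      ⟨(hT (tsupport_deriv_subset h)).1,
        (hT (tsupport_deriv_subset h)).2.trans_le (le_max_left _ _)⟩
  rw [integral_eq_interval_of_tsupport hS fun t ht => by rw [hz' t ht, zero_mul],
    integral_eq_interval_of_tsupport hS fun t ht => by rw [hz t ht, zero_mul]]
  have hη : AbsolutelyContinuousOnInterval η 0 S :=
    ContDiffOn.absolutelyContinuousOnInterval (h1.of_le (by simp)).contDiffOn
  have hB := absolutelyContinuous_primitive hb hS
  have key := hη.integral_mul_deriv_eq_deriv_mul hB
  rw [hz S (by simp), zero_mul, hz 0 (by simp), zero_mul, sub_zero, zero_sub] at key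
  rw [← neg_eq_iff_eq_neg, ← key]
  refine intervalIntegral.integral_congr_ae ?_
  filter_upwards [ae_deriv_primitive hb hS] with t ht hm
  rw [ht hm]

theorem exists_time_bump : ∃ η : ℝ → ℝ, ContDiff ℝ ∞ η ∧ HasCompactSupport η ∧
    tsupport η ⊆ Ioi 0 ∧ ∫ t, η t = 1 := by
  let ρ : ContDiffBump (1 : ℝ) := ⟨1 / 4, 1 / 2, by norm_num, by norm_num⟩
  refine ⟨ρ.normed volume, ρ.contDiff_normed, ρ.hasCompactSupport_normed, ?_, ρ.integral_normed⟩
  rw [ρ.tsupport_normed_eq, Real.closedBall_eq_Icc]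
  exact fun t ht => lt_of_lt_of_le (by norm_num [ρ]) ht.1

/-- A test function on `(0,∞)` with vanishing integral has a primitive that is a test function. -/
theorem exists_test_primitive {θ : ℝ → ℝ} (h1 : ContDiff ℝ ∞ θ) (h2 : HasCompactSupport θ)
    (h3 : tsupport θ ⊆ Ioi 0) (h0 : ∫ t, θ t = 0) : ∃ η : ℝ → ℝ, ContDiff ℝ ∞ η ∧
      HasCompactSupport η ∧ tsupport η ⊆ Ioi 0 ∧ deriv η = θ := by
  have hd : ∀ t, HasDerivAt (fun t => ∫ s in 0..t, θ s) (θ t) t := fun t =>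
    h1.continuous.integral_hasStrictDerivAt 0 t |>.hasDerivAt
  have hde : deriv (fun t => ∫ s in 0..t, θ s) = θ := funext fun t => (hd t).deriv
  obtain ⟨T, hT⟩ := exists_tsupport_subset_Ioo h2 h3
  -- A positive lower bound for the support keeps the support of the primitive away from zero.
  obtain ⟨a, ha, haT⟩ : ∃ a : ℝ, 0 < a ∧ ∀ t ∈ tsupport θ, a ≤ t := by
    rcases (tsupport θ).eq_empty_or_nonempty with he | hne
    · exact ⟨1, one_pos, by simp [he]⟩
    · obtain ⟨a, ha, hmin⟩ := h2.isCompact.exists_isMinOn hne continuousOn_id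
      exact ⟨a, h3 ha, fun t ht => hmin ht⟩
  have hz : ∀ t, t ∉ Icc a T → θ t = 0 := fun t ht =>
    image_eq_zero_of_notMem_tsupport fun h => ht ⟨haT t h, (hT h).2.le⟩
  have hsup : Function.support (fun t => ∫ s in 0..t, θ s) ⊆ Icc a T := by
    intro t ht
    by_contra hmem
    refine ht ?_
    change ∫ s in 0..t, θ s = 0
    rcases lt_or_ge t a with hta | hta
    · refine intervalIntegral.integral_zero_ae (Eventually.of_forall fun s hs => hz s fun hs' => ?_)
      rcases le_total 0 t with h | h
      · rw [uIoc_of_le h] at hs; linarith [hs.2, hs'.1]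
      · rw [uIoc_of_ge h] at hs; linarith [hs.2, hs'.1]
    -- Beyond `T` the primitive equals the total integral of θ, which is zero.
    · have htT : T < t := by
        by_contra h
        exact hmem ⟨hta, not_lt.1 h⟩
      have ht0 : 0 ≤ t := ha.le.trans hta
      rw [← integral_eq_interval_of_tsupport ht0, h0]
      refine fun s hs => hz s fun hs' => hs ⟨ha.trans_le hs'.1, hs'.2.trans_lt htT⟩
  have hcl : tsupport (fun t => ∫ s in 0..t, θ s) ⊆ Icc a T := closure_minimal hsup isClosed_Icc
  refine ⟨fun t => ∫ s in 0..t, θ s, ?_, ?_, fun t ht => ha.trans_le (hcl ht).1, hde⟩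
  · exact contDiff_infty_iff_deriv.2 ⟨fun t => (hd t).differentiableAt, by rw [hde]; exact h1⟩
  · exact isCompact_Icc.of_isClosed_subset (isClosed_tsupport _) hcl

/-- A function on `(0,∞)` with vanishing weak derivative is constant. -/
theorem exists_ae_eq_const (hg : ∀ T, IntegrableOn g (Ioo 0 T))
    (h : ∀ η : ℝ → ℝ, ContDiff ℝ ∞ η → HasCompactSupport η → tsupport η ⊆ Ioi 0 →
      ∫ t, deriv η t * g t = 0) : ∃ c : ℝ, ∀ᵐ t ∂timeMeasure, g t = c := by
  obtain ⟨η₀, a1, a2, a3, a4⟩ := exists_time_bump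
  have hint : ∀ {θ : ℝ → ℝ} {f : ℝ → ℝ}, Continuous θ → HasCompactSupport θ →
      tsupport θ ⊆ Ioi 0 → (∀ T, IntegrableOn f (Ioo 0 T)) → Integrable fun t => θ t * f t := by
    intro θ f c1 c2 c3 hf
    obtain ⟨T, hT⟩ := exists_tsupport_subset_Ioo c2 c3
    obtain ⟨B, hB⟩ := c1.bounded_above_of_compact_support c2
    have hs : Function.support (fun t => θ t * f t) ⊆ Ioo 0 T := fun t ht =>
      hT (subset_tsupport _ fun h0 => ht (by simp [h0]))
    rw [← integrableOn_iff_integrable_of_support_subset hs]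
    exact (hf T).bdd_mul c1.aestronglyMeasurable (Eventually.of_forall hB)
  have hconst : ∀ (c : ℝ) (T : ℝ), IntegrableOn (fun _ => c) (Ioo 0 T) := fun c T =>
    integrableOn_const (by simp)
  refine ⟨∫ t, η₀ t * g t, ?_⟩
  set c := ∫ t, η₀ t * g t with hc
  have key := isOpen_Ioi.ae_eq_zero_of_integral_contDiff_smul_eq_zero (μ := volume)
    (f := fun t => g t - c)
    (locallyIntegrableOn_of_Ioo fun T => (hg T).sub (hconst c T)) fun θ b1 b2 b3 => ?_
  · refine (ae_restrict_iff' measurableSet_Ioi).2 (key.mono fun t ht hm => ?_)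
    exact sub_eq_zero.1 (ht hm)
  -- Subtracting r η₀ leaves mean zero, so the remainder is the derivative of an admissible test
  -- function.
  · set r := ∫ t, θ t with hr
    have s1 : ContDiff ℝ ∞ (fun t => θ t - r * η₀ t) := b1.sub (contDiff_const.mul a1)
    have hsub : tsupport (fun t => θ t - r * η₀ t) ⊆ tsupport θ ∪ tsupport η₀ := by
      refine closure_minimal (fun t ht => ?_) ((isClosed_tsupport _).union (isClosed_tsupport _))
      by_contra hn
      rw [mem_union, not_or] at hn
      exact ht (by simp [image_eq_zero_of_notMem_tsupport hn.1,
        image_eq_zero_of_notMem_tsupport hn.2])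
    have s2 : HasCompactSupport (fun t => θ t - r * η₀ t) :=
      (b2.isCompact.union a2.isCompact).of_isClosed_subset (isClosed_tsupport _) hsub
    have s3 := hsub.trans (union_subset b3 a3)
    have iθ : Integrable θ := b1.continuous.integrable_of_hasCompactSupport b2
    have iη : Integrable η₀ := a1.continuous.integrable_of_hasCompactSupport a2
    have s4 : ∫ t, (θ t - r * η₀ t) = 0 := by
      rw [integral_sub iθ (iη.const_mul r), integral_const_mul, a4, mul_one, hr, sub_self]
    obtain ⟨η, e1, e2, e3, e4⟩ := exists_test_primitive s1 s2 s3 s4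
    have := h η e1 e2 e3
    simp only [e4, sub_mul, mul_assoc] at this
    have i1 := hint b1.continuous b2 b3 hg
    have i2 := hint a1.continuous a2 a3 hg
    rw [integral_sub i1 (i2.const_mul r), integral_const_mul] at this
    simp only [smul_eq_mul, mul_sub]
    rw [integral_sub i1 (iθ.mul_const c), integral_mul_const]
    linarith

theorem exists_ae_eq_primitive (hg : ∀ T, IntegrableOn g (Ioo 0 T))
    (hb : ∀ T, IntegrableOn b (Ioo 0 T))
    (h : ∀ η : ℝ → ℝ, ContDiff ℝ ∞ η → HasCompactSupport η → tsupport η ⊆ Ioi 0 →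
      ∫ t, deriv η t * g t = -∫ t, η t * b t) :
    ∃ c : ℝ, ∀ᵐ t ∂timeMeasure, g t = c + ∫ s in 0..t, b s := by
  have hB : ∀ T, IntegrableOn (fun t => ∫ s in 0..t, b s) (Ioo 0 T) := fun T => by
    rcases le_total 0 T with hT | hT
    · have := (absolutelyContinuous_primitive hb hT).continuousOn
      rw [uIcc_of_le hT] at this
      exact (this.integrableOn_Icc).mono_set Ioo_subset_Icc_self
    · rw [Ioo_eq_empty (not_lt.2 hT)]; exact integrableOn_empty
  obtain ⟨c, hc⟩ := exists_ae_eq_const (g := fun t => g t - ∫ s in 0..t, b s)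
    (fun T => (hg T).sub (hB T)) fun η h1 h2 h3 => by
      have hint : ∀ {f : ℝ → ℝ}, (∀ T, IntegrableOn f (Ioo 0 T)) →
          Integrable fun t => deriv η t * f t := by
        intro f hf
        obtain ⟨T, hT⟩ := exists_tsupport_subset_Ioo h2 h3
        have c1 : Continuous (deriv η) := (contDiff_infty_iff_deriv.1 h1).2.continuous
        obtain ⟨B, hB⟩ := c1.bounded_above_of_compact_support h2.deriv
        have hs : Function.support (fun t => deriv η t * f t) ⊆ Ioo 0 T := fun t ht =>
          hT (tsupport_deriv_subset (subset_tsupport _ fun h0 => ht (by simp [h0])))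
        rw [← integrableOn_iff_integrable_of_support_subset hs]
        exact (hf T).bdd_mul c1.aestronglyMeasurable (Eventually.of_forall hB)
      simp only [mul_sub]
      rw [integral_sub (hint hg) (hint hB), h η h1 h2 h3,
        integral_deriv_mul_primitive hb h1 h2 h3, sub_self]
  exact ⟨c, hc.mono fun t ht => by linarith⟩

instance neBot_initial : NeBot (𝓝[>] (0 : ℝ) ⊓ ae volume) := by
  rw [Filter.inf_neBot_iff]
  intro s hs s' hs'
  obtain ⟨ε, hε, hsub⟩ := mem_nhdsGT_iff_exists_Ioo_subset.1 hs
  by_contra hn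
  rw [not_nonempty_iff_eq_empty] at hn
  have h1 : Ioo (0 : ℝ) ε ⊆ s'ᶜ := fun t ht ht' => by
    have : t ∈ s ∩ s' := ⟨hsub ht, ht'⟩
    rw [hn] at this; exact this
  have h2 : volume (Ioo (0 : ℝ) ε) = 0 := measure_mono_null h1 hs'
  rw [Real.volume_Ioo, ENNReal.ofReal_eq_zero] at h2
  have : (0 : ℝ) < ε := hε
  linarith

/-- The function and the primitive both tend to zero at time zero, so the constant of integration
vanishes; `neBot_initial` makes that limit unique. -/
theorem ae_eq_primitive (hg : ∀ T, IntegrableOn g (Ioo 0 T))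
    (hb : ∀ T, IntegrableOn b (Ioo 0 T))
    (h : ∀ η : ℝ → ℝ, ContDiff ℝ ∞ η → HasCompactSupport η → tsupport η ⊆ Ioi 0 →
      ∫ t, deriv η t * g t = -∫ t, η t * b t)
    (h0 : Tendsto g (𝓝[>] (0 : ℝ) ⊓ ae volume) (𝓝 0)) :
    ∀ᵐ t ∂timeMeasure, g t = ∫ s in 0..t, b s := by
  obtain ⟨c, hc⟩ := exists_ae_eq_primitive hg hb h
  have hB : Tendsto (fun t => ∫ s in 0..t, b s) (𝓝[>] (0 : ℝ)) (𝓝 0) := by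
    have hcont := (absolutelyContinuous_primitive hb zero_le_one).continuousOn
    rw [uIcc_of_le zero_le_one] at hcont
    have := (hcont 0 (by simp)).mono_of_mem_nhdsWithin
      (mem_of_superset (Ioo_mem_nhdsGT one_pos) Ioo_subset_Icc_self)
    simpa [ContinuousWithinAt] using this
  have he : g =ᶠ[𝓝[>] (0 : ℝ) ⊓ ae volume] fun t => c + ∫ s in 0..t, b s := by
    have h1 := (ae_restrict_iff' measurableSet_Ioi).1 hc
    exact mem_inf_of_inter self_mem_nhdsWithin h1 fun t ht => ht.2 ht.1
  have hc0 : c = 0 := by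
    have := tendsto_nhds_unique (h0.congr' he) ((hB.mono_left inf_le_left).const_add c)
    linarith
  exact hc.mono fun t ht => by rw [ht, hc0, zero_add]

end Time

/-! ### The energy identity -/

/-- The primitive in time of a function on space-time. -/
def primitive (A : ℝ × E3 → ℝ) (z : ℝ × E3) : ℝ :=
  ∫ s, (Ioo 0 z.1).indicator (fun s => A (s, z.2)) s

theorem primitive_eq (A : ℝ × E3 → ℝ) {t : ℝ} (ht : 0 ≤ t) (x : E3) :
    primitive A (t, x) = ∫ s in 0..t, A (s, x) := by
  rw [primitive, integral_indicator measurableSet_Ioo, intervalIntegral.integral_of_le ht,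
    integral_Ioc_eq_integral_Ioo]

/-- The indicator turns the variable endpoint into part of a jointly measurable integrand. -/
theorem stronglyMeasurable_primitive {A : ℝ × E3 → ℝ} (hA : StronglyMeasurable A) :
    StronglyMeasurable (primitive A) := by
  have hS : MeasurableSet {p : (ℝ × E3) × ℝ | 0 < p.2 ∧ p.2 < p.1.1} :=
    (measurableSet_lt measurable_const measurable_snd).inter
      (measurableSet_lt measurable_snd (measurable_fst.comp measurable_fst))
  have h1 : StronglyMeasurable fun p : (ℝ × E3) × ℝ => A (p.2, p.1.2) :=
    hA.comp_measurable (measurable_snd.prodMk (measurable_snd.comp measurable_fst))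
  exact (h1.indicator hS).integral_prod_right'

/-- Cauchy–Schwarz in time on an interval of length t. -/
theorem primitive_sq_le {A : ℝ × E3 → ℝ} (hA : StronglyMeasurable A) (t : ℝ) (x : E3) :
    ‖primitive A (t, x)‖ₑ ^ 2 ≤ ENNReal.ofReal t * ∫⁻ s in Ioo 0 t, ‖A (s, x)‖ₑ ^ 2 := by
  have hm : AEStronglyMeasurable (fun s => A (s, x)) (volume.restrict (Ioo 0 t)) :=
    (hA.comp_measurable measurable_prodMk_right).aestronglyMeasurable
  have h1 : ‖primitive A (t, x)‖ₑ ≤ eLpNorm (fun s => A (s, x)) 1 (volume.restrict (Ioo 0 t)) := by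
    rw [primitive, integral_indicator measurableSet_Ioo, eLpNorm_one_eq_lintegral_enorm]
    exact enorm_integral_le_lintegral_enorm _
  have h2 := eLpNorm_le_eLpNorm_mul_rpow_measure_univ (p := 1) (q := 2) (by norm_num) hm
  have h4 := pow_le_pow_left₀ zero_le (h1.trans h2) 2
  have h5 : (volume.restrict (Ioo 0 t) univ ^ (1 / ENNReal.toReal 1 - 1 / ENNReal.toReal 2)) ^ 2 =
      ENNReal.ofReal t := by
    rw [← ENNReal.rpow_natCast, ← ENNReal.rpow_mul]
    norm_num
  rw [mul_pow, eLpNorm_two_sq_eq, h5, mul_comm] at h4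
  exact h4

theorem memLp_primitive {A : ℝ × E3 → ℝ} (hA : StronglyMeasurable A)
    (hA2 : ∀ T, MemLp A 2 (slab T)) (t : ℝ) : MemLp (fun x => primitive A (t, x)) 2 volume := by
  refine ⟨((stronglyMeasurable_primitive hA).comp_measurable
    measurable_prodMk_left).aestronglyMeasurable, ?_⟩
  refine (ENNReal.pow_lt_top_iff.1 ?_).resolve_right two_ne_zero
  rw [eLpNorm_two_sq_eq]
  refine (lintegral_mono fun x => primitive_sq_le hA t x).trans_lt ?_
  have hm : Measurable fun z : ℝ × E3 => ‖A z‖ₑ ^ 2 := hA.measurable.enorm.pow_const 2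
  rw [lintegral_const_mul _ (Measurable.lintegral_prod_left' hm)]
  refine ENNReal.mul_lt_top (by simp) ?_
  rw [← lintegral_prod_symm _ hm.aemeasurable]
  have := ENNReal.pow_lt_top (n := 2) (hA2 t).2
  rw [eLpNorm_two_sq_eq] at this
  exact this

theorem ae_integrableOn_line {A : ℝ × E3 → ℝ} (hA2 : ∀ T, MemLp A 2 (slab T)) :
    ∀ᵐ x : E3, ∀ T, IntegrableOn (fun s => A (s, x)) (Ioo 0 T) := by
  have h : ∀ n : ℕ, ∀ᵐ x : E3, IntegrableOn (fun s => A (s, x)) (Ioo 0 (n : ℝ)) := fun n => by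
    have h1 := (memLp_two_iff_integrable_sq_norm (hA2 n).1).1 (hA2 n)
    filter_upwards [h1.prod_left_ae, (hA2 n).1.prod_swap.prodMk_left] with x hx hmx
    have : MemLp (fun s => A (s, x)) 2 (volume.restrict (Ioo 0 (n : ℝ))) :=
      (memLp_two_iff_integrable_sq_norm hmx).2 hx
    exact this.integrable one_le_two
  filter_upwards [ae_all_iff.2 h] with x hx T
  obtain ⟨n, hn⟩ := exists_nat_ge T
  exact (hx n).mono_set (Ioo_subset_Ioo_right hn)

/-- On almost every time line the primitive is absolutely continuous, and its square has derivative
2 · `primitive A` · `A`. -/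
theorem primitive_sq {A : ℝ × E3 → ℝ} {x : E3}
    (hx : ∀ T, IntegrableOn (fun s => A (s, x)) (Ioo 0 T)) {t : ℝ} (ht : 0 ≤ t) :
    primitive A (t, x) ^ 2 = 2 * ∫ s in Ioo 0 t, primitive A (s, x) * A (s, x) := by
  have hB := absolutelyContinuous_primitive hx ht
  have key := hB.integral_deriv_mul_eq_sub hB
  have e : ∫ s in 0..t, 2 * (primitive A (s, x) * A (s, x)) =
      ∫ s in 0..t, (deriv (fun t => ∫ s in 0..t, A (s, x)) s * (∫ r in 0..s, A (r, x)) +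
        (∫ r in 0..s, A (r, x)) * deriv (fun t => ∫ s in 0..t, A (s, x)) s) := by
    refine intervalIntegral.integral_congr_ae ?_
    filter_upwards [ae_deriv_primitive hx ht] with s hs hm
    have h0 : 0 ≤ s := by rw [uIoc_of_le ht] at hm; exact hm.1.le
    rw [hs hm, primitive_eq A h0]
    ring
  rw [← integral_Ioc_eq_integral_Ioo, ← intervalIntegral.integral_of_le ht,
    ← intervalIntegral.integral_const_mul, e, key, primitive_eq A ht,
    intervalIntegral.integral_same]
  ring

/-- Take e₃-components of the countable vector family; approximating ζ e₃ in L² recovers any scalar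
test function ζ. -/
theorem exists_countable_scalar_test : ∃ 𝓢 : Set (E3 → ℝ), 𝓢.Countable ∧ (∀ ζ ∈ 𝓢, IsTest ζ) ∧
    ∀ v : E3 → ℝ, MemLp v 2 volume → (∀ ζ ∈ 𝓢, ∫ x, ζ x * v x = 0) → v =ᵐ[volume] 0 := by
  obtain ⟨𝓕, hc, ht, hd⟩ := exists_countable_test
  refine ⟨(fun f x => ⟪e₃, f x⟫_ℝ) '' 𝓕, hc.image _, ?_, fun v hv h => ?_⟩
  · rintro _ ⟨f, hf, rfl⟩
    exact (ht f hf).clm (innerSL ℝ e₃)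
  · refine ae_eq_zero_of_integral_contDiff_smul_eq_zero (hv.locallyIntegrable one_le_two)
      fun ζ h1 h2 => ?_
    have hζ : IsTest (fun x => ζ x • e₃) :=
      IsTest.clm (f := ζ) ⟨h1, h2⟩ (ContinuousLinearMap.toSpanSingleton ℝ e₃)
    obtain ⟨f, hf, hmem⟩ := hd _ _ _ (H2.of_test hζ)
    have hv3 : MemLp (fun x => v x • e₃) 2 volume :=
      (ContinuousLinearMap.toSpanSingleton ℝ e₃).comp_memLp' hv
    have hl := hf.val.tendsto_integral_inner hv3 (fun n => (hf.test n).memLp 2) (hζ.memLp 2)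
    have h0 : ∀ n, ∫ x, ⟪v x • e₃, f n x⟫_ℝ = 0 := fun n => by
      rw [← h _ ⟨f n, hmem n, rfl⟩]
      simp only [inner_smul_left, RCLike.conj_to_real, mul_comm]
    simp only [h0] at hl
    have := tendsto_nhds_unique hl tendsto_const_nhds
    simpa [inner_smul_left, inner_smul_right, inner_e₃_self, mul_comm, norm_e₃] using this

theorem IsTest.scalar_memLp_slab {ζ : E3 → ℝ} (hζ : IsTest ζ) (p : ℝ≥0∞) (T : ℝ) :
    MemLp (fun z : ℝ × E3 => ζ z.2) p (slab T) :=
  (hζ.memLp p).comp_snd _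

theorem integrable_mul_of_memLp_two {Ω : Type*} [MeasurableSpace Ω] {μ : Measure Ω} {f g : Ω → ℝ}
    (hf : MemLp f 2 μ) (hg : MemLp g 2 μ) : Integrable (fun x => f x * g x) μ :=
  hf.integrable_mul hg

/-- For each of countably many ζ the pairing ∫ζ w(t) has weak derivative ∫ζ a(t) and limit zero at
time zero, so `ae_eq_primitive` applies. Fubini moves the time integral inside the pairing. -/
theorem ae_eq_primitive_field {w a : ℝ → E3 → ℝ} {A : ℝ × E3 → ℝ} (hA : StronglyMeasurable A)
    (hAa : ∀ᵐ t ∂timeMeasure, ∀ᵐ x, a t x = A (t, x)) (hA2 : ∀ T, MemLp A 2 (slab T))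
    (hw : ∀ T, MemLp (fun z : ℝ × E3 => w z.1 z.2) 2 (slab T))
    (hwt : ∀ᵐ t ∂timeMeasure, MemLp (w t) 2 volume)
    (hweak : ∀ ζ : E3 → ℝ, IsTest ζ → ∀ η : ℝ → ℝ, ContDiff ℝ ∞ η → HasCompactSupport η →
      tsupport η ⊆ Ioi 0 → ∫ t, deriv η t * ∫ x, ζ x * w t x = -∫ t, η t * ∫ x, ζ x * a t x)
    (h0 : Tendsto (fun t => eLpNorm (w t) 2 volume) (𝓝[>] (0 : ℝ) ⊓ ae volume) (𝓝 0)) :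
    ∀ᵐ t ∂timeMeasure, w t =ᵐ[volume] fun x => primitive A (t, x) := by
  obtain ⟨𝓢, hc, ht, hd⟩ := exists_countable_scalar_test
  have h : ∀ ζ ∈ 𝓢, ∀ᵐ t ∂timeMeasure, ∫ x, ζ x * w t x = ∫ x, ζ x * primitive A (t, x) := by
    intro ζ hζ
    have T := ht ζ hζ
    have iw := fun S => integrable_mul_of_memLp_two (T.scalar_memLp_slab 2 S) (hw S)
    have iA := fun S => integrable_mul_of_memLp_two (T.scalar_memLp_slab 2 S) (hA2 S)
    have he : ∀ᵐ t ∂timeMeasure, ∫ x, ζ x * a t x = ∫ x, ζ x * A (t, x) :=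
      hAa.mono fun t ht => integral_congr_ae (ht.mono fun x hx => by simp only [hx])
    have key := ae_eq_primitive (g := fun t => ∫ x, ζ x * w t x)
      (b := fun t => ∫ x, ζ x * A (t, x)) (integrableOn_slice iw) (integrableOn_slice iA)
      (fun η h1 h2 h3 => by
        rw [hweak ζ T η h1 h2 h3]
        congr 1
        refine integral_congr_ae ?_
        filter_upwards [(ae_restrict_iff' measurableSet_Ioi).1 he] with t ht
        by_cases h : t ∈ Ioi (0 : ℝ)
        · simp only [ht h]
        · simp [image_eq_zero_of_notMem_tsupport fun h' => h (h3 h')]) ?_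
    · filter_upwards [key, ae_restrict_mem measurableSet_Ioi] with t hk ht0
      have ht0' : (0 : ℝ) ≤ t := le_of_lt ht0
      rw [hk, intervalIntegral.integral_of_le ht0', integral_Ioc_eq_integral_Ioo]
      have hsw := integral_integral_swap (μ := volume.restrict (Ioo 0 t)) (ν := volume)
        (f := fun s x => ζ x * A (s, x)) (iA t)
      rw [hsw]
      refine integral_congr_ae (Eventually.of_forall fun x => ?_)
      simp only
      rw [integral_const_mul, primitive_eq A ht0', intervalIntegral.integral_of_le ht0',
        integral_Ioc_eq_integral_Ioo]
    · have hz : Tendsto (fun t => (eLpNorm ζ 2 volume * eLpNorm (w t) 2 volume).toReal)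
          (𝓝[>] (0 : ℝ) ⊓ ae volume) (𝓝 0) := by
        have h1 := ENNReal.Tendsto.const_mul (a := eLpNorm ζ 2 volume) h0
          (Or.inr (T.memLp 2).2.ne)
        rw [mul_zero] at h1
        exact (ENNReal.tendsto_toReal ENNReal.zero_ne_top).comp h1
      refine squeeze_zero_norm' ?_ hz
      have hwt' := (ae_restrict_iff' measurableSet_Ioi).1 hwt
      refine mem_inf_of_inter self_mem_nhdsWithin hwt' fun t ht => ?_
      have hm := ht.2 ht.1
      have h1 : ‖∫ x, ζ x * w t x‖ₑ ≤ eLpNorm ζ 2 volume * eLpNorm (w t) 2 volume := by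
        refine (enorm_integral_le_lintegral_enorm _).trans ?_
        rw [← eLpNorm_one_eq_lintegral_enorm]
        exact eLpNorm_mul_le_real (p := 2) (q := 2) (T.memLp 2).1 hm.1
      have h2 := ENNReal.toReal_mono (ENNReal.mul_ne_top (T.memLp 2).2.ne hm.2.ne) h1
      simpa using h2
  filter_upwards [(ae_ball_iff hc).2 h, hwt] with t htt hwt'
  have hp := memLp_primitive hA hA2 t
  have := hd _ (hwt'.sub hp) fun ζ hζ => by
    simp only [Pi.sub_apply, mul_sub]
    rw [integral_sub (integrable_mul_of_memLp_two ((ht ζ hζ).memLp 2) hwt')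
      (integrable_mul_of_memLp_two ((ht ζ hζ).memLp 2) hp), htt ζ hζ, sub_self]
  filter_upwards [this] with x hx
  exact sub_eq_zero.1 hx

/-- Replace w by its pointwise primitive in time, differentiate the square along almost every time
line, and integrate in x with Fubini. This avoids calculus for L²-valued functions. -/
theorem energy_identity {w a : ℝ → E3 → ℝ}
    (ha : MemLp (fun z : ℝ × E3 => a z.1 z.2) 2 spaceTimeMeasure)
    (hw : ∀ T, MemLp (fun z : ℝ × E3 => w z.1 z.2) 2 (slab T))
    (hwt : ∀ᵐ t ∂timeMeasure, MemLp (w t) 2 volume)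
    (hweak : ∀ ζ : E3 → ℝ, IsTest ζ → ∀ η : ℝ → ℝ, ContDiff ℝ ∞ η → HasCompactSupport η →
      tsupport η ⊆ Ioi 0 → ∫ t, deriv η t * ∫ x, ζ x * w t x = -∫ t, η t * ∫ x, ζ x * a t x)
    (h0 : Tendsto (fun t => eLpNorm (w t) 2 volume) (𝓝[>] (0 : ℝ) ⊓ ae volume) (𝓝 0)) :
    ∀ᵐ t ∂timeMeasure, ∫ x, w t x ^ 2 = 2 * ∫ s in Ioo 0 t, ∫ x, w s x * a s x := by
  obtain ⟨A, hA, hAa⟩ := ha.1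
  have hA2 : ∀ T, MemLp A 2 (slab T) := fun T => (ha.ae_eq hAa).mono_measure (slab_le T)
  have hAa' : ∀ᵐ t ∂timeMeasure, ∀ᵐ x, a t x = A (t, x) := Measure.ae_ae_of_ae_prod hAa
  have hW := ae_eq_primitive_field hA hAa' hA2 hw hwt hweak h0
  have hWm := stronglyMeasurable_primitive hA
  have hslab : ∀ T, (fun z : ℝ × E3 => w z.1 z.2) =ᵐ[slab T] primitive A := fun T =>
    ae_eq_prod_of_slices (hw T).1 hWm.aestronglyMeasurable (ae_Ioo_of_timeMeasure hW T)
  have hWA : ∀ T, Integrable (fun z => primitive A z * A z) (slab T) := fun T =>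
    integrable_mul_of_memLp_two ((hw T).ae_eq (hslab T)) (hA2 T)
  filter_upwards [hW, ae_restrict_mem measurableSet_Ioi] with t ht ht0
  have ht0' : (0 : ℝ) ≤ t := le_of_lt ht0
  have e1 : ∫ x, w t x ^ 2 = ∫ x, 2 * ∫ s in Ioo 0 t, primitive A (s, x) * A (s, x) := by
    refine integral_congr_ae ?_
    filter_upwards [ht, ae_integrableOn_line hA2] with x hx hxl
    rw [hx, primitive_sq hxl ht0']
  rw [e1, integral_const_mul]
  congr 1
  have hsw := integral_integral_swap (μ := volume.restrict (Ioo 0 t)) (ν := volume)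
    (f := fun s x => primitive A (s, x) * A (s, x)) (hWA t)
  rw [← hsw]
  refine integral_congr_ae ?_
  filter_upwards [ae_Ioo_of_timeMeasure hW t, ae_Ioo_of_timeMeasure hAa' t] with s h1 h2
  refine integral_congr_ae ?_
  filter_upwards [h1, h2] with x hx1 hx2
  simp only [hx1, hx2]

/-! ### Gronwall's inequality -/

/-- Iterating the inequality gives y(t) ≤ M (C t)ⁿ / n! for every n. No continuity of y is required.
-/
theorem ae_eq_zero_of_le_integral {y : ℝ → ℝ} {M C : ℝ} (hC : 0 ≤ C)
    (hi : ∀ T, IntegrableOn y (Ioo 0 T)) (h0 : ∀ᵐ t ∂timeMeasure, 0 ≤ y t)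
    (hM : ∀ᵐ t ∂timeMeasure, y t ≤ M)
    (h : ∀ᵐ t ∂timeMeasure, y t ≤ C * ∫ s in Ioo 0 t, y s) : ∀ᵐ t ∂timeMeasure, y t = 0 := by
  have key : ∀ n : ℕ, ∀ᵐ t ∂timeMeasure, y t ≤ M * ((C * t) ^ n / n.factorial) := by
    intro n
    induction n with
    | zero => simpa using hM
    | succ n ih =>
      filter_upwards [h, ae_restrict_mem measurableSet_Ioi] with t ht ht0
      have ht0' : (0 : ℝ) ≤ t := le_of_lt ht0
      have hc : Continuous fun s : ℝ => M * ((C * s) ^ n / n.factorial) := by fun_prop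
      refine ht.trans ?_
      have h1 : ∫ s in Ioo 0 t, y s ≤ ∫ s in Ioo 0 t, M * ((C * s) ^ n / n.factorial) :=
        integral_mono_ae (hi t) (hc.integrableOn_Icc.mono_set Ioo_subset_Icc_self)
          (ae_Ioo_of_timeMeasure ih t)
      refine (mul_le_mul_of_nonneg_left h1 hC).trans (le_of_eq ?_)
      rw [← integral_Ioc_eq_integral_Ioo, ← intervalIntegral.integral_of_le ht0']
      simp only [mul_pow, mul_div_assoc]
      rw [intervalIntegral.integral_const_mul, intervalIntegral.integral_const_mul,
        intervalIntegral.integral_div, integral_pow, Nat.factorial_succ]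
      push_cast
      have : (n : ℝ) + 1 ≠ 0 := by positivity
      field_simp
      ring
  filter_upwards [ae_all_iff.2 key, h0] with t ht ht0
  refine le_antisymm ?_ ht0
  have hl := (FloorSemiring.tendsto_pow_div_factorial_atTop (C * t)).const_mul M
  rw [mul_zero] at hl
  exact ge_of_tendsto' hl ht

/-! ### Uniqueness -/

variable {m mt m' mt' : ℝ → E3 → E3} {D D' : Fin 3 → ℝ → E3 → E3}
  {D2 D2' : Fin 3 → Fin 3 → ℝ → E3 → E3}

theorem IsRegular.integrable_test (H : IsRegular m mt D D2) {ζ : E3 → ℝ} (hζ : IsTest ζ) (T : ℝ) :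
    Integrable (fun z : ℝ × E3 => ζ z.2 • m z.1 z.2) (slab T) :=
  memLp_one_iff_integrable.1 ((memLp_top_of_sphere (H.sphere_slab T)
    (H.memL2.memLp_slab two_ne_zero (by simp) T)).smul (r := 1) (hζ.scalar_memLp_slab 1 T))

theorem IsRegular.integrable_test_time (H : IsRegular m mt D D2) {ζ : E3 → ℝ} (hζ : IsTest ζ)
    (T : ℝ) : Integrable (fun z : ℝ × E3 => ζ z.2 • mt z.1 z.2) (slab T) :=
  memLp_one_iff_integrable.1 ((H.memL2_mt.mono_measure (slab_le T)).smul (r := 1)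
    (hζ.scalar_memLp_slab 2 T))

theorem IsRegular.weak_time (H : IsRegular m mt D D2) {ζ : E3 → ℝ} (hζ : IsTest ζ) {η : ℝ → ℝ}
    (h1 : ContDiff ℝ ∞ η) (h2 : HasCompactSupport η) (h3 : tsupport η ⊆ Ioi 0) :
    ∫ z, deriv η z.1 • (ζ z.2 • m z.1 z.2) ∂spaceTimeMeasure =
      -∫ z, η z.1 • (ζ z.2 • mt z.1 z.2) ∂spaceTimeMeasure := by
  have := H.weak_mt (tensorTest h1 h2 h3 hζ)
  simp only [tensorTest_time] at this
  simpa only [tensorTest_apply, smul_assoc] using this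

theorem weak_time_diff (H : IsRegular m mt D D2) (H' : IsRegular m' mt' D' D2') (k : Fin 3)
    {ζ : E3 → ℝ} (hζ : IsTest ζ) {η : ℝ → ℝ}
    (h1 : ContDiff ℝ ∞ η) (h2 : HasCompactSupport η) (h3 : tsupport η ⊆ Ioi 0) :
    ∫ t, deriv η t * ∫ x, ζ x * (m t x k - m' t x k) =
      -∫ t, η t * ∫ x, ζ x * (mt t x k - mt' t x k) := by
  have c1 : Continuous (deriv η) := (contDiff_infty_iff_deriv.1 h1).2.continuous
  have s1 : tsupport (deriv η) ⊆ Ioi 0 := (tsupport_deriv_subset (f := η)).trans h3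
  have i := (integral_time_test c1 h2.deriv s1 (H.integrable_test hζ)).1
  have i' := (integral_time_test c1 h2.deriv s1 (H'.integrable_test hζ)).1
  have q := (integral_time_test h1.continuous h2 h3 (H.integrable_test_time hζ)).1
  have q' := (integral_time_test h1.continuous h2 h3 (H'.integrable_test_time hζ)).1
  have e : ∫ z, deriv η z.1 • (ζ z.2 • (m z.1 z.2 - m' z.1 z.2)) ∂spaceTimeMeasure =
      -∫ z, η z.1 • (ζ z.2 • (mt z.1 z.2 - mt' z.1 z.2)) ∂spaceTimeMeasure := by
    simp only [smul_sub]
    rw [integral_sub i i', integral_sub q q', H.weak_time hζ h1 h2 h3, H'.weak_time hζ h1 h2 h3]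
    abel
  have d := fun T => (H.integrable_test hζ T).sub (H'.integrable_test hζ T)
  have dt := fun T => (H.integrable_test_time hζ T).sub (H'.integrable_test_time hζ T)
  have e' := congrArg (EuclideanSpace.proj (𝕜 := ℝ) k : E3 →L[ℝ] ℝ) e
  rw [map_neg, ← ContinuousLinearMap.integral_comp_comm _ ((i.sub i').congr
      (Eventually.of_forall fun z => by simp [smul_sub])),
    ← ContinuousLinearMap.integral_comp_comm _ ((q.sub q').congr
      (Eventually.of_forall fun z => by simp [smul_sub]))] at e'
  have t1 := (integral_time_test c1 h2.deriv s1 (G := fun z : ℝ × E3 =>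
    ζ z.2 * (m z.1 z.2 k - m' z.1 z.2 k)) fun T =>
      ((EuclideanSpace.proj (𝕜 := ℝ) k).integrable_comp (d T)).congr
        (Eventually.of_forall fun z => by simp [mul_sub])).2
  have t2 := (integral_time_test h1.continuous h2 h3 (G := fun z : ℝ × E3 =>
    ζ z.2 * (mt z.1 z.2 k - mt' z.1 z.2 k)) fun T =>
      ((EuclideanSpace.proj (𝕜 := ℝ) k).integrable_comp (dt T)).congr
        (Eventually.of_forall fun z => by simp [mul_sub])).2
  simp only [smul_eq_mul] at t1 t2
  rw [← t1, ← t2]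
  simpa using e'

theorem IsRegular.diff_memLinf (H : IsRegular m mt D D2) (H' : IsRegular m' mt' D' D2') :
    MemLinfLp 2 (fun t x => m t x - m' t x) := by
  obtain ⟨a, A, hA⟩ := H.memL2
  obtain ⟨b, B, hB⟩ := H'.memL2
  refine ⟨(a.sub b).congr (Eventually.of_forall fun z => by simp), A + B, ?_⟩
  filter_upwards [hA, hB, a.prodMk_left, b.prodMk_left] with t h1 h2 h3 h4
  have e : (fun x => m t x - m' t x) = (fun x => m t x - e₃) - fun x => m' t x - e₃ := by
    ext1 x; simp
  rw [e]
  push_cast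
  exact (eLpNorm_sub_le h3 h4 one_le_two).trans (add_le_add h1 h2)

theorem memLp_coord {Ω : Type*} [MeasurableSpace Ω] {μ : Measure Ω} {p : ℝ≥0∞} {u : Ω → E3}
    (hu : MemLp u p μ) (k : Fin 3) : MemLp (fun z => u z k) p μ :=
  (EuclideanSpace.proj (𝕜 := ℝ) k).comp_memLp' hu

theorem eLpNorm_coord_le (u : E3 → E3) (k : Fin 3) :
    eLpNorm (fun x => u x k) 2 volume ≤ eLpNorm u 2 volume :=
  eLpNorm_mono fun x => PiLp.norm_apply_le (u x) k

theorem tendsto_diff_initial (H : IsRegular m mt D D2) (H' : IsRegular m' mt' D' D2')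
    {m₀ : E3 → E3} (h0 : MemH2Sphere m₀) (hi : HasInitialValue m m₀) (hi' : HasInitialValue m' m₀) :
    Tendsto (fun t => eLpNorm (fun x => m t x - m' t x) 2 volume)
      (𝓝[>] (0 : ℝ) ⊓ ae volume) (𝓝 0) := by
  have hs := hi.add hi'
  rw [add_zero] at hs
  refine tendsto_of_tendsto_of_tendsto_of_le_of_le' tendsto_const_nhds hs
    (Eventually.of_forall fun _ => zero_le) ?_
  have h1 := (ae_restrict_iff' measurableSet_Ioi).1 (H.memL2.memLp_slice.and H'.memL2.memLp_slice)
  refine mem_inf_of_inter self_mem_nhdsWithin h1 fun t ht => ?_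
  obtain ⟨a, b⟩ := ht.2 ht.1
  have e : (fun x => m t x - m' t x) = (fun x => m t x - m₀ x) - fun x => m' t x - m₀ x := by
    ext1 x; simp
  have a' : AEStronglyMeasurable (fun x => m t x - m₀ x) :=
    (a.1.sub h0.2.1.1).congr (Eventually.of_forall fun x => by simp)
  have b' : AEStronglyMeasurable (fun x => m' t x - m₀ x) :=
    (b.1.sub h0.2.1.1).congr (Eventually.of_forall fun x => by simp)
  change eLpNorm (fun x => m t x - m' t x) 2 volume ≤ _
  rw [e]
  exact eLpNorm_sub_le a' b' one_le_two

/-- The scalar identity is applied to each coordinate of the difference and summed. -/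
theorem energy_identity_diff (H : IsRegular m mt D D2) (H' : IsRegular m' mt' D' D2')
    {m₀ : E3 → E3} (h0 : MemH2Sphere m₀) (hi : HasInitialValue m m₀) (hi' : HasInitialValue m' m₀) :
    ∀ᵐ t ∂timeMeasure, ∫ x, ⟪m t x - m' t x, m t x - m' t x⟫_ℝ =
      2 * ∫ s in Ioo 0 t, ∫ x, ⟪mt s x - mt' s x, m s x - m' s x⟫_ℝ := by
  have hd := H.diff_memLinf H'
  have ha := H.memL2_mt.sub H'.memL2_mt
  have hw := fun T => hd.memLp_slab two_ne_zero (by simp) T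
  have hT := tendsto_diff_initial H H' h0 hi hi'
  have key := fun k : Fin 3 => energy_identity (w := fun t x => m t x k - m' t x k)
    (a := fun t x => mt t x k - mt' t x k) (memLp_coord ha k) (fun T => memLp_coord (hw T) k)
    (hd.memLp_slice.mono fun t ht => memLp_coord ht k)
    (fun ζ hζ η h1 h2 h3 => weak_time_diff H H' k hζ h1 h2 h3)
    (tendsto_of_tendsto_of_tendsto_of_le_of_le tendsto_const_nhds hT (fun _ => zero_le)
      fun t => eLpNorm_coord_le (fun x => m t x - m' t x) k)
  have hsl : ∀ᵐ t ∂timeMeasure, MemLp (fun x => m t x - m' t x) 2 volume ∧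
      MemLp (fun x => mt t x - mt' t x) 2 volume := by
    filter_upwards [hd.memLp_slice, memLp_slice_of_memLp H.memL2_mt,
      memLp_slice_of_memLp H'.memL2_mt] with t h1 h2 h3
    exact ⟨h1, h2.sub h3⟩
  have hslab : ∀ (k : Fin 3) (t : ℝ), IntegrableOn
      (fun s => ∫ x, (m s x k - m' s x k) * (mt s x k - mt' s x k)) (Ioo 0 t) := fun k t =>
    integrableOn_slice (G := fun z : ℝ × E3 => (m z.1 z.2 k - m' z.1 z.2 k) *
      (mt z.1 z.2 k - mt' z.1 z.2 k)) (fun T => integrable_mul_of_memLp_two (memLp_coord (hw T) k)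
        (memLp_coord (ha.mono_measure (slab_le T)) k)) t
  filter_upwards [ae_all_iff.2 key, hsl] with t ht hst
  have e1 : ∫ x, ⟪m t x - m' t x, m t x - m' t x⟫_ℝ = ∑ k, ∫ x, (m t x k - m' t x k) ^ 2 := by
    have c : ∀ k, Integrable fun x => (m t x k - m' t x k) ^ 2 := fun k =>
      (memLp_coord hst.1 k).integrable_sq
    rw [← integral_finsetSum _ fun k _ => c k]
    refine integral_congr_ae (Eventually.of_forall fun x => ?_)
    simp only [inner_E3, Fin.sum_univ_three, PiLp.sub_apply]
    ring
  rw [e1, Finset.sum_congr rfl fun k _ => ht k, ← Finset.mul_sum,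
    ← integral_finsetSum _ fun k _ => hslab k t]
  congr 1
  refine integral_congr_ae ?_
  filter_upwards [ae_Ioo_of_timeMeasure hsl t] with s hs
  change ∑ k, ∫ x, (m s x k - m' s x k) * (mt s x k - mt' s x k) = _
  have c : ∀ k, Integrable fun x => (m s x k - m' s x k) * (mt s x k - mt' s x k) := fun k =>
    integrable_mul_of_memLp_two (memLp_coord hs.1 k) (memLp_coord hs.2 k)
  rw [← integral_finsetSum _ fun k _ => c k]
  refine integral_congr_ae (Eventually.of_forall fun x => ?_)
  simp only [inner_E3, Fin.sum_univ_three, PiLp.sub_apply]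
  ring

theorem toReal_eLpNorm_sq {f : E3 → E3} (hf : MemLp f 2 volume) :
    (eLpNorm f 2 volume).toReal ^ 2 = ∫ x, ⟪f x, f x⟫_ℝ := by
  rw [← ENNReal.toReal_pow, eLpNorm_sq_eq hf, ENNReal.toReal_ofReal]
  exact integral_nonneg fun x => real_inner_self_nonneg

theorem IsSolution.unique {α h : ℝ} (hα : 0 < α) {j : ℝ → E3 → E3} (hj : MemLinfLp (6 / 5) j)
    {m₀ : E3 → E3} (h0 : MemH2Sphere m₀) (hs : IsSolution α h j m) (hs' : IsSolution α h j m')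
    (hi : HasInitialValue m m₀) (hi' : HasInitialValue m' m₀) :
    ∀ᵐ t ∂timeMeasure, ∀ᵐ x, m t x = m' t x := by
  obtain ⟨mt, D, D2, M, H, hsl⟩ := hs.exists_slice hj
  obtain ⟨mt', D', D2', M', H', hsl'⟩ := hs'.exists_slice hj
  -- One constant must serve both solutions, hence the larger of the two bounds.
  obtain ⟨K, hK, hen⟩ := exists_energy_le hα h (max M M')
  have hd := H.diff_memLinf H'
  obtain ⟨-, B, hB⟩ := H.diff_memLinf H'
  have hid := energy_identity_diff H H' h0 hi hi'
  set y : ℝ → ℝ := fun t => ∫ x, ⟪m t x - m' t x, m t x - m' t x⟫_ℝ with hy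
  have hyi : ∀ T, IntegrableOn y (Ioo 0 T) := integrableOn_slice (G := fun z : ℝ × E3 =>
    ⟪m z.1 z.2 - m' z.1 z.2, m z.1 z.2 - m' z.1 z.2⟫_ℝ) fun T =>
      have := hd.memLp_slab two_ne_zero (by simp) T
      integrable_inner_of_memLp this this
  have hai : ∀ T, IntegrableOn (fun s => ∫ x, ⟪mt s x - mt' s x, m s x - m' s x⟫_ℝ) (Ioo 0 T) :=
    integrableOn_slice (G := fun z : ℝ × E3 =>
      ⟪mt z.1 z.2 - mt' z.1 z.2, m z.1 z.2 - m' z.1 z.2⟫_ℝ) fun T =>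
        integrable_inner_of_memLp ((H.memL2_mt.sub H'.memL2_mt).mono_measure (slab_le T))
          (hd.memLp_slab two_ne_zero (by simp) T)
  have hle : ∀ᵐ t ∂timeMeasure, ∫ x, ⟪mt t x - mt' t x, m t x - m' t x⟫_ℝ ≤ K * y t := by
    filter_upwards [hsl, hsl', hd.memLp_slice] with t h1 h2 h3
    have hyt : y t = _ := (toReal_eLpNorm_sq h3).symm
    rw [hyt]
    exact hen _ _ _ _ _ _ _ _ _ (h1.mono (le_max_left _ _)) (h2.mono (le_max_right _ _))
  -- The constant 2 K combines the factor 2 of the energy identity with the energy estimate; B² is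
  -- the a priori bound that starts the iteration.
  have hy0 := ae_eq_zero_of_le_integral (y := y) (M := (B : ℝ) ^ 2) (C := 2 * K) (by positivity) hyi
    (Eventually.of_forall fun t => integral_nonneg fun x => real_inner_self_nonneg) ?_ ?_
  · filter_upwards [hy0, hd.memLp_slice] with t ht hmt
    have h1 := (integral_eq_zero_iff_of_nonneg (fun x => real_inner_self_nonneg)
      (integrable_inner_of_memLp hmt hmt)).1 ht
    filter_upwards [h1] with x hx
    exact sub_eq_zero.1 (inner_self_eq_zero.1 hx)
  · filter_upwards [hB, hd.memLp_slice] with t ht hmt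
    have hyt : y t = _ := (toReal_eLpNorm_sq hmt).symm
    rw [hyt]
    exact pow_le_pow_left₀ ENNReal.toReal_nonneg
      (by simpa using ENNReal.toReal_mono ENNReal.coe_ne_top ht) 2
  · filter_upwards [hid] with t ht
    have h1 := integral_mono_ae (hai t) ((hyi t).const_mul K) (ae_Ioo_of_timeMeasure hle t)
    rw [integral_const_mul] at h1
    have hyt : y t = _ := ht
    linarith

end LLG

end

theorem theorem2 (α h : ℝ) (hα : 0 < α)
    (j : ℝ → LLG.E3 → LLG.E3) (hj : LLG.MemLinfLp (6 / 5) j)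
    (m₀ : LLG.E3 → LLG.E3) (hm₀ : LLG.MemH2Sphere m₀)
    (m₁ m₂ : ℝ → LLG.E3 → LLG.E3)
    (h₁ : LLG.IsSolution α h j m₁) (h₂ : LLG.IsSolution α h j m₂)
    (hi₁ : LLG.HasInitialValue m₁ m₀) (hi₂ : LLG.HasInitialValue m₂ m₀) :
    ∀ᵐ t ∂(volume.restrict (Ioi (0 : ℝ))), ∀ᵐ x : LLG.E3, m₁ t x = m₂ t x :=
  LLG.IsSolution.unique hα hj hm₀ h₁ h₂ hi₁ hi₂
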